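/- Let $X$ be a complex manifold. A (smooth, exact) complex Courant algebroid $(E,\pi,\langle\cdot,\cdot\rangle,[\cdot,\cdot])$ over $X$ is a smooth complex vector bundle which is an extension $0\to T^*X\otimes\mathbb C\xrightarrow{\iota}E\xrightarrow{\pi}TX\otimes\mathbb C\to 0$, with a nondegenerate symmetric pairing satisfying $\langle\iota\xi,e\rangle=\tfrac12\xi(\pi e)$ and a bracket on its sheaf of smooth sections, such that near every point some smooth splitting of $\pi$ identifies $E$ with $(TX\oplus T^*X)\otimes\mathbb C$ equipped with $\langle Z+\xi,W+\eta\rangle=\tfrac12(\xi(W)+\eta(Z))$ and $[Z+\xi,W+\eta]=[Z,W]+L_Z\eta-i_Wd\xi$. A holomorphic Courant algebroid over $X$ is the same notion in the holomorphic category: a holomorphic vector bundle, an extension of $T_{1,0}X$ by $T^*_{1,0}X$ (the holomorphic tangent and cotangent bundles), with a holomorphic pairing and a bracket on its sheaf of holomorphic sections, which near every point is identified by a holomorphic splitting with $T_{1,0}X\oplus T_{1,0}^*X$ with its standard pairing and Courant bracket. A lifting of $T_{0,1}X$ to $E$ is an isotropic, involutive smooth subbundle $D\subset E$ mapped isomorphically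 onto $T_{0,1}X$ by $\pi$. **Theorem.** A lifting $D$ of $T_{0,1}X$ to a complex Courant algebroid $E$ over $X$ determines a natural holomorphic Courant algebroid $E_D$ over $X$. Concretely: 1. $E_D=D^\perp/D$ is a smooth complex vector bundle, and $\bar\partial_Z s=[\tilde Z,\tilde s]\bmod D$, where $\tilde Z\in\Gamma(D)$ is the lift of $Z\in\Gamma(T_{0,1}X)$ and $\tilde s\in\Gamma(D^\perp)$ is any lift of $s\in\Gamma(E_D)$, is a well-defined $\bar\partial$-operator on it (it satisfies the Leibniz rule and $\bar\partial^2=0$). 2. With the $\bar\partial$-closed smooth sections as holomorphic sections, $E_D$ is a holomorphic Courant algebroid, whose extension maps $T^*_{1,0}X\to E_D\to T_{1,0}X$ and pairing are induced by those of $E$, and whose bracket on holomorphic sections is $[s,t]=[\tilde s,\tilde t]\bmod D$ for any lifts $\tilde s,\tilde t\in\Gamma(D^\perp)$. 3. This is natural: if $\Phi:E\to E'$ is an isomorphism of complex Courant algebroids over $X$ and $D'=\Phi(D)$ is a lifting of $T_{0,1}X$ to $E'$, then $\Phi$ induces a smooth isomorphism $D^\perp/D\to D'^\perp/D'$ which intertwines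 the $\bar\partial$-operators and is an isomorphism of holomorphic Courant algebroids $E_D\to E'_{D'}$. -/

import Mathlib

open scoped Manifold ContDiff TensorProduct
open Set TopologicalSpace

noncomputable section

namespace Courant

/-! ## Vector bundles as families of vector spaces with a locally free sheaf of sections

Sections over an open set `U` are represented by functions `s : Π x, F x` defined on all of `X`;
only their values on `U` matter. -/

/-- `Sec U s` ("`s` is a section over `U`") makes the family `F` of complex vector spaces a vector
bundle over the sheaf of functions `Fn`: sections form a sheaf, and near every point there
is a frame such that sections are exactly the combinations of the frame with coefficients
in `Fn`. -/
structure IsVectorBundle {X : Type*} [TopologicalSpace X] (Fn : Opens X → (X → ℂ) → Prop)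
    (F : X → Type*) [∀ x, AddCommGroup (F x)] [∀ x, Module ℂ (F x)]
    (Sec : Opens X → (∀ x, F x) → Prop) : Prop where
  restrict : ∀ (U W : Opens X) (s : ∀ x, F x), W ≤ U → Sec U s → Sec W s
  glue : ∀ (U : Opens X) (s : ∀ x, F x),
    (∀ x ∈ U, ∃ W : Opens X, x ∈ W ∧ W ≤ U ∧ Sec W s) → Sec U s
  frame : ∀ x₀ : X, ∃ U : Opens X, x₀ ∈ U ∧ ∃ (r : ℕ) (e : Fin r → ∀ x, F x),
    (∀ x ∈ U, LinearIndependent ℂ (fun i => e i x) ∧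
      Submodule.span ℂ (Set.range fun i => e i x) = ⊤) ∧
    ∀ (W : Opens X) (s : ∀ x, F x), W ≤ U →
      (Sec W s ↔ ∃ c : Fin r → X → ℂ, (∀ i, Fn W (c i)) ∧ ∀ x ∈ W, s x = ∑ i, c i x • e i x)

/-! ## Exterior derivative of a one-form, over the reals or the complex numbers -/

section OneForms

variable (𝕜 : Type*) [NontriviallyNormedField 𝕜] [NormedSpace 𝕜 ℂ]
  {V : Type*} [NormedAddCommGroup V] [NormedSpace 𝕜 V]
  {X : Type*} [TopologicalSpace X] [ChartedSpace V X]

/-- The coordinate expression of a `ℂ`-valued one-form in the preferred chart at `x₀`, that is, its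
pull-back to the model space by the inverse of the chart. -/
def formInChart (x₀ : X) (ξ : ∀ x : X, TangentSpace 𝓘(𝕜, V) x →L[𝕜] ℂ) : V → V →L[𝕜] ℂ :=
  fun y => (ξ ((extChartAt 𝓘(𝕜, V) x₀).symm y)).comp
    (mfderiv 𝓘(𝕜, V) 𝓘(𝕜, V) (extChartAt 𝓘(𝕜, V) x₀).symm y)

/-- A one-form is smooth over `U` when its coordinate expressions are. -/
def SmoothForm (U : Opens X) (ξ : ∀ x : X, TangentSpace 𝓘(𝕜, V) x →L[𝕜] ℂ) : Prop :=
  ∀ x₀ : X, ContDiffOn 𝕜 ∞ (formInChart 𝕜 x₀ ξ)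
    ((extChartAt 𝓘(𝕜, V) x₀).target ∩ (extChartAt 𝓘(𝕜, V) x₀).symm ⁻¹' U)

/-- The exterior derivative of a one-form, `(dξ)ₓ(u)(v) = (∂ᵤξ)(v) - (∂ᵥξ)(u)`, computed
in the preferred chart at `x`, in which the tangent space at `x` is `V`. -/
def extD (ξ : ∀ x : X, TangentSpace 𝓘(𝕜, V) x →L[𝕜] ℂ) (x : X) : V →L[𝕜] V →L[𝕜] ℂ :=
  fderiv 𝕜 (formInChart 𝕜 x ξ) (extChartAt 𝓘(𝕜, V) x x) -
    (fderiv 𝕜 (formInChart 𝕜 x ξ) (extChartAt 𝓘(𝕜, V) x x)).flip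

/-- The contraction `i_A dξ` of the exterior derivative with a tangent vector `A` at `x`. -/
def contract (ξ : ∀ x : X, TangentSpace 𝓘(𝕜, V) x →L[𝕜] ℂ) (x : X) (A : TangentSpace 𝓘(𝕜, V) x) :
    TangentSpace 𝓘(𝕜, V) x →L[𝕜] ℂ :=
  extD 𝕜 ξ x A

/-- Smooth vector fields over `U`. -/
def SmoothField [IsManifold 𝓘(𝕜, V) 1 X] (U : Opens X)
    (A : ∀ x : X, TangentSpace 𝓘(𝕜, V) x) : Prop :=
  ContMDiffOn 𝓘(𝕜, V) 𝓘(𝕜, V).tangent ∞ (fun x => (⟨x, A x⟩ : TangentBundle 𝓘(𝕜, V) X)) U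

end OneForms

section ComplexManifold

variable {V : Type*} [NormedAddCommGroup V] [NormedSpace ℂ V]
  {X : Type*} [TopologicalSpace X] [ChartedSpace V X]

/-- The smooth manifold underlying a complex manifold. -/
instance realManifold [IsManifold 𝓘(ℂ, V) ∞ X] : IsManifold 𝓘(ℝ, V) ∞ X := by
  apply isManifold_of_contDiffOn
  intro e e' he he'
  have h := (contDiffGroupoid ∞ 𝓘(ℂ, V)).compatible he he'
  rw [contDiffGroupoid, mem_groupoid_of_pregroupoid] at h
  have h1 : ContDiffOn ℂ ∞ (𝓘(ℂ, V) ∘ e.symm ≫ₕ e' ∘ 𝓘(ℂ, V).symm)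
    (𝓘(ℂ, V).symm ⁻¹' (e.symm ≫ₕ e').source ∩ range 𝓘(ℂ, V)) := h.1
  exact h1.restrict_scalars ℝ

/-! ## The complexified tangent and cotangent bundles -/

variable (V) in
/-- The fibre of `TX ⊗ ℂ`. -/
abbrev CT (x : X) : Type _ := ℂ ⊗[ℝ] TangentSpace 𝓘(ℝ, V) x

variable (V) in
/-- The fibre of `T*X ⊗ ℂ`: real-linear complex-valued forms on the real tangent space. -/
abbrev CForm (x : X) : Type _ := TangentSpace 𝓘(ℝ, V) x →L[ℝ] ℂ

variable (V) in
/-- The fibre of the holomorphic tangent bundle. -/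
abbrev HT (x : X) : Type _ := TangentSpace 𝓘(ℂ, V) x

variable (V) in
/-- The fibre of the holomorphic cotangent bundle. -/
abbrev HForm (x : X) : Type _ := TangentSpace 𝓘(ℂ, V) x →L[ℂ] ℂ

/-- Real part `TX ⊗ ℂ → TX`. -/
def reT (x : X) : CT V x →ₗ[ℝ] TangentSpace 𝓘(ℝ, V) x :=
  (TensorProduct.lid ℝ (TangentSpace 𝓘(ℝ, V) x)).toLinearMap ∘ₗ
    Complex.reLm.rTensor (TangentSpace 𝓘(ℝ, V) x)

/-- Imaginary part `TX ⊗ ℂ → TX`. -/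
def imT (x : X) : CT V x →ₗ[ℝ] TangentSpace 𝓘(ℝ, V) x :=
  (TensorProduct.lid ℝ (TangentSpace 𝓘(ℝ, V) x)).toLinearMap ∘ₗ
    Complex.imLm.rTensor (TangentSpace 𝓘(ℝ, V) x)

/-- The complex structure on the real tangent space. -/
def J (x : X) : TangentSpace 𝓘(ℝ, V) x →ₗ[ℝ] TangentSpace 𝓘(ℝ, V) x :=
  (Complex.I • LinearMap.id : V →ₗ[ℝ] V)

variable (V) in
/-- `T₀₁X ⊆ TX ⊗ ℂ`, the `-i`-eigenspace of the complex structure. -/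
def T01 (x : X) : Submodule ℂ (CT V x) :=
  LinearMap.ker ((J (V := V) x).baseChange ℂ + Complex.I • LinearMap.id)

/-- The projection `TX ⊗ ℂ → T₁₀X`, where `T₁₀X` is identified with the holomorphic tangent
bundle; `c ⊗ v ↦ c v`, so that `(v - i J v) / 2 ↦ v` and the kernel is `T₀₁X`. -/
def holPart (x : X) : CT V x →ₗ[ℂ] HT V x :=
  (LinearMap.liftBaseChange ℂ (LinearMap.id : V →ₗ[ℝ] V) : ℂ ⊗[ℝ] V →ₗ[ℂ] V)

/-- The inclusion of `T*₁₀X` (complex-linear forms) into `T*X ⊗ ℂ`. -/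
def holForm (x : X) (ξ : HForm V x) : CForm V x :=
  (show V →L[ℂ] ℂ from ξ).restrictScalars ℝ

/-- Evaluation of a complex form on a complex tangent vector. -/
def ev {x : X} (ξ : CForm V x) (z : CT V x) : ℂ := ξ (reT x z) + Complex.I * ξ (imT x z)

/-- Smooth complex functions. -/
def SmoothFn (V : Type*) [NormedAddCommGroup V] [NormedSpace ℂ V] {X : Type*} [TopologicalSpace X]
    [ChartedSpace V X] (U : Opens X) (f : X → ℂ) : Prop :=
  ContMDiffOn 𝓘(ℝ, V) 𝓘(ℝ, ℂ) ∞ f U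

/-- Holomorphic functions. -/
def HolFn (V : Type*) [NormedAddCommGroup V] [NormedSpace ℂ V] {X : Type*} [TopologicalSpace X]
    [ChartedSpace V X] (U : Opens X) (f : X → ℂ) : Prop :=
  ContMDiffOn 𝓘(ℂ, V) 𝓘(ℂ, ℂ) ∞ f U

/-- The differential of a complex function, as a complex one-form. -/
def dFn (f : X → ℂ) (x : X) : CForm V x := mfderiv 𝓘(ℝ, V) 𝓘(ℝ, ℂ) f x

/-- The holomorphic differential of a holomorphic function. -/
def dHolFn (f : X → ℂ) (x : X) : HForm V x := mfderiv 𝓘(ℂ, V) 𝓘(ℂ, ℂ) f x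

/-- Smooth sections of `TX ⊗ ℂ`. -/
def SmoothCField [IsManifold 𝓘(ℂ, V) ∞ X] (U : Opens X) (Z : ∀ x : X, CT V x) : Prop :=
  SmoothField ℝ U (fun x => reT x (Z x)) ∧ SmoothField ℝ U (fun x => imT x (Z x))

/-- The complex bilinear extension of the Lie bracket of vector fields. -/
def cLie (Z W : ∀ x : X, CT V x) (x : X) : CT V x :=
  (1 : ℂ) ⊗ₜ[ℝ]
      (VectorField.mlieBracket 𝓘(ℝ, V) (fun y => reT y (Z y)) (fun y => reT y (W y)) x -
        VectorField.mlieBracket 𝓘(ℝ, V) (fun y => imT y (Z y)) (fun y => imT y (W y)) x) +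
    Complex.I ⊗ₜ[ℝ]
      (VectorField.mlieBracket 𝓘(ℝ, V) (fun y => reT y (Z y)) (fun y => imT y (W y)) x +
        VectorField.mlieBracket 𝓘(ℝ, V) (fun y => imT y (Z y)) (fun y => reT y (W y)) x)

/-- The contraction `i_Z dξ` with a complex vector field. -/
def cContract (Z : ∀ x : X, CT V x) (ξ : ∀ x : X, CForm V x) (x : X) : CForm V x :=
  contract ℝ ξ x (reT x (Z x)) + Complex.I • contract ℝ ξ x (imT x (Z x))

/-- The one-form component `L_Z η - i_W dξ` of the Courant bracket `[Z + ξ, W + η]`, where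
`L_Z η = i_Z dη + d(η(Z))`. -/
def cCourantForm (Z : ∀ x : X, CT V x) (ξ : ∀ x : X, CForm V x)
    (W : ∀ x : X, CT V x) (η : ∀ x : X, CForm V x) (x : X) : CForm V x :=
  (cContract Z η x + dFn (fun y => ev (η y) (Z y)) x) - cContract W ξ x

/-- The one-form component `L_A η - i_B dξ` of the holomorphic Courant bracket
`[A + ξ, B + η]`, where `L_A η = i_A dη + d(η(A))`. -/
def hCourantForm (A : ∀ x : X, HT V x) (ξ : ∀ x : X, HForm V x)
    (B : ∀ x : X, HT V x) (η : ∀ x : X, HForm V x) (x : X) : HForm V x :=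
  (contract ℂ η x (A x) + dHolFn (fun y => η y (A y)) x) - contract ℂ ξ x (B x)

/-! ## Complex Courant algebroids -/

/-- A smooth complex (exact) Courant algebroid with fibres `E x` over a complex manifold: a smooth
complex vector bundle which is an extension of `TX ⊗ ℂ` by `T*X ⊗ ℂ`, with a symmetric pairing
inducing a self-dual isomorphism of extensions, and a bracket on its sheaf of smooth sections, such
that near every point some splitting of the anchor identifies it with `(TX ⊕ T*X) ⊗ ℂ`,
its pairing `⟨Z + ξ, W + η⟩ = (ξ(W) + η(Z)) / 2` and its Courant bracket.
The values of `bracket` matter only near points where both arguments are smooth. -/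
structure ComplexCourantAlgebroid (V : Type*) [NormedAddCommGroup V] [NormedSpace ℂ V]
    {X : Type*} [TopologicalSpace X] [ChartedSpace V X] [IsManifold 𝓘(ℂ, V) ∞ X]
    (E : X → Type*) [∀ x, AddCommGroup (E x)] [∀ x, Module ℂ (E x)] where
  IsSmooth : Opens X → (∀ x, E x) → Prop
  isVectorBundle : IsVectorBundle (SmoothFn V) E IsSmooth
  ι : ∀ x, CForm V x →ₗ[ℂ] E x
  π : ∀ x, E x →ₗ[ℂ] CT V x
  ι_smooth : ∀ (U : Opens X) (ξ : ∀ x, CForm V x),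
    SmoothForm ℝ U ξ → IsSmooth U (fun x => ι x (ξ x))
  π_smooth : ∀ (U : Opens X) (s : ∀ x, E x), IsSmooth U s → SmoothCField U (fun x => π x (s x))
  ι_injective : ∀ x, Function.Injective (ι x)
  exact : ∀ x, LinearMap.range (ι x) = LinearMap.ker (π x)
  π_surjective : ∀ x, Function.Surjective (π x)
  pairing : ∀ x, E x →ₗ[ℂ] E x →ₗ[ℂ] ℂ
  pairing_smooth : ∀ (U : Opens X) (s t : ∀ x, E x), IsSmooth U s → IsSmooth U t →
    SmoothFn V U (fun x => pairing x (s x) (t x))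
  pairing_symm : ∀ x a b, pairing x a b = pairing x b a
  pairing_nondegenerate : ∀ x a, (∀ b, pairing x a b = 0) → a = 0
  pairing_ι : ∀ x (ξ : CForm V x) (a : E x), pairing x (ι x ξ) a = (1 / 2) * ev ξ (π x a)
  bracket : (∀ x, E x) → (∀ x, E x) → ∀ x, E x
  bracket_smooth : ∀ (U : Opens X) (s t : ∀ x, E x), IsSmooth U s → IsSmooth U t →
    IsSmooth U (bracket s t)
  bracket_local : ∀ (U : Opens X) (s s' t t' : ∀ x, E x), IsSmooth U s → IsSmooth U t →
    (∀ x ∈ U, s x = s' x) → (∀ x ∈ U, t x = t' x) →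
    ∀ x ∈ U, bracket s t x = bracket s' t' x
  local_trivialization : ∀ x₀ : X, ∃ U : Opens X, x₀ ∈ U ∧ ∃ σ : ∀ x, CT V x →ₗ[ℂ] E x,
    (∀ x ∈ U, ∀ z, π x (σ x z) = z) ∧
    (∀ (W : Opens X) (Z : ∀ x, CT V x), W ≤ U → SmoothCField W Z →
      IsSmooth W (fun x => σ x (Z x))) ∧
    (∀ x ∈ U, ∀ (z w : CT V x) (ξ η : CForm V x),
      pairing x (σ x z + ι x ξ) (σ x w + ι x η) = (1 / 2) * (ev ξ w + ev η z)) ∧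
    ∀ (W : Opens X) (Z Y : ∀ x, CT V x) (ξ η : ∀ x, CForm V x), W ≤ U →
      SmoothCField W Z → SmoothForm ℝ W ξ → SmoothCField W Y → SmoothForm ℝ W η →
      ∀ x ∈ W, bracket (fun y => σ y (Z y) + ι y (ξ y)) (fun y => σ y (Y y) + ι y (η y)) x =
        σ x (cLie Z Y x) + ι x (cCourantForm Z ξ Y η x)

/-! ## Holomorphic Courant algebroids -/

/-- A holomorphic (exact) Courant algebroid with fibres `F x`: the same notion in the
holomorphic category, that is, with a holomorphic vector bundle which is an extension of the
holomorphic tangent bundle by the holomorphic cotangent bundle, and a bracket on its sheaf of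
holomorphic sections. -/
structure HolomorphicCourantAlgebroid (V : Type*) [NormedAddCommGroup V] [NormedSpace ℂ V]
    {X : Type*} [TopologicalSpace X] [ChartedSpace V X] [IsManifold 𝓘(ℂ, V) ∞ X]
    (F : X → Type*) [∀ x, AddCommGroup (F x)] [∀ x, Module ℂ (F x)] where
  IsHol : Opens X → (∀ x, F x) → Prop
  isVectorBundle : IsVectorBundle (HolFn V) F IsHol
  ι : ∀ x, HForm V x →ₗ[ℂ] F x
  π : ∀ x, F x →ₗ[ℂ] HT V x
  ι_hol : ∀ (U : Opens X) (ξ : ∀ x, HForm V x),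
    SmoothForm ℂ U ξ → IsHol U (fun x => ι x (ξ x))
  π_hol : ∀ (U : Opens X) (s : ∀ x, F x), IsHol U s → SmoothField ℂ U (fun x => π x (s x))
  ι_injective : ∀ x, Function.Injective (ι x)
  exact : ∀ x, LinearMap.range (ι x) = LinearMap.ker (π x)
  π_surjective : ∀ x, Function.Surjective (π x)
  pairing : ∀ x, F x →ₗ[ℂ] F x →ₗ[ℂ] ℂ
  pairing_hol : ∀ (U : Opens X) (s t : ∀ x, F x), IsHol U s → IsHol U t →
    HolFn V U (fun x => pairing x (s x) (t x))
  pairing_symm : ∀ x a b, pairing x a b = pairing x b a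
  pairing_nondegenerate : ∀ x a, (∀ b, pairing x a b = 0) → a = 0
  pairing_ι : ∀ x (ξ : HForm V x) (a : F x), pairing x (ι x ξ) a = (1 / 2) * ξ (π x a)
  bracket : (∀ x, F x) → (∀ x, F x) → ∀ x, F x
  bracket_hol : ∀ (U : Opens X) (s t : ∀ x, F x), IsHol U s → IsHol U t →
    IsHol U (bracket s t)
  bracket_local : ∀ (U : Opens X) (s s' t t' : ∀ x, F x), IsHol U s → IsHol U t →
    (∀ x ∈ U, s x = s' x) → (∀ x ∈ U, t x = t' x) →
    ∀ x ∈ U, bracket s t x = bracket s' t' x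
  local_trivialization : ∀ x₀ : X, ∃ U : Opens X, x₀ ∈ U ∧ ∃ σ : ∀ x, HT V x →ₗ[ℂ] F x,
    (∀ x ∈ U, ∀ z, π x (σ x z) = z) ∧
    (∀ (W : Opens X) (A : ∀ x, HT V x), W ≤ U → SmoothField ℂ W A →
      IsHol W (fun x => σ x (A x))) ∧
    (∀ x ∈ U, ∀ (z w : HT V x) (ξ η : HForm V x),
      pairing x (σ x z + ι x ξ) (σ x w + ι x η) = (1 / 2) * (ξ w + η z)) ∧
    ∀ (W : Opens X) (A B : ∀ x, HT V x) (ξ η : ∀ x, HForm V x), W ≤ U →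
      SmoothField ℂ W A → SmoothForm ℂ W ξ → SmoothField ℂ W B → SmoothForm ℂ W η →
      ∀ x ∈ W, bracket (fun y => σ y (A y) + ι y (ξ y)) (fun y => σ y (B y) + ι y (η y)) x =
        σ x (VectorField.mlieBracket 𝓘(ℂ, V) A B x) + ι x (hCourantForm A ξ B η x)

/-! ## Dolbeault operators -/

/-- A `∂̄`-operator on a smooth complex vector bundle `F` with smooth sections `IsSmooth`: an
operator `Γ(F) → Γ(T*₀₁X ⊗ F)` satisfying the Leibniz rule and with vanishing square.
Its values matter only near points where the section is smooth. -/
structure DolbeaultOperator (V : Type*) [NormedAddCommGroup V] [NormedSpace ℂ V]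
    {X : Type*} [TopologicalSpace X] [ChartedSpace V X] [IsManifold 𝓘(ℂ, V) ∞ X]
    (F : X → Type*) [∀ x, AddCommGroup (F x)] [∀ x, Module ℂ (F x)]
    (IsSmooth : Opens X → (∀ x, F x) → Prop) where
  op : (∀ x, F x) → ∀ x, T01 V x →ₗ[ℂ] F x
  smooth : ∀ (U : Opens X) (s : ∀ x, F x) (Z : ∀ x, T01 V x), IsSmooth U s →
    SmoothCField U (fun x => (Z x : CT V x)) → IsSmooth U (fun x => op s x (Z x))
  congr : ∀ (U : Opens X) (s s' : ∀ x, F x), IsSmooth U s → (∀ x ∈ U, s x = s' x) →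
    ∀ x ∈ U, op s x = op s' x
  add : ∀ (U : Opens X) (s t : ∀ x, F x), IsSmooth U s → IsSmooth U t →
    ∀ x ∈ U, op (fun y => s y + t y) x = op s x + op t x
  leibniz : ∀ (U : Opens X) (f : X → ℂ) (s : ∀ x, F x), SmoothFn V U f → IsSmooth U s →
    ∀ x ∈ U, ∀ z : T01 V x,
      op (fun y => f y • s y) x z = f x • op s x z + ev (dFn f x) (z : CT V x) • s x
  flat : ∀ (U : Opens X) (s : ∀ x, F x) (Z W B : ∀ x, T01 V x), IsSmooth U s →
    SmoothCField U (fun x => (Z x : CT V x)) → SmoothCField U (fun x => (W x : CT V x)) →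
    (∀ x ∈ U, (B x : CT V x) = cLie (fun y => (Z y : CT V y)) (fun y => (W y : CT V y)) x) →
    ∀ x ∈ U, op (fun y => op s y (W y)) x (Z x) - op (fun y => op s y (Z y)) x (W x) =
      op s x (B x)

/-! ## Liftings and reduction -/

section Lifting

variable [IsManifold 𝓘(ℂ, V) ∞ X] {E : X → Type*} [∀ x, AddCommGroup (E x)] [∀ x, Module ℂ (E x)]

/-- A lifting of `T₀₁X` to `E`: an isotropic, involutive smooth subbundle `D ⊆ E` mapped
isomorphically onto `T₀₁X` by the anchor. -/
structure Lifting (C : ComplexCourantAlgebroid V E) where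
  D : ∀ x, Submodule ℂ (E x)
  subbundle : ∀ x₀ : X, ∃ U : Opens X, x₀ ∈ U ∧ ∃ (r : ℕ) (e : Fin r → ∀ x, E x),
    (∀ i, C.IsSmooth U (e i)) ∧ ∀ x ∈ U, LinearIndependent ℂ (fun i => e i x) ∧
      Submodule.span ℂ (Set.range fun i => e i x) = D x
  isotropic : ∀ x, ∀ a ∈ D x, ∀ b ∈ D x, C.pairing x a b = 0
  involutive : ∀ (U : Opens X) (s t : ∀ x, E x), C.IsSmooth U s → C.IsSmooth U t →
    (∀ x ∈ U, s x ∈ D x) → (∀ x ∈ U, t x ∈ D x) → ∀ x ∈ U, C.bracket s t x ∈ D x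
  anchor_injOn : ∀ x, Set.InjOn (C.π x) (D x)
  anchor_map : ∀ x, (D x).map (C.π x) = T01 V x

namespace Lifting

variable {C : ComplexCourantAlgebroid V E} (L : Lifting C)

/-- The orthogonal complement of `D`. -/
def perp (x : X) : Submodule ℂ (E x) where
  carrier := {a | ∀ d ∈ L.D x, C.pairing x a d = 0}
  add_mem' := by
    intro a b ha hb d hd
    simp [ha d hd, hb d hd]
  zero_mem' := by
    intro d _
    simp
  smul_mem' := by
    intro c a ha d hd
    simp [ha d hd]

/-- The fibre of `E_D`, the quotient of the orthogonal complement of `D` by `D`. -/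
abbrev Reduced (x : X) : Type _ := (L.perp x) ⧸ (L.D x).submoduleOf (L.perp x)

/-- The element `a` of `E` lies in the orthogonal complement of `D` and its class is `q`. -/
def HasClass {x : X} (a : E x) (q : L.Reduced x) : Prop :=
  ∃ h : a ∈ L.perp x, Submodule.Quotient.mk (⟨a, h⟩ : L.perp x) = q

/-- `s'` is, over `U`, a smooth section of the orthogonal complement of `D` which lifts the
section `s` of `E_D`. -/
def IsLift (U : Opens X) (s : ∀ x, L.Reduced x) (s' : ∀ x, E x) : Prop :=
  C.IsSmooth U s' ∧ ∀ x ∈ U, L.HasClass (s' x) (s x)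

/-- Smooth sections of the quotient bundle `E_D`: those which locally lift to smooth sections. -/
def ReducedSmooth (U : Opens X) (s : ∀ x, L.Reduced x) : Prop :=
  ∀ x ∈ U, ∃ W : Opens X, x ∈ W ∧ W ≤ U ∧ ∃ s' : ∀ x, E x, L.IsLift W s s'

/-- `H` is the reduction of `E` by `D`: on the bundle `E_D`, the `∂̄`-operator is
`∂̄_Z s = [Z', s'] mod D` for `Z'` the lift of `Z` to `D` and `s'` any lift of `s`, the
holomorphic sections are the smooth sections annihilated by it, and the extension maps, the pairing
and the bracket are induced by those of `E`. -/
structure IsReduction (P : DolbeaultOperator V L.Reduced L.ReducedSmooth)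
    (H : HolomorphicCourantAlgebroid V L.Reduced) : Prop where
  dbar : ∀ (U : Opens X) (Z : ∀ x, T01 V x) (Z' : ∀ x, E x) (s : ∀ x, L.Reduced x)
    (s' : ∀ x, E x), SmoothCField U (fun x => (Z x : CT V x)) → C.IsSmooth U Z' →
    (∀ x ∈ U, Z' x ∈ L.D x ∧ C.π x (Z' x) = Z x) → L.IsLift U s s' →
    ∀ x ∈ U, L.HasClass (C.bracket Z' s' x) (P.op s x (Z x))
  hol : ∀ (U : Opens X) (s : ∀ x, L.Reduced x),
    H.IsHol U s ↔ L.ReducedSmooth U s ∧ ∀ x ∈ U, P.op s x = 0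
  ι : ∀ x (ξ : HForm V x), L.HasClass (C.ι x (holForm x ξ)) (H.ι x ξ)
  π : ∀ x (a : E x) (q : L.Reduced x), L.HasClass a q → H.π x q = holPart x (C.π x a)
  pairing : ∀ x (a b : E x) (p q : L.Reduced x), L.HasClass a p → L.HasClass b q →
    H.pairing x p q = C.pairing x a b
  bracket : ∀ (U : Opens X) (s t : ∀ x, L.Reduced x) (s' t' : ∀ x, E x),
    H.IsHol U s → H.IsHol U t → L.IsLift U s s' → L.IsLift U t t' →
    ∀ x ∈ U, L.HasClass (C.bracket s' t' x) (H.bracket s t x)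

end Lifting

end Lifting

/-! ## Isomorphisms -/

section Iso

variable [IsManifold 𝓘(ℂ, V) ∞ X]
  {E : X → Type*} [∀ x, AddCommGroup (E x)] [∀ x, Module ℂ (E x)]
  {E' : X → Type*} [∀ x, AddCommGroup (E' x)] [∀ x, Module ℂ (E' x)]

/-- The bundle isomorphism `Φ` is an isomorphism of complex Courant algebroids. -/
structure IsComplexCourantIso (C : ComplexCourantAlgebroid V E) (C' : ComplexCourantAlgebroid V E')
    (Φ : ∀ x, E x ≃ₗ[ℂ] E' x) : Prop where
  smooth : ∀ (U : Opens X) (s : ∀ x, E x), C.IsSmooth U s ↔ C'.IsSmooth U (fun x => Φ x (s x))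
  ι : ∀ x ξ, Φ x (C.ι x ξ) = C'.ι x ξ
  π : ∀ x a, C'.π x (Φ x a) = C.π x a
  pairing : ∀ x a b, C'.pairing x (Φ x a) (Φ x b) = C.pairing x a b
  bracket : ∀ (U : Opens X) (s t : ∀ x, E x), C.IsSmooth U s → C.IsSmooth U t →
    ∀ x ∈ U, Φ x (C.bracket s t x) = C'.bracket (fun y => Φ y (s y)) (fun y => Φ y (t y)) x

/-- The bundle isomorphism `Φ` is an isomorphism of holomorphic Courant algebroids. -/
structure IsHolomorphicCourantIso (H : HolomorphicCourantAlgebroid V E)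
    (H' : HolomorphicCourantAlgebroid V E') (Φ : ∀ x, E x ≃ₗ[ℂ] E' x) : Prop where
  hol : ∀ (U : Opens X) (s : ∀ x, E x), H.IsHol U s ↔ H'.IsHol U (fun x => Φ x (s x))
  ι : ∀ x ξ, Φ x (H.ι x ξ) = H'.ι x ξ
  π : ∀ x a, H'.π x (Φ x a) = H.π x a
  pairing : ∀ x a b, H'.pairing x (Φ x a) (Φ x b) = H.pairing x a b
  bracket : ∀ (U : Opens X) (s t : ∀ x, E x), H.IsHol U s → H.IsHol U t →
    ∀ x ∈ U, Φ x (H.bracket s t x) = H'.bracket (fun y => Φ y (s y)) (fun y => Φ y (t y)) x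

end Iso

end ComplexManifold

end Courant

end

open scoped Manifold ContDiff TensorProduct
open Set TopologicalSpace

noncomputable section

namespace Courant

/-! ## The Cauchy–Pompeiu formula -/

open MeasureTheory

/-! The heart of the matter is a local normal form, `Lifting.exists_adapted`: near every point some
splitting of the anchor identifies `E` with the standard algebroid `(TX ⊕ T*X) ⊗ ℂ` and `D` with the
image of `T₀₁X`. The orthogonal complement of `T₀₁X` there is `TX ⊗ ℂ ⊕ T*₁₀X`, so the quotient is
`T₁₀X ⊕ T*₁₀X`, with model fibre `V × V*` in a chart. Bracketing with sections of `D` becomes the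
componentwise `∂̄` of the chart (`IsLocalModel.bracket_lift`), and on sections annihilated by `∂̄`
the bracket becomes the holomorphic Courant bracket (`IsLocalModel.bracket_hol`). The Leibniz rule,
flatness, holomorphic frames and the holomorphic local splittings are then computations in `V × V*`.

For the normal form, start from any splitting. In a chart with constant `(0,1)`-fields `∂̄ⱼ`, the
subbundle `D` is spanned by lifts `∂̄ⱼ + θⱼ`. Isotropy makes `θᵢ(∂̄ⱼ)` skew; involutivity, the `∂̄ⱼ`
commuting, gives `L_{∂̄ᵢ} θⱼ = i_{∂̄ⱼ} dθᵢ`. If a one-form `a` satisfies `i_{∂̄ⱼ} da = θⱼ`, then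
shearing the splitting by `da` carries `T₀₁X` onto `D`; the shear preserves pairing and bracket
because `da` is skew and closed (`IsSplitting.add_contractL`). The `(0,1)`-part of `a` comes from
the Dolbeault lemma for `(0,2)`-forms, after which its `(1,0)`-part comes from the lemma for
`(0,1)`-forms (`exists_potential`). Both Dolbeault lemmas are proved one coordinate at a time by the
Cauchy transform, which rests on the Cauchy–Pompeiu formula.

To globalise, each operation on the quotient is defined at `x` through a chosen model at `x` and
shown to be the class of the corresponding operation of `E`. That description mentions no model, so
the same coordinate formula holds in every model. Naturality follows from the same description,
since an isomorphism carries classes to classes. -/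

theorem locallyIntegrable_inv_complex : LocallyIntegrable (fun w : ℂ => w⁻¹) volume := by
  have key : ∀ r : ℝ, IntegrableOn (fun w : ℂ => w⁻¹) (Metric.ball 0 r) volume := by
    intro r
    have h : IntegrableOn (fun w : ℂ => ‖w‖⁻¹) (Metric.ball 0 r) volume := by
      -- In polar coordinates the Jacobian `r` cancels the singularity `r⁻¹`, leaving the constant
      -- `1`.
      rw [integrableOn_fun_norm_addHaar (E := ℂ) volume (f := fun x : ℝ => x⁻¹) (r := r)]
      have : IntegrableOn (fun _ : ℝ => (1 : ℝ)) (Ioo 0 r) := by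
        simp
      refine this.congr_fun ?_ measurableSet_Ioo
      intro y hy
      have : y ≠ 0 := hy.1.ne'
      simp [Complex.finrank_real_complex, this]
    refine Integrable.mono' h ?_ ?_
    · exact measurable_inv.aestronglyMeasurable
    · filter_upwards with w
      simp
  intro x
  refine ⟨Metric.ball 0 (‖x‖ + 1), Metric.isOpen_ball.mem_nhds (by simp), key _⟩

/-- The integrand is the derivative of `h` along the ray, so only the value at the origin survives;
compact support removes the other end. -/
theorem integral_radial_deriv {h : ℂ → ℂ} (hh : ContDiff ℝ ∞ h) (hc : HasCompactSupport h)
    (θ : ℝ) (e : ℂ) (he : e = Complex.exp (θ * Complex.I)) :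
    ∫ r in Ioi (0 : ℝ), fderiv ℝ h (r * e) e = - h 0 := by
  have hlin : ContDiff ℝ ∞ (fun r : ℝ => (r : ℂ) * e) :=
    (Complex.ofRealCLM.contDiff).mul contDiff_const
  have hder : ∀ r : ℝ, HasDerivAt (fun r : ℝ => h (r * e)) (fderiv ℝ h (r * e) e) r := by
    intro r
    have h1 : HasDerivAt (fun r : ℝ => (r : ℂ) * e) e r := by
      simpa using (Complex.ofRealCLM.hasDerivAt (x := r)).mul_const e
    exact ((hh.differentiable (by simp)) _).hasFDerivAt.comp_hasDerivAt r h1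
  have hne : e ≠ 0 := by rw [he]; exact Complex.exp_ne_zero _
  have hcs : HasCompactSupport (fun r : ℝ => h (r * e)) := by
    have hemb : Topology.IsClosedEmbedding (fun r : ℝ => (r : ℂ) * e) :=
      (Homeomorph.mulRight₀ e hne).isClosedEmbedding.comp
        (Complex.isometry_ofReal.isClosedEmbedding)
    exact hc.comp_isClosedEmbedding hemb
  have := HasCompactSupport.integral_Ioi_deriv_eq (f := fun r : ℝ => h (r * e))
    ((hh.comp hlin).of_le (by simp)) hcs 0
  simp only [Complex.ofReal_zero, zero_mul] at this
  rw [← this]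
  refine setIntegral_congr_fun measurableSet_Ioi fun r _ => ((hder r).deriv).symm

/-- The integrand is the derivative in `θ` of `r⁻¹ h(r e^{iθ})`, which takes equal values at `-π`
and `π`. -/
theorem integral_angular_deriv {h : ℂ → ℂ} (hh : ContDiff ℝ ∞ h) {r : ℝ} (hr : 0 < r) :
    ∫ θ in Ioo (-Real.pi) Real.pi,
      fderiv ℝ h (r * Complex.exp (θ * Complex.I)) (Complex.I * Complex.exp (θ * Complex.I)) =
      0 := by
  have hder : ∀ θ : ℝ, HasDerivAt (fun θ : ℝ => (r : ℂ)⁻¹ * h (r * Complex.exp (θ * Complex.I)))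
      (fderiv ℝ h (r * Complex.exp (θ * Complex.I)) (Complex.I * Complex.exp (θ * Complex.I)))
      θ := by
    intro θ
    have h1 : HasDerivAt (fun θ : ℝ => (r : ℂ) * Complex.exp (θ * Complex.I))
        ((r : ℝ) • (Complex.I * Complex.exp (θ * Complex.I))) θ := by
      have h2 : HasDerivAt (fun θ : ℝ => (θ : ℂ) * Complex.I) Complex.I θ := by
        simpa using (Complex.ofRealCLM.hasDerivAt (x := θ)).mul_const Complex.I
      have := (h2.cexp).const_mul (r : ℂ)
      refine this.congr_deriv ?_
      simp [mul_comm]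
    have h3 := (((hh.differentiable (by simp)) _).hasFDerivAt.comp_hasDerivAt θ h1).const_mul
      (r : ℂ)⁻¹
    refine h3.congr_deriv ?_
    rw [map_smul]
    simp [hr.ne']
  have hcont : Continuous fun θ : ℝ => fderiv ℝ h (r * Complex.exp (θ * Complex.I))
      (Complex.I * Complex.exp (θ * Complex.I)) := by
    have := hh.continuous_fderiv (by simp)
    fun_prop
  rw [← integral_Ioc_eq_integral_Ioo,
    ← intervalIntegral.integral_of_le (by linarith [Real.pi_pos]),
    intervalIntegral.integral_eq_sub_of_hasDerivAt (fun θ _ => hder θ)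
      (hcont.intervalIntegrable _ _)]
  simp [Complex.exp_neg, Complex.exp_pi_mul_I]

/-- In polar coordinates `∂ₓ + i ∂ᵧ = e^{iθ} (∂ᵣ + i r⁻¹ ∂_θ)`, and the kernel `w⁻¹` with the
Jacobian `r` cancels the factor `e^{iθ}`. The radial term integrates to `-h 0` over each ray, the
angular term to zero over each circle. -/
theorem cauchyPompeiu {h : ℂ → ℂ} (hh : ContDiff ℝ ∞ h) (hc : HasCompactSupport h) :
    ∫ w : ℂ, w⁻¹ * (fderiv ℝ h w 1 + Complex.I * fderiv ℝ h w Complex.I) =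
      - (2 * Real.pi) * h 0 := by
  obtain ⟨R, hR⟩ : ∃ R : ℝ, ∀ w : ℂ, R < ‖w‖ → fderiv ℝ h w = 0 := by
    obtain ⟨R, hR⟩ := (hc.fderiv ℝ).isCompact.isBounded.subset_closedBall 0
    refine ⟨R, fun w hw => ?_⟩
    by_contra hne
    have := hR (subset_tsupport _ hne)
    simp at this
    linarith
  set A : ℝ × ℝ → ℂ := fun p =>
    fderiv ℝ h (p.1 * Complex.exp (p.2 * Complex.I)) (Complex.exp (p.2 * Complex.I)) with hA
  set B : ℝ × ℝ → ℂ := fun p => fderiv ℝ h (p.1 * Complex.exp (p.2 * Complex.I))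
    (Complex.I * Complex.exp (p.2 * Complex.I)) with hB
  have hfc := hh.continuous_fderiv (by simp)
  have hAc : Continuous A := by rw [hA]; fun_prop
  have hBc : Continuous B := by rw [hB]; fun_prop
  -- Integrability, needed for Fubini in either order, comes from continuity on a compact rectangle
  -- outside of which the integrand vanishes.
  have hint : ∀ G : ℝ × ℝ → ℂ, Continuous G → (∀ p : ℝ × ℝ, R < |p.1| → G p = 0) →
      IntegrableOn G (Ioi (0 : ℝ) ×ˢ Ioo (-Real.pi) Real.pi) (volume.prod volume) := by
    intro G hG hG0
    have h1 : IntegrableOn G (Icc 0 R ×ˢ Icc (-Real.pi) Real.pi) (volume.prod volume) :=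
      (hG.continuousOn).integrableOn_compact (isCompact_Icc.prod isCompact_Icc)
    refine h1.of_forall_sdiff_eq_zero (measurableSet_Ioi.prod measurableSet_Ioo) ?_
    rintro ⟨r, θ⟩ ⟨⟨h2, h3⟩, h4⟩
    apply hG0
    by_contra h5
    simp only [not_lt] at h5
    simp only [mem_Ioi, mem_Ioo] at h2 h3
    exact h4 ⟨⟨le_of_lt h2, (le_abs_self r).trans h5⟩, ⟨h3.1.le, h3.2.le⟩⟩
  have hzero : ∀ p : ℝ × ℝ, R < |p.1| → fderiv ℝ h (p.1 * Complex.exp (p.2 * Complex.I)) = 0 := by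
    intro p hp
    apply hR
    simpa [Complex.norm_exp_ofReal_mul_I] using hp
  have hAi := hint A hAc (fun p hp => by simp [hA, hzero p hp])
  have hBi := hint B hBc (fun p hp => by simp [hB, hzero p hp])
  rw [← Complex.integral_comp_polarCoord_symm,
    show polarCoord.target = Ioi (0 : ℝ) ×ˢ Ioo (-Real.pi) Real.pi from rfl]
  -- Real linearity of the derivative turns directions `1` and `i` into the radial direction
  -- `e^{iθ}` and the angular direction `i e^{iθ}`.
  have hstep : ∀ p ∈ Ioi (0 : ℝ) ×ˢ Ioo (-Real.pi) Real.pi,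
      p.1 • ((Complex.polarCoord.symm p)⁻¹ * (fderiv ℝ h (Complex.polarCoord.symm p) 1 +
        Complex.I * fderiv ℝ h (Complex.polarCoord.symm p) Complex.I)) =
      A p + Complex.I * B p := by
    rintro ⟨r, θ⟩ ⟨hr, -⟩
    have hr' : (r : ℂ) ≠ 0 := by exact_mod_cast (ne_of_gt hr)
    have hsymm : Complex.polarCoord.symm (r, θ) = r * Complex.exp (θ * Complex.I) := by
      rw [Complex.polarCoord_symm_apply, Complex.exp_mul_I]; simp
    rw [hsymm]
    simp only [hA, hB]
    set D := fderiv ℝ h (r * Complex.exp (θ * Complex.I))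
    have hD : ∀ a b : ℝ, D (a + b * Complex.I) = a * D 1 + b * D Complex.I := by
      intro a b
      have : (a : ℂ) + b * Complex.I = a • (1 : ℂ) + b • Complex.I := by simp
      rw [this, map_add, map_smul, map_smul]
      simp
    have h1 : Complex.exp (θ * Complex.I) = (Real.cos θ : ℂ) + (Real.sin θ : ℂ) * Complex.I := by
      rw [Complex.exp_mul_I]; simp
    have h2 : Complex.I * Complex.exp (θ * Complex.I) =
        ((-Real.sin θ : ℝ) : ℂ) + (Real.cos θ : ℂ) * Complex.I := by
      rw [h1]; push_cast; linear_combination (Complex.sin θ) * Complex.I_sq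
    have hinv : (Complex.exp (θ * Complex.I))⁻¹ =
        (Real.cos θ : ℂ) - (Real.sin θ : ℂ) * Complex.I := by
      rw [← Complex.exp_neg, ← neg_mul, Complex.exp_mul_I]; simp; ring
    rw [h2, hD]
    nth_rewrite 2 [h1]
    rw [hD, mul_inv, hinv, Complex.real_smul]
    push_cast
    field_simp
    linear_combination (-Complex.sin θ * D Complex.I) * Complex.I_sq
  rw [setIntegral_congr_fun (measurableSet_Ioi.prod measurableSet_Ioo) hstep]
  rw [show (volume : Measure (ℝ × ℝ)) = volume.prod volume from rfl]
  rw [integral_add hAi (hBi.const_mul _), integral_const_mul]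
  have hI1 : ∫ p in Ioi (0 : ℝ) ×ˢ Ioo (-Real.pi) Real.pi, A p ∂(volume.prod volume) =
      -(2 * Real.pi) * h 0 := by
    rw [← Measure.prod_restrict, integral_prod_symm _ (by rwa [Measure.prod_restrict])]
    have : ∀ θ : ℝ, ∫ r in Ioi (0 : ℝ), A (r, θ) = - h 0 := fun θ =>
      integral_radial_deriv hh hc θ _ rfl
    simp only [this]
    rw [setIntegral_const]
    simp [Real.pi_pos.le]
    left; ring
  have hI2 : ∫ p in Ioi (0 : ℝ) ×ˢ Ioo (-Real.pi) Real.pi, B p ∂(volume.prod volume) = 0 := by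
    rw [← Measure.prod_restrict, integral_prod _ (by rwa [Measure.prod_restrict])]
    have : ∀ r ∈ Ioi (0 : ℝ), ∫ θ in Ioo (-Real.pi) Real.pi, B (r, θ) = 0 := fun r hr =>
      integral_angular_deriv hh hr
    rw [setIntegral_congr_fun measurableSet_Ioi this]
    simp
  rw [hI1, hI2]
  simp

/-! ## Solving the inhomogeneous Cauchy–Riemann equation in one direction -/

section CauchyTransform

open MeasureTheory

variable {V : Type*} [NormedAddCommGroup V] [NormedSpace ℂ V]

/-- The derivative of `f` along the complex tangent vector `1 ⊗ v + i ⊗ iv` of type `(0,1)`. -/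
def dbar {F : Type*} [NormedAddCommGroup F] [NormedSpace ℂ F] (v : V) (f : V → F) (z : V) : F :=
  fderiv ℝ f z v + Complex.I • fderiv ℝ f z (Complex.I • v)

/-- The Cauchy transform of `F` in the direction `e`. -/
def cauchyTransform (e : V) (F : V → ℂ) (z : V) : ℂ :=
  (2 * Real.pi : ℂ)⁻¹ * ∫ w : ℂ, w⁻¹ * F (z - w • e)

variable {e : V} {l : V →L[ℂ] ℂ} {F : V → ℂ} {R : ℝ}

/-- The functional `l` measures displacement along `e`: `l (p + w • e) = l p + w`. Hence the support
in `w` is bounded uniformly for `p` near `z₀`, as differentiation of a convolution with parameters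
requires. Nothing is assumed about decay in the other directions. -/
theorem cauchyTransform_support (hl : l e = 1) (hF0 : ∀ z, R < ‖l z‖ → F z = 0) (z₀ : V) :
    ∀ (p : V) (w : ℂ), p ∈ Metric.ball z₀ 1 →
      w ∉ Metric.closedBall (0 : ℂ) (R + ‖l‖ * (‖z₀‖ + 1)) → F (p + w • e) = 0 := by
  intro p w hp hw
  apply hF0
  have h1 : ‖l p‖ ≤ ‖l‖ * (‖z₀‖ + 1) := by
    refine (l.le_opNorm p).trans (mul_le_mul_of_nonneg_left ?_ (norm_nonneg _))
    have h2 : ‖p - z₀‖ < 1 := by simpa [dist_eq_norm] using hp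
    have h3 : ‖p‖ ≤ ‖p - z₀‖ + ‖z₀‖ := by simpa using norm_add_le (p - z₀) z₀
    linarith
  have h4 : R + ‖l‖ * (‖z₀‖ + 1) < ‖w‖ := by simpa using hw
  have h5 : l (p + w • e) = l p + w := by simp [hl]
  rw [h5]
  have h6 := norm_sub_norm_le w (-(l p))
  rw [norm_neg, sub_neg_eq_add, add_comm w] at h6
  linarith

/-- With `z` as a parameter and the convolution evaluated at `0`, smoothness and differentiation
under the integral become statements about convolutions with a parameter. -/
theorem cauchyTransform_eq_convolution (z : V) : cauchyTransform e F z = (2 * Real.pi : ℂ)⁻¹ *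
    (convolution (fun w : ℂ => w⁻¹) (fun w : ℂ => F (z + w • e))
      (ContinuousLinearMap.mul ℝ ℂ) volume) 0 := by
  simp [cauchyTransform, convolution, sub_eq_add_neg]

theorem contDiff_cauchyTransform (hl : l e = 1) (hF : ContDiff ℝ ∞ F)
    (hF0 : ∀ z, R < ‖l z‖ → F z = 0) : ContDiff ℝ ∞ (cauchyTransform e F) := by
  rw [contDiff_iff_contDiffAt]
  intro z₀
  have h := contDiffOn_convolution_right_with_param (𝕜 := ℝ) (n := ⊤) (μ := (volume : Measure ℂ))
    (ContinuousLinearMap.mul ℝ ℂ) (g := fun (z : V) (w : ℂ) => F (z + w • e))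
    (s := Metric.ball z₀ 1) Metric.isOpen_ball (isCompact_closedBall _ _)
    (cauchyTransform_support hl hF0 z₀) locallyIntegrable_inv_complex
    (by
      apply ContDiff.contDiffOn
      exact hF.comp (contDiff_fst.add (contDiff_snd.smul contDiff_const)))
  have h1 : ContDiffAt ℝ ∞ (fun q : V × ℂ => (convolution (fun w : ℂ => w⁻¹)
      (fun w : ℂ => F (q.1 + w • e)) (ContinuousLinearMap.mul ℝ ℂ) volume) q.2) (z₀, 0) :=
    h.contDiffAt ((Metric.isOpen_ball.prod isOpen_univ).mem_nhds (by simp))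
  have h2 := h1.comp z₀ (f := fun z : V => (z, (0 : ℂ))) (by fun_prop)
  have h3 : cauchyTransform e F = fun z => (2 * Real.pi : ℂ)⁻¹ *
    (convolution (fun w : ℂ => w⁻¹) (fun w : ℂ => F (z + w • e))
      (ContinuousLinearMap.mul ℝ ℂ) volume) 0 := funext cauchyTransform_eq_convolution
  rw [h3]
  exact contDiffAt_const.mul h2

/-- The kernel does not involve `z`, so all derivatives fall on `F`. -/
theorem fderiv_cauchyTransform (hl : l e = 1) (hF : ContDiff ℝ ∞ F)
    (hF0 : ∀ z, R < ‖l z‖ → F z = 0) (z u : V) :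
    fderiv ℝ (cauchyTransform e F) z u = cauchyTransform e (fun z => fderiv ℝ F z u) z := by
  have hG : ContDiff ℝ ∞ (fun q : V × ℂ => F (q.1 + q.2 • e)) :=
    hF.comp (contDiff_fst.add (contDiff_snd.smul contDiff_const))
  have h := hasFDerivAt_convolution_right_with_param (𝕜 := ℝ) (μ := (volume : Measure ℂ))
    (ContinuousLinearMap.mul ℝ ℂ) (g := fun (z : V) (w : ℂ) => F (z + w • e))
    (s := Metric.ball z 1) Metric.isOpen_ball (isCompact_closedBall _ _)
    (cauchyTransform_support hl hF0 z) locallyIntegrable_inv_complex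
    ((hG.of_le (by simp)).contDiffOn) (z, 0) (by simp)
  have h2 : HasFDerivAt (fun z : V => (z, (0 : ℂ))) (ContinuousLinearMap.inl ℝ V ℂ) z :=
    hasFDerivAt_prodMk_left z (0 : ℂ)
  have h3 := (h.comp z h2).const_mul (2 * Real.pi : ℂ)⁻¹
  have h4 : cauchyTransform e F = fun z => (2 * Real.pi : ℂ)⁻¹ *
    (convolution (fun w : ℂ => w⁻¹) (fun w : ℂ => F (z + w • e))
      (ContinuousLinearMap.mul ℝ ℂ) volume) 0 := funext cauchyTransform_eq_convolution
  have h5 := h3.congr_of_eventuallyEq (Filter.EventuallyEq.of_eq h4)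
  rw [h5.fderiv, cauchyTransform_eq_convolution]
  have hder : ∀ w : ℂ, fderiv ℝ (fun q : V × ℂ => F (q.1 + q.2 • e)) (z, w) =
      (fderiv ℝ F (z + w • e)).comp
        (ContinuousLinearMap.fst ℝ V ℂ + (ContinuousLinearMap.snd ℝ V ℂ).smulRight e) := by
    intro w
    refine HasFDerivAt.fderiv ?_
    refine ((hF.differentiable (by simp)) (z + w • e)).hasFDerivAt.comp (z, w) ?_
    exact hasFDerivAt_fst.add (hasFDerivAt_snd.smul_const e)
  have hcs : HasCompactSupport
      (fun w : ℂ => fderiv ℝ (fun q : V × ℂ => F (q.1 + q.2 • e)) (z, w)) := by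
    refine HasCompactSupport.intro (isCompact_closedBall (0 : ℂ) (R + ‖l‖ * (‖z‖ + 1))) ?_
    intro w hw
    have hev : (fun q : V × ℂ => F (q.1 + q.2 • e)) =ᶠ[nhds (z, w)] fun _ => 0 := by
      have hop : IsOpen (Metric.ball z 1 ×ˢ (Metric.closedBall (0 : ℂ) (R + ‖l‖ * (‖z‖ + 1)))ᶜ) :=
        Metric.isOpen_ball.prod Metric.isClosed_closedBall.isOpen_compl
      filter_upwards [hop.mem_nhds ⟨by simp, hw⟩] with q hq
      exact cauchyTransform_support hl hF0 z q.1 q.2 hq.1 hq.2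
    rw [hev.fderiv_eq]
    simp
  have hcont : Continuous
      (fun w : ℂ => fderiv ℝ (fun q : V × ℂ => F (q.1 + q.2 • e)) (z, w)) :=
    (hG.continuous_fderiv (by simp)).comp (by fun_prop)
  -- Only the parameter `z` moves, hence the direction `(u, 0)`.
  have h6 := convolution_precompR_apply (𝕜 := ℝ) (μ := (volume : Measure ℂ))
    (ContinuousLinearMap.mul ℝ ℂ) locallyIntegrable_inv_complex hcs hcont 0 (u, (0 : ℂ))
  simp only [smul_apply, ContinuousLinearMap.comp_apply,
    ContinuousLinearMap.inl_apply, smul_eq_mul]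
  congr 1
  refine h6.trans ?_
  congr 1
  funext w
  rw [hder]
  simp

theorem cauchyTransform_integrable (hl : l e = 1) (hF : Continuous F)
    (hF0 : ∀ z, R < ‖l z‖ → F z = 0) (z : V) :
    Integrable (fun w : ℂ => w⁻¹ * F (z - w • e)) := by
  have hcs : HasCompactSupport (fun w : ℂ => F (z - w • e)) := by
    refine HasCompactSupport.intro (isCompact_closedBall (0 : ℂ) (R + ‖l‖ * (‖z‖ + 1))) ?_
    intro w hw
    have := cauchyTransform_support hl hF0 z z (-w) (by simp) (by simpa using hw)
    simpa [sub_eq_add_neg] using this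
  exact locallyIntegrable_inv_complex.integrable_smul_right_of_hasCompactSupport
    (by fun_prop) hcs

theorem fderiv_support (hF0 : ∀ z, R < ‖l z‖ → F z = 0) (z : V) (hz : R < ‖l z‖) :
    fderiv ℝ F z = 0 := by
  have : F =ᶠ[nhds z] fun _ => 0 := by
    filter_upwards [(isOpen_lt continuous_const (l.continuous.norm)).mem_nhds hz] with y hy
    exact hF0 y hy
  rw [this.fderiv_eq]
  simp

theorem dbar_cauchyTransform (hl : l e = 1) (hF : ContDiff ℝ ∞ F)
    (hF0 : ∀ z, R < ‖l z‖ → F z = 0) (u z : V) :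
    dbar u (cauchyTransform e F) z = cauchyTransform e (dbar u F) z := by
  rw [dbar, fderiv_cauchyTransform hl hF hF0, fderiv_cauchyTransform hl hF hF0]
  simp only [cauchyTransform, dbar, smul_eq_mul]
  have hc : ∀ v, Continuous fun z => fderiv ℝ F z v := fun v =>
    (hF.continuous_fderiv (by simp)).clm_apply continuous_const
  have h0 : ∀ v z, R < ‖l z‖ → fderiv ℝ F z v = 0 := fun v z hz => by
    rw [fderiv_support hF0 z hz]; rfl
  have i1 := cauchyTransform_integrable hl (hc u) (h0 u) z
  have i2 := cauchyTransform_integrable hl (hc (Complex.I • u)) (h0 (Complex.I • u)) z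
  have : (fun w : ℂ => w⁻¹ * (fderiv ℝ F (z - w • e) u +
      Complex.I * fderiv ℝ F (z - w • e) (Complex.I • u))) = fun w : ℂ =>
      w⁻¹ * fderiv ℝ F (z - w • e) u +
        Complex.I * (w⁻¹ * fderiv ℝ F (z - w • e) (Complex.I • u)) := by
    funext w; ring
  rw [this, integral_add i1 (i2.const_mul _), integral_const_mul]
  ring

/-- This is Cauchy–Pompeiu for `w ↦ F (z - w • e)` at `0`; the sign of `-w` cancels the sign in that
formula. -/
theorem cauchyTransform_dbar_self (hl : l e = 1) (hF : ContDiff ℝ ∞ F)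
    (hF0 : ∀ z, R < ‖l z‖ → F z = 0) (z : V) :
    cauchyTransform e (dbar e F) z = F z := by
  have hh : ContDiff ℝ ∞ (fun w : ℂ => F (z - w • e)) :=
    hF.comp (contDiff_const.sub (contDiff_id.smul contDiff_const))
  have hcs : HasCompactSupport (fun w : ℂ => F (z - w • e)) := by
    refine HasCompactSupport.intro (isCompact_closedBall (0 : ℂ) (R + ‖l‖ * (‖z‖ + 1))) ?_
    intro w hw
    have := cauchyTransform_support hl hF0 z z (-w) (by simp) (by simpa using hw)
    simpa [sub_eq_add_neg] using this
  have hder : ∀ w c : ℂ, fderiv ℝ (fun w : ℂ => F (z - w • e)) w c =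
      - fderiv ℝ F (z - w • e) (c • e) := by
    intro w c
    have h1 : HasFDerivAt (fun w : ℂ => z - w • e)
        (-((ContinuousLinearMap.id ℝ ℂ).smulRight e)) w := by
      have := ((hasFDerivAt_id (𝕜 := ℝ) w).smul_const e).const_sub z
      simpa using this
    have := (((hF.differentiable (by simp)) (z - w • e)).hasFDerivAt.comp w h1).fderiv
    rw [show (fun w : ℂ => F (z - w • e)) = F ∘ fun w : ℂ => z - w • e from rfl, this]
    simp
  have h := cauchyPompeiu hh hcs
  simp only [hder, one_smul, zero_smul, sub_zero] at h
  have : (fun w : ℂ => w⁻¹ * dbar e F (z - w • e)) = fun w : ℂ =>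
      -(w⁻¹ * (-fderiv ℝ F (z - w • e) e +
        Complex.I * -fderiv ℝ F (z - w • e) (Complex.I • e))) := by
    funext w; simp only [dbar, smul_eq_mul]; ring
  rw [cauchyTransform, this, integral_neg, h]
  have hpi : (Real.pi : ℂ) ≠ 0 := by exact_mod_cast Real.pi_ne_zero
  field_simp

theorem cauchyTransform_eq_zero (z : V) (h : ∀ w : ℂ, F (z - w • e) = 0) :
    cauchyTransform e F z = 0 := by
  simp [cauchyTransform, h]

end CauchyTransform

/-! ## The Dolbeault lemma in degrees one and two -/

section Dolbeault

variable {V : Type*} [NormedAddCommGroup V] [NormedSpace ℂ V]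
  {F : Type*} [NormedAddCommGroup F] [NormedSpace ℂ F]

theorem dbar_congr {f g : V → F} {z : V} (h : f =ᶠ[nhds z] g) (v : V) :
    dbar v f z = dbar v g z := by
  rw [dbar, dbar, h.fderiv_eq]

theorem dbar_add {f g : V → F} {z : V} (hf : DifferentiableAt ℝ f z)
    (hg : DifferentiableAt ℝ g z) (v : V) :
    dbar v (fun y => f y + g y) z = dbar v f z + dbar v g z := by
  rw [dbar, dbar, dbar, fderiv_fun_add hf hg]
  simp only [add_apply, smul_add]
  abel

theorem dbar_sub {f g : V → F} {z : V} (hf : DifferentiableAt ℝ f z)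
    (hg : DifferentiableAt ℝ g z) (v : V) :
    dbar v (fun y => f y - g y) z = dbar v f z - dbar v g z := by
  rw [dbar, dbar, dbar, fderiv_fun_sub hf hg]
  simp only [sub_apply, smul_sub]
  abel

@[simp] theorem dbar_zero (v z : V) : dbar v (fun _ => (0 : F)) z = 0 := by
  simp [dbar]

theorem dbar_eq_zero_of_eventuallyEq {f : V → F} {z : V} (h : f =ᶠ[nhds z] fun _ => 0) (v : V) :
    dbar v f z = 0 := by
  rw [dbar_congr h, dbar_zero]

theorem dbar_neg {f : V → F} {z : V} (v : V) :
    dbar v (fun y => -f y) z = -dbar v f z := by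
  rw [dbar, dbar, fderiv_fun_neg]
  simp only [neg_apply, smul_neg]
  abel

theorem dbar_mul {f g : V → ℂ} {z : V} (hf : DifferentiableAt ℝ f z)
    (hg : DifferentiableAt ℝ g z) (v : V) :
    dbar v (fun y => f y * g y) z = dbar v f z * g z + f z * dbar v g z := by
  rw [dbar, dbar, dbar, fderiv_fun_mul hf hg]
  simp only [add_apply, smul_apply, smul_eq_mul]
  ring

theorem contDiffAt_dbar {f : V → F} {z : V} (hf : ContDiffAt ℝ ∞ f z) (v : V) :
    ContDiffAt ℝ ∞ (dbar v f) z := by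
  have h : ContDiffAt ℝ ∞ (fderiv ℝ f) z := hf.fderiv_right (by simp)
  exact (h.clm_apply contDiffAt_const).add ((h.clm_apply contDiffAt_const).const_smul Complex.I)

theorem contDiff_dbar {f : V → F} (hf : ContDiff ℝ ∞ f) (v : V) : ContDiff ℝ ∞ (dbar v f) :=
  contDiff_iff_contDiffAt.2 fun _ => contDiffAt_dbar hf.contDiffAt v

theorem second_fderiv_symm {f : V → F} {z : V} (hf : ContDiffAt ℝ ∞ f z) (u v : V) :
    fderiv ℝ (fderiv ℝ f) z u v = fderiv ℝ (fderiv ℝ f) z v u :=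
  (hf.isSymmSndFDerivAt (by simpa using WithTop.coe_le_coe.2 (le_top : (2 : ℕ∞) ≤ ⊤))) u v

theorem fderiv_dbar {f : V → F} {z : V} (hf : ContDiffAt ℝ ∞ f z) (v u : V) :
    fderiv ℝ (dbar v f) z u = fderiv ℝ (fderiv ℝ f) z u v +
      Complex.I • fderiv ℝ (fderiv ℝ f) z u (Complex.I • v) := by
  have h : DifferentiableAt ℝ (fderiv ℝ f) z :=
    (hf.fderiv_right (m := ∞) (by simp)).differentiableAt (by simp)
  have h1 : ∀ w, HasFDerivAt (fun y => fderiv ℝ f y w) ((fderiv ℝ (fderiv ℝ f) z).flip w) z :=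
    fun w => by simpa using h.hasFDerivAt.clm_apply (hasFDerivAt_const w z)
  have := ((h1 v).add ((h1 (Complex.I • v)).const_smul Complex.I)).fderiv
  rw [show dbar v f = ((fun y => fderiv ℝ f y v) +
    (Complex.I • fun y => fderiv ℝ f y (Complex.I • v))) from rfl, this]
  simp

/-- The operators have constant coefficients, so this is the symmetry of the second derivative in
each of the four pairs of directions. -/
theorem dbar_comm {f : V → F} {z : V} (hf : ContDiffAt ℝ ∞ f z) (u v : V) :
    dbar u (dbar v f) z = dbar v (dbar u f) z := by
  rw [dbar, dbar, fderiv_dbar hf, fderiv_dbar hf, fderiv_dbar hf, fderiv_dbar hf,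
    second_fderiv_symm hf u v, second_fderiv_symm hf u (Complex.I • v),
    second_fderiv_symm hf (Complex.I • u) v, second_fderiv_symm hf (Complex.I • u) (Complex.I • v)]
  simp only [smul_add]
  abel

variable {n : ℕ} (b : Module.Basis (Fin n) ℂ V)

/-- The polydisc with radii `r j`. -/
def polydisc (r : Fin n → ℝ) : Set V := {z | ∀ j, ‖b.coord j z‖ < r j}

/-- Radii `r / 2` in the coordinates from `m` on, and `r` in the others. -/
def radii (n : ℕ) (r : ℝ) (m : ℕ) (j : Fin n) : ℝ := if m ≤ j then r / 2 else r

theorem polydisc_radii_succ {r : ℝ} (hr : 0 < r) (m : ℕ) :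
    polydisc b (radii n r m) ⊆ polydisc b (radii n r (m + 1)) := by
  intro z hz j
  have := hz j
  unfold radii at this ⊢
  split_ifs at this ⊢ <;> linarith

/-- Translation along `b k` moves the `k`-th coordinate alone, and passing from stage `k` to stage
`k + 1` relaxes exactly that bound, from `r / 2` to `r`. -/
theorem sub_mem_polydisc_radii {r : ℝ} (hr : 0 < r) {k : Fin n} {z : V} {w : ℂ}
    (hz : z ∈ polydisc b (radii n r k)) (hw : ‖b.coord k z - w‖ < r) :
    z - w • b k ∈ polydisc b (radii n r (k + 1)) := by
  intro j
  by_cases hj : j = k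
  · subst hj
    simpa [radii] using hw
  · have := polydisc_radii_succ b hr k hz j
    simpa [Finsupp.single_apply, Ne.symm hj] using this

variable [FiniteDimensional ℂ V]

/-- The continuous coordinate functions of a basis. -/
def coordL (j : Fin n) : V →L[ℂ] ℂ := (b.coord j).toContinuousLinearMap

@[simp] theorem coordL_apply (j : Fin n) (z : V) : coordL b j z = b.coord j z := rfl

theorem isOpen_polydisc (r : Fin n → ℝ) : IsOpen (polydisc b r) := by
  have : polydisc b r = ⋂ j, {z | ‖coordL b j z‖ < r j} := by
    ext z; simp [polydisc]
  rw [this]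
  exact isOpen_iInter_of_finite fun j => isOpen_lt ((coordL b j).continuous.norm) continuous_const

/-- The solution is the Cauchy transform along `b k` of `f` cut off in the `k`-th coordinate only.
Since the cut-off is independent of the other coordinates, `u` stays holomorphic in each direction
`b j` in which `f` is holomorphic along the whole slice; the inductions below depend on this last
clause. -/
theorem exists_dbar_eq {f : V → ℂ} (hf : ContDiff ℝ ∞ f) {r : ℝ} (hr : 0 < r) (k : Fin n) :
    ∃ u : V → ℂ, ContDiff ℝ ∞ u ∧ (∀ z, ‖b.coord k z‖ < r / 2 → dbar (b k) u z = f z) ∧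
      ∀ j, j ≠ k → ∀ z, (∀ w : ℂ, ‖b.coord k z - w‖ < r → dbar (b j) f (z - w • b k) = 0) →
        dbar (b j) u z = 0 := by
  let χ : ContDiffBump (0 : ℂ) := ⟨r / 2, r, by linarith, by linarith⟩
  have hle : coordL b k (b k) = 1 := by simp
  have hχ : ContDiff ℝ ∞ fun z : V => ((χ (coordL b k z) : ℝ) : ℂ) :=
    Complex.ofRealCLM.contDiff.comp
      (χ.contDiff.comp ((coordL b k).restrictScalars ℝ).contDiff)
  have hF : ContDiff ℝ ∞ fun z : V => ((χ (coordL b k z) : ℝ) : ℂ) * f z := hχ.mul hf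
  have hF0 : ∀ z, r < ‖coordL b k z‖ → ((χ (coordL b k z) : ℝ) : ℂ) * f z = 0 := by
    intro z hz
    rw [χ.zero_of_le_dist (by simpa using hz.le)]
    simp
  refine ⟨cauchyTransform (b k) fun z : V => ((χ (coordL b k z) : ℝ) : ℂ) * f z,
    contDiff_cauchyTransform hle hF hF0, ?_, ?_⟩
  · intro z hz
    rw [dbar_cauchyTransform hle hF hF0, cauchyTransform_dbar_self hle hF hF0,
      χ.one_of_mem_closedBall (by simpa using hz.le)]
    simp
  · intro j hj z hz
    rw [dbar_cauchyTransform hle hF hF0]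
    apply cauchyTransform_eq_zero
    intro w
    rw [dbar_mul (hχ.differentiable (by simp) _) (hf.differentiable (by simp) _)]
    -- The derivative of the cut-off factors through the `k`-th coordinate, which vanishes on `b j`.
    have hconst : dbar (b j) (fun z : V => ((χ (coordL b k z) : ℝ) : ℂ)) (z - w • b k) = 0 := by
      have h1 : ∀ c : ℂ, fderiv ℝ (fun z : V => ((χ (coordL b k z) : ℝ) : ℂ)) (z - w • b k)
          (c • b j) = 0 := by
        intro c
        have h2 : fderiv ℝ (fun z : V => ((χ (coordL b k z) : ℝ) : ℂ)) (z - w • b k) =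
            (fderiv ℝ (fun c : ℂ => ((χ c : ℝ) : ℂ)) (coordL b k (z - w • b k))).comp
              ((coordL b k).restrictScalars ℝ) := by
          have hd : ContDiff ℝ ∞ fun c : ℂ => ((χ c : ℝ) : ℂ) :=
            Complex.ofRealCLM.contDiff.comp χ.contDiff
          exact (((hd.differentiable (by simp)) _).hasFDerivAt.comp (z - w • b k)
            ((coordL b k).restrictScalars ℝ).hasFDerivAt).fderiv
        rw [h2]
        simp [hj]
      have h3 := h1 1
      rw [one_smul] at h3
      rw [dbar, h3, h1]
      simp
    rw [hconst, zero_mul, zero_add]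
    by_cases hw : ‖b.coord k z - w‖ < r
    · rw [hz w hw, mul_zero]
    · rw [χ.zero_of_le_dist (by simpa using hw)]
      simp

/-- Induction on the number of components that may be non-zero. Solve `∂̄ₖ u = fₖ` for the last such
component. For `j > k` closedness gives `∂̄ⱼ fₖ = ∂̄ₖ fⱼ = 0`, so `∂̄ⱼ u = 0` and subtracting `∂̄u`
removes `fₖ` without reviving the later components. Each step halves the radius in one coordinate.
-/
theorem dolbeault_one_aux {r : ℝ} (hr : 0 < r) (m : ℕ) (hm : m ≤ n) :
    ∀ f : Fin n → V → ℂ, (∀ j, ContDiff ℝ ∞ (f j)) →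
      (∀ i j, ∀ z ∈ polydisc b (radii n r m), dbar (b i) (f j) z = dbar (b j) (f i) z) →
      (∀ j : Fin n, m ≤ j → ∀ z ∈ polydisc b (radii n r m), f j z = 0) →
      ∃ u : V → ℂ, ContDiff ℝ ∞ u ∧
        ∀ j, ∀ z ∈ polydisc b (radii n r 0), dbar (b j) u z = f j z := by
  induction m with
  | zero =>
    intro f _ _ h0
    exact ⟨fun _ => 0, contDiff_const, fun j z hz => by rw [dbar_zero, h0 j (by simp) z hz]⟩
  | succ m ih =>
    intro f hf hcl h0
    let k : Fin n := ⟨m, hm⟩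
    obtain ⟨u, hu, hk, hj⟩ := exists_dbar_eq b (hf k) hr k
    have hdu : ∀ j, ContDiff ℝ ∞ (dbar (b j) u) := fun j => contDiff_dbar hu _
    obtain ⟨u', hu', h'⟩ := ih (by omega) (fun j z => f j z - dbar (b j) u z)
      (fun j => (hf j).sub (hdu j))
      (fun i j z hz => by
        have d1 : ∀ j, DifferentiableAt ℝ (f j) z := fun j => (hf j).differentiable (by simp) z
        have d2 : ∀ j, DifferentiableAt ℝ (dbar (b j) u) z :=
          fun j => (hdu j).differentiable (by simp) z
        rw [dbar_sub (d1 j) (d2 j), dbar_sub (d1 i) (d2 i),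
          hcl i j z (polydisc_radii_succ b hr m hz), dbar_comm hu.contDiffAt])
      (fun j hmj z hz => by
        by_cases hjk : j = k
        · subst hjk
          have := hz k
          rw [hk z (by simpa [radii, k] using this), sub_self]
        · have hlt : m + 1 ≤ (j : ℕ) := by
            have : (j : ℕ) ≠ m := fun h => hjk (Fin.ext h)
            omega
          rw [h0 j hlt z (polydisc_radii_succ b hr m hz), hj j hjk z, sub_zero]
          intro w hw
          have hmem := sub_mem_polydisc_radii b hr (k := k) hz hw
          -- Closedness exchanges the indices, and `f j` vanishes on an open polydisc around the
          -- point.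
          rw [hcl j k _ hmem]
          apply dbar_eq_zero_of_eventuallyEq
          filter_upwards [(isOpen_polydisc b _).mem_nhds hmem] with y hy
          exact h0 j hlt y hy)
    refine ⟨fun z => u z + u' z, hu.add hu', fun j z hz => ?_⟩
    rw [dbar_add (hu.differentiable (by simp) z) (hu'.differentiable (by simp) z), h' j z hz]
    ring

/-- The Dolbeault lemma for `(0,1)`-forms. -/
theorem dolbeault_one {r : ℝ} (hr : 0 < r) (f : Fin n → V → ℂ) (hf : ∀ j, ContDiff ℝ ∞ (f j))
    (hcl : ∀ i j, ∀ z ∈ polydisc b (fun _ => r), dbar (b i) (f j) z = dbar (b j) (f i) z) :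
    ∃ u : V → ℂ, ContDiff ℝ ∞ u ∧
      ∀ j, ∀ z ∈ polydisc b (fun _ => r / 2), dbar (b j) u z = f j z := by
  have h0 : radii n r 0 = fun _ => r / 2 := by funext j; simp [radii]
  have hn : radii n r n = fun _ => r := by funext j; simp [radii]
  obtain ⟨u, hu, h⟩ := dolbeault_one_aux b hr n le_rfl f hf (by rwa [hn])
    (fun j hj => absurd j.2 (by omega))
  exact ⟨u, hu, by rwa [h0] at h⟩

/-- The same induction, now removing all components with an index `k`: solve `∂̄ₖ vᵢ = f k i` and
subtract `∂̄v`. Skew-symmetry extends the vanishing hypothesis from the first index to either index.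
-/
theorem dolbeault_two_aux {r : ℝ} (hr : 0 < r) (m : ℕ) (hm : m ≤ n) :
    ∀ f : Fin n → Fin n → V → ℂ, (∀ i j, ContDiff ℝ ∞ (f i j)) →
      (∀ i j z, f i j z = - f j i z) →
      (∀ i j k, ∀ z ∈ polydisc b (radii n r m),
        dbar (b i) (f j k) z + dbar (b j) (f k i) z + dbar (b k) (f i j) z = 0) →
      (∀ i j : Fin n, m ≤ i → ∀ z ∈ polydisc b (radii n r m), f i j z = 0) →
      ∃ u : Fin n → V → ℂ, (∀ j, ContDiff ℝ ∞ (u j)) ∧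
        ∀ i j, ∀ z ∈ polydisc b (radii n r 0),
          dbar (b i) (u j) z - dbar (b j) (u i) z = f i j z := by
  induction m with
  | zero =>
    intro f _ _ _ h0
    exact ⟨fun _ _ => 0, fun _ => contDiff_const,
      fun i j z hz => by rw [dbar_zero, dbar_zero, h0 i j (by simp) z hz, sub_zero]⟩
  | succ m ih =>
    intro f hf hanti hcl h0
    let k : Fin n := ⟨m, hm⟩
    choose v hv hvk hvj using fun i => exists_dbar_eq b (hf k i) hr k
    -- Only the indices below `m` are corrected: `f k i` is already zero on the polydisc for `i ≥
    -- m`. In particular `u k = 0`, so the new `(k, j)` component is `f k j - ∂̄ₖ vⱼ`.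
    let u : Fin n → V → ℂ := fun i => if (i : ℕ) < m then v i else fun _ => 0
    have hu : ∀ i, ContDiff ℝ ∞ (u i) := by
      intro i
      by_cases h : (i : ℕ) < m
      · simp only [u, h, if_true]; exact hv i
      · simp only [u, h, if_false]; exact contDiff_const
    have hulow : ∀ i : Fin n, (i : ℕ) < m → u i = v i := fun i h => by simp only [u, h, if_true]
    have huhigh : ∀ i : Fin n, ¬ (i : ℕ) < m → u i = fun _ => 0 := fun i h => by
      simp only [u, h, if_false]
    have hdu : ∀ i j, ContDiff ℝ ∞ (dbar (b i) (u j)) := fun i j => contDiff_dbar (hu j) _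
    have hself : ∀ i z, f i i z = 0 := fun i z => by
      have := hanti i i z
      exact self_eq_neg.1 this
    have h0' : ∀ i j : Fin n, m + 1 ≤ (i : ℕ) ∨ m + 1 ≤ (j : ℕ) →
        ∀ z ∈ polydisc b (radii n r (m + 1)), f i j z = 0 := by
      rintro i j (h | h) z hz
      · exact h0 i j h z hz
      · rw [hanti, h0 j i h z hz, neg_zero]
    -- In the cyclic identity for `j`, `k`, `i` the two other terms carry the index `j` and vanish
    -- locally, so `f k i` is holomorphic in direction `j`, and `v i` inherits this.
    have hholo : ∀ i j : Fin n, m + 1 ≤ (j : ℕ) → ∀ z ∈ polydisc b (radii n r m),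
        dbar (b j) (v i) z = 0 := by
      intro i j hmj z hz
      have hjk : j ≠ k := fun h => by
        have : (j : ℕ) = m := congrArg Fin.val h
        omega
      refine hvj i j hjk z fun w hw => ?_
      have hmem := sub_mem_polydisc_radii b hr (k := k) hz hw
      have hz1 : ∀ p q l : Fin n, m + 1 ≤ (p : ℕ) ∨ m + 1 ≤ (q : ℕ) →
          dbar (b l) (f p q) (z - w • b k) = 0 := by
        intro p q l hpq
        apply dbar_eq_zero_of_eventuallyEq
        filter_upwards [(isOpen_polydisc b _).mem_nhds hmem] with y hy
        exact h0' p q hpq y hy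
      have := hcl j k i _ hmem
      rwa [hz1 i j k (Or.inr hmj), hz1 j k i (Or.inl hmj), add_zero, add_zero] at this
    obtain ⟨u', hu', h'⟩ := ih (by omega)
      (fun i j z => f i j z - (dbar (b i) (u j) z - dbar (b j) (u i) z))
      (fun i j => (hf i j).sub ((hdu i j).sub (hdu j i)))
      (fun i j z => by rw [hanti i j]; ring)
      (fun i j l z hz => by
        have d1 : ∀ i j, DifferentiableAt ℝ (f i j) z :=
          fun i j => (hf i j).differentiable (by simp) z
        have d2 : ∀ i j, DifferentiableAt ℝ (dbar (b i) (u j)) z :=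
          fun i j => (hdu i j).differentiable (by simp) z
        have key : ∀ p i j, dbar (b p)
            (fun z => f i j z - (dbar (b i) (u j) z - dbar (b j) (u i) z)) z =
            dbar (b p) (f i j) z -
              (dbar (b p) (dbar (b i) (u j)) z - dbar (b p) (dbar (b j) (u i)) z) := by
          intro p i j
          rw [dbar_sub (g := fun z => dbar (b i) (u j) z - dbar (b j) (u i) z) (d1 i j)
            ((d2 i j).sub (d2 j i)), dbar_sub (d2 i j) (d2 j i)]
        rw [key, key, key]
        have c1 := dbar_comm (hu l).contDiffAt (z := z) (b i) (b j)
        have c2 := dbar_comm (hu i).contDiffAt (z := z) (b j) (b l)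
        have c3 := dbar_comm (hu j).contDiffAt (z := z) (b i) (b l)
        linear_combination hcl i j l z (polydisc_radii_succ b hr m hz) - c1 - c2 + c3)
      (fun i j hmi z hz => by
        have hz' := polydisc_radii_succ b hr m hz
        have hzk : ‖b.coord k z‖ < r / 2 := by simpa [radii, k] using hz k
        rw [huhigh i (by omega), dbar_zero, sub_zero]
        by_cases hj : (j : ℕ) < m
        · rw [hulow j hj]
          by_cases hi : i = k
          · subst hi
            rw [hvk j z hzk, sub_self]
          · have hlt : m + 1 ≤ (i : ℕ) := by
              have : (i : ℕ) ≠ m := fun h => hi (Fin.ext h)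
              omega
            rw [hholo j i hlt z hz, h0 i j hlt z hz', sub_zero]
        · rw [huhigh j hj, dbar_zero, sub_zero]
          by_cases hij : i = j
          · rw [hij, hself]
          · have hij' : (i : ℕ) ≠ j := fun h => hij (Fin.ext h)
            exact h0' i j (by omega) z hz')
    refine ⟨fun i z => u i z + u' i z, fun i => (hu i).add (hu' i), fun i j z hz => ?_⟩
    have e1 : ∀ i, DifferentiableAt ℝ (u i) z := fun i => (hu i).differentiable (by simp) z
    have e2 : ∀ i, DifferentiableAt ℝ (u' i) z := fun i => (hu' i).differentiable (by simp) z
    rw [dbar_add (e1 j) (e2 j), dbar_add (e1 i) (e2 i)]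
    linear_combination h' i j z hz

/-- The Dolbeault lemma for `(0,2)`-forms. -/
theorem dolbeault_two {r : ℝ} (hr : 0 < r) (f : Fin n → Fin n → V → ℂ)
    (hf : ∀ i j, ContDiff ℝ ∞ (f i j)) (hanti : ∀ i j z, f i j z = - f j i z)
    (hcl : ∀ i j k, ∀ z ∈ polydisc b (fun _ => r),
      dbar (b i) (f j k) z + dbar (b j) (f k i) z + dbar (b k) (f i j) z = 0) :
    ∃ u : Fin n → V → ℂ, (∀ j, ContDiff ℝ ∞ (u j)) ∧
      ∀ i j, ∀ z ∈ polydisc b (fun _ => r / 2),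
        dbar (b i) (u j) z - dbar (b j) (u i) z = f i j z := by
  have h0 : radii n r 0 = fun _ => r / 2 := by funext j; simp [radii]
  have hn : radii n r n = fun _ => r := by funext j; simp [radii]
  obtain ⟨u, hu, h⟩ := dolbeault_two_aux b hr n le_rfl f hf hanti (by rwa [hn])
    (fun j _ hj => absurd j.2 (by omega))
  exact ⟨u, hu, by rwa [h0] at h⟩

end Dolbeault

/-! ## Local potentials -/

section Potential

variable {V : Type*} [NormedAddCommGroup V] [NormedSpace ℂ V]

/-- The value of a real-linear form on the vector `1 ⊗ w + i ⊗ iw` of type `(0,1)`. -/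
def antiPart (α : V →L[ℝ] ℂ) (w : V) : ℂ := α w + Complex.I * α (Complex.I • w)

/-- The value of a real-linear form on the vector `1 ⊗ w - i ⊗ iw` of type `(1,0)`. -/
def linPart (α : V →L[ℝ] ℂ) (w : V) : ℂ := α w - Complex.I * α (Complex.I • w)

theorem dbar_apply {α : V → V →L[ℝ] ℂ} {z : V} (h : DifferentiableAt ℝ α z) (v u : V) :
    dbar v (fun y => α y u) z = dbar v α z u := by
  have h1 : HasFDerivAt (fun y => α y u) ((fderiv ℝ α z).flip u) z := by
    simpa using h.hasFDerivAt.clm_apply (hasFDerivAt_const u z)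
  rw [dbar, h1.fderiv, dbar]
  rfl

theorem smul_apply_real (α : V →L[ℝ] ℂ) (c : ℂ) (w : V) :
    α (c • w) = c.re * α w + c.im * α (Complex.I • w) := by
  conv_lhs => rw [← Complex.re_add_im c]
  rw [add_smul, map_add, mul_smul, Complex.coe_smul, Complex.coe_smul, map_smul, map_smul]
  simp

variable {n : ℕ} (b : Module.Basis (Fin n) ℂ V)

/-- The decomposition of a real-linear form along `dzᵢ` and `dz̄ᵢ`; the halves appear because these
take the value `2` on `1 ⊗ bᵢ ∓ i ⊗ i bᵢ` respectively. -/
theorem sum_linPart_antiPart (α : V →L[ℝ] ℂ) (u : V) :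
    ∑ i, (linPart α (b i) * b.coord i u + antiPart α (b i) * star (b.coord i u)) / 2 = α u := by
  conv_rhs => rw [← b.sum_repr u, map_sum]
  refine Finset.sum_congr rfl fun i _ => ?_
  rw [smul_apply_real, linPart, antiPart, Module.Basis.coord_apply]
  set c := b.repr u i
  have h1 : c = c.re + c.im * Complex.I := (Complex.re_add_im c).symm
  have h2 : star c = c.re - c.im * Complex.I := by
    apply Complex.ext <;> simp
  rw [h2]
  nth_rewrite 1 [h1]
  linear_combination (-(c.im : ℂ) * α (Complex.I • b i)) * Complex.I_sq

variable [FiniteDimensional ℂ V]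

/-- The conjugate of a coordinate, as a real-linear form. -/
def conjCoordL (i : Fin n) : V →L[ℝ] ℂ :=
  (Complex.conjCLE : ℂ →L[ℝ] ℂ).comp ((coordL b i).restrictScalars ℝ)

theorem conjCoordL_apply (i : Fin n) (u : V) : conjCoordL b i u = star (b.coord i u) := by
  simp [conjCoordL]

/-- A two-form whose contractions with the `(0,1)`-vectors are closed in the sense that
`dθ(z, w, ·) = 0` for `z`, `w` of type `(0,1)` agrees on `(0,1)`-vectors with an exact form. -/
theorem exists_potential {r : ℝ} (hr : 0 < r) (θ : Fin n → V → V →L[ℝ] ℂ)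
    (hθ : ∀ j, ContDiff ℝ ∞ (θ j))
    (hiso : ∀ i j z, antiPart (θ i z) (b j) = - antiPart (θ j z) (b i))
    (hinv : ∀ i j u, ∀ z ∈ polydisc b (fun _ => r), dbar (b i) (θ j) z u - dbar (b j) (θ i) z u +
      fderiv ℝ (fun y => antiPart (θ i y) (b j)) z u = 0) :
    ∃ a : V → V →L[ℝ] ℂ, ContDiff ℝ ∞ a ∧ ∀ j u, ∀ z ∈ polydisc b (fun _ => r / 4),
      dbar (b j) a z u - antiPart (fderiv ℝ a z u) (b j) = θ j z u := by
  have hev : ∀ j u, ContDiff ℝ ∞ fun z => θ j z u := fun j u => (hθ j).clm_apply contDiff_const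
  have hdθ : ∀ j z, DifferentiableAt ℝ (θ j) z := fun j => (hθ j).differentiable (by simp)
  have hdev : ∀ j u z, DifferentiableAt ℝ (fun z => θ j z u) z := fun j u =>
    (hev j u).differentiable (by simp)
  have hanti : ∀ i j, ContDiff ℝ ∞ fun z => antiPart (θ i z) (b j) := fun i j =>
    (hev i _).add (contDiff_const.mul (hev i _))
  have hlin : ∀ i j, ContDiff ℝ ∞ fun z => linPart (θ i z) (b j) := fun i j =>
    (hev i _).sub (contDiff_const.mul (hev i _))
  have dmulI : ∀ (f : V → ℂ) (z v : V), DifferentiableAt ℝ f z →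
      dbar v (fun y => Complex.I * f y) z = Complex.I * dbar v f z := by
    intro f z v hf
    rw [dbar_mul (differentiableAt_const _) hf]
    simp [dbar]
  have danti : ∀ i j k z, dbar (b k) (fun z => antiPart (θ i z) (b j)) z =
      antiPart (dbar (b k) (θ i) z) (b j) := by
    intro i j k z
    unfold antiPart
    rw [dbar_add (hdev i _ z) ((differentiableAt_const _).fun_mul (hdev i _ z)), dmulI _ _ _ (hdev i _ z),
      dbar_apply (hdθ i z), dbar_apply (hdθ i z)]
  have dlin : ∀ i j k z, dbar (b k) (fun z => linPart (θ i z) (b j)) z =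
      linPart (dbar (b k) (θ i) z) (b j) := by
    intro i j k z
    unfold linPart
    rw [dbar_sub (hdev i _ z) ((differentiableAt_const _).fun_mul (hdev i _ z)), dmulI _ _ _ (hdev i _ z),
      dbar_apply (hdθ i z), dbar_apply (hdθ i z)]
  -- Evaluating `hinv` on the `(0,1)`-vector of `b k` gives the cyclic identity, that is,
  -- `∂̄`-closedness of the `(0,2)`-part of `θ`. A primitive `β` of it supplies the `(0,1)`-part of
  -- the potential.
  obtain ⟨β, hβ, hβ'⟩ := dolbeault_two b hr (fun i j z => antiPart (θ i z) (b j)) hanti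
    (fun i j z => hiso i j z) (by
      intro i j k z hz
      have hki : (fun z => antiPart (θ k z) (b i)) = fun z => -antiPart (θ i z) (b k) :=
        funext fun z => hiso k i z
      rw [danti, hki, dbar_neg, danti]
      have h1 := hinv i j (b k) z hz
      have h2 := hinv i j (Complex.I • b k) z hz
      simp only [antiPart, dbar, smul_eq_mul] at h1 h2 ⊢
      linear_combination h1 + Complex.I * h2)
  have hdβ : ∀ j z, DifferentiableAt ℝ (β j) z := fun j => (hβ j).differentiable (by simp)
  have hfβ : ∀ j u, ContDiff ℝ ∞ fun z => fderiv ℝ (β j) z u := fun j u =>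
    ((hβ j).fderiv_right (m := ∞) (by simp)).clm_apply contDiff_const
  have hg : ∀ i j, ContDiff ℝ ∞ fun z => linPart (θ j z) (b i) + linPart (fderiv ℝ (β j) z) (b i) :=
    fun i j => (hlin j i).add ((hfβ j _).sub (contDiff_const.mul (hfβ j _)))
  -- Derivatives of type `(1,0)` and `(0,1)` of `β` commute.
  have dlinβ : ∀ i j k z, dbar (b k) (fun z => linPart (fderiv ℝ (β j) z) (b i)) z =
      linPart (fderiv ℝ (dbar (b k) (β j)) z) (b i) := by
    intro i j k z
    have hd2 : DifferentiableAt ℝ (fderiv ℝ (β j)) z :=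
      ((hβ j).fderiv_right (m := ∞) (by simp)).differentiable (by simp) z
    unfold linPart
    rw [dbar_sub ((hfβ j _).differentiable (by simp) z)
      ((differentiableAt_const _).fun_mul ((hfβ j _).differentiable (by simp) z)),
      dmulI _ _ _ ((hfβ j _).differentiable (by simp) z), dbar_apply hd2, dbar_apply hd2,
      fderiv_dbar (hβ j).contDiffAt, fderiv_dbar (hβ j).contDiffAt]
    simp only [dbar, add_apply, smul_apply]
    rw [second_fderiv_symm (hβ j).contDiffAt (b k), second_fderiv_symm (hβ j).contDiffAt (b k),
      second_fderiv_symm (hβ j).contDiffAt (Complex.I • b k) (b i),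
      second_fderiv_symm (hβ j).contDiffAt (Complex.I • b k) (Complex.I • b i)]
  have hr2 : 0 < r / 2 := by linarith
  -- For fixed `i` these right-hand sides form a `∂̄`-closed `(0,1)`-form: `hinv` on the
  -- `(1,0)`-vector of `b i` leaves a derivative of the `(0,2)`-part, which the equation for `β`
  -- replaces. A second use of the Dolbeault lemma halves the radius again, whence `r / 4`.
  have hsol : ∀ i, ∃ c : V → ℂ, ContDiff ℝ ∞ c ∧ ∀ j, ∀ z ∈ polydisc b (fun _ => r / 2 / 2),
      dbar (b j) c z = linPart (θ j z) (b i) + linPart (fderiv ℝ (β j) z) (b i) := by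
    intro i
    refine dolbeault_one b hr2 _ (hg i) ?_
    intro k j z hz
    have hz' : z ∈ polydisc b (fun _ => r) := fun l => (hz l).trans (by linarith)
    have hdl : ∀ j, DifferentiableAt ℝ (fun z => linPart (θ j z) (b i)) z := fun j =>
      (hlin j i).differentiable (by simp) z
    have hdl' : ∀ j, DifferentiableAt ℝ (fun z => linPart (fderiv ℝ (β j) z) (b i)) z := fun j =>
      ((hfβ j _).sub (contDiff_const.mul (hfβ j _))).differentiable (by simp) z
    rw [dbar_add (hdl j) (hdl' j), dbar_add (hdl k) (hdl' k), dlin, dlin, dlinβ, dlinβ]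
    have h1 := hinv k j (b i) z hz'
    have h2 := hinv k j (Complex.I • b i) z hz'
    have h3 : (fun y => antiPart (θ k y) (b j)) =ᶠ[nhds z]
        fun y => dbar (b k) (β j) y - dbar (b j) (β k) y := by
      filter_upwards [(isOpen_polydisc b _).mem_nhds hz] with y hy
      exact (hβ' k j y hy).symm
    rw [h3.fderiv_eq, fderiv_fun_sub ((contDiff_dbar (hβ j) _).differentiable (by simp) z)
      ((contDiff_dbar (hβ k) _).differentiable (by simp) z)] at h1 h2
    simp only [sub_apply] at h1 h2
    simp only [linPart]
    linear_combination h1 - Complex.I * h2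
  choose c hc hc' using hsol
  -- The potential is `∑ (cᵢ dzᵢ + βᵢ dz̄ᵢ) / 2`. The equations `∂̄ⱼ cᵢ - ∂ᵢ βⱼ` and `∂̄ⱼ βᵢ - ∂̄ᵢ
  -- βⱼ` give the `(1,0)`- and `(0,1)`-parts of `θⱼ`, up to the normalisation by `2` of the
  -- coordinate vectors.
  refine ⟨fun z => ∑ i, ((c i z / 2) • (coordL b i).restrictScalars ℝ +
    (β i z / 2) • conjCoordL b i), ?_, ?_⟩
  · refine ContDiff.sum fun i _ => ?_
    exact (((hc i).div_const 2).smul contDiff_const).add (((hβ i).div_const 2).smul contDiff_const)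
  · intro j u z hz
    have hdc : ∀ i, DifferentiableAt ℝ (c i) z := fun i => (hc i).differentiable (by simp) z
    have hder : HasFDerivAt (fun z => ∑ i, ((c i z / 2) • (coordL b i).restrictScalars ℝ +
        (β i z / 2) • conjCoordL b i))
        (∑ i, (((fderiv ℝ (c i) z).smulRight ((1 / 2 : ℂ) • (coordL b i).restrictScalars ℝ)) +
          ((fderiv ℝ (β i) z).smulRight ((1 / 2 : ℂ) • conjCoordL b i)))) z := by
      refine HasFDerivAt.fun_sum fun i _ => ?_
      have e1 := (hdc i).hasFDerivAt.smul_const ((1 / 2 : ℂ) • (coordL b i).restrictScalars ℝ)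
      have e2 := (hdβ i z).hasFDerivAt.smul_const ((1 / 2 : ℂ) • conjCoordL b i)
      refine (e1.add e2).congr_of_eventuallyEq (Filter.Eventually.of_forall fun y => ?_)
      simp only [Pi.add_apply, smul_smul]
      congr 2 <;> ring
    have hz2 : z ∈ polydisc b (fun _ => r / 2) := fun l => (hz l).trans (by linarith)
    have hz4 : z ∈ polydisc b (fun _ => r / 2 / 2) := fun l => (hz l).trans_le (by linarith)
    have happ : ∀ v w, (∑ i, (((fderiv ℝ (c i) z).smulRight
        ((1 / 2 : ℂ) • (coordL b i).restrictScalars ℝ)) +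
          ((fderiv ℝ (β i) z).smulRight ((1 / 2 : ℂ) • conjCoordL b i)))) v w =
        ∑ i, (fderiv ℝ (c i) z v * b.coord i w + fderiv ℝ (β i) z v * star (b.coord i w)) / 2 := by
      intro v w
      rw [sum_apply, sum_apply]
      refine Finset.sum_congr rfl fun i _ => ?_
      simp [conjCoordL_apply]
      ring
    have hfirst : dbar (b j) (fun z => ∑ i, ((c i z / 2) • (coordL b i).restrictScalars ℝ +
        (β i z / 2) • conjCoordL b i)) z u =
        ∑ i, (dbar (b j) (c i) z * b.coord i u + dbar (b j) (β i) z * star (b.coord i u)) / 2 := by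
      rw [dbar, hder.fderiv, add_apply, smul_apply, happ, happ, smul_eq_mul, Finset.mul_sum,
        ← Finset.sum_add_distrib]
      refine Finset.sum_congr rfl fun i _ => ?_
      simp only [dbar, smul_eq_mul]
      ring
    -- Contracting in the form slot with the `(0,1)`-vector of `b j` kills every `dzᵢ` and selects
    -- `βⱼ`.
    have hsecond : antiPart (fderiv ℝ (fun z => ∑ i, ((c i z / 2) • (coordL b i).restrictScalars ℝ +
        (β i z / 2) • conjCoordL b i)) z u) (b j) = fderiv ℝ (β j) z u := by
      rw [antiPart, hder.fderiv, happ, happ, Finset.mul_sum, ← Finset.sum_add_distrib,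
        Finset.sum_eq_single j]
      · simp
        linear_combination (fderiv ℝ (c j) z u - fderiv ℝ (β j) z u) / 2 * Complex.I_sq
      · intro i _ hij
        simp [hij.symm]
      · simp
    rw [hfirst, hsecond, ← sum_linPart_antiPart b (θ j z) u,
      ← sum_linPart_antiPart b (fderiv ℝ (β j) z) u, ← Finset.sum_sub_distrib]
    refine Finset.sum_congr rfl fun i _ => ?_
    rw [hc' i j z hz4]
    have h1 := hβ' j i z hz2
    have h2 : dbar (b i) (β j) z = antiPart (fderiv ℝ (β j) z) (b i) := by
      simp [dbar, antiPart]
    rw [h2] at h1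
    linear_combination star (b.coord i u) / 2 * h1

end Potential

/-! ## Vector fields and one-forms in a chart -/

section Charts

variable (𝕜 : Type*) [RCLike 𝕜] [NormedSpace 𝕜 ℂ]
  {V : Type*} [NormedAddCommGroup V] [NormedSpace 𝕜 V]
  {X : Type*} [TopologicalSpace X] [ChartedSpace V X]

/-- The derivative at `x` of the preferred chart at `x₀`. -/
def chartD (x₀ x : X) : V →L[𝕜] V := mfderiv 𝓘(𝕜, V) 𝓘(𝕜, V) (extChartAt 𝓘(𝕜, V) x₀) x

/-- The derivative at `y` of the inverse of the preferred chart at `x₀`. -/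
def chartDinv (x₀ : X) (y : V) : V →L[𝕜] V :=
  mfderiv 𝓘(𝕜, V) 𝓘(𝕜, V) (extChartAt 𝓘(𝕜, V) x₀).symm y

/-- The coordinate expression of a vector field in the preferred chart at `x₀`. -/
def fieldInChart (x₀ : X) (A : ∀ x : X, TangentSpace 𝓘(𝕜, V) x) (y : V) : V :=
  chartD 𝕜 x₀ ((extChartAt 𝓘(𝕜, V) x₀).symm y) (A ((extChartAt 𝓘(𝕜, V) x₀).symm y))

/-- The part over `U` of the domain of the inverse of the preferred chart at `x₀`. -/
def chartDom (x₀ : X) (U : Opens X) : Set V :=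
  (extChartAt 𝓘(𝕜, V) x₀).target ∩ (extChartAt 𝓘(𝕜, V) x₀).symm ⁻¹' U

variable {𝕜}

omit [NormedSpace 𝕜 ℂ] in
theorem isOpen_chartDom (x₀ : X) (U : Opens X) : IsOpen (chartDom 𝕜 (V := V) x₀ U) :=
  (continuousOn_extChartAt_symm x₀).isOpen_inter_preimage (isOpen_extChartAt_target x₀) U.2

omit [NormedSpace 𝕜 ℂ] in
theorem mem_chartDom {x₀ x : X} {U : Opens X} (hx : x ∈ (extChartAt 𝓘(𝕜, V) x₀).source)
    (hU : x ∈ U) : extChartAt 𝓘(𝕜, V) x₀ x ∈ chartDom 𝕜 x₀ U := by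
  refine ⟨(extChartAt 𝓘(𝕜, V) x₀).map_source hx, ?_⟩
  rw [mem_preimage, (extChartAt 𝓘(𝕜, V) x₀).left_inv hx]
  exact hU

theorem formInChart_apply (x₀ : X) (ξ : ∀ x : X, TangentSpace 𝓘(𝕜, V) x →L[𝕜] ℂ) (y v : V) :
    formInChart 𝕜 x₀ ξ y v = ξ ((extChartAt 𝓘(𝕜, V) x₀).symm y) (chartDinv 𝕜 x₀ y v) := rfl

variable [IsManifold 𝓘(𝕜, V) ∞ X]

omit [NormedSpace 𝕜 ℂ] in
theorem mdifferentiableAt_chart_symm {x₀ : X} {y : V} (hy : y ∈ (extChartAt 𝓘(𝕜, V) x₀).target) :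
    MDifferentiableAt 𝓘(𝕜, V) 𝓘(𝕜, V) (extChartAt 𝓘(𝕜, V) x₀).symm y := by
  have := mdifferentiableWithinAt_extChartAt_symm (I := 𝓘(𝕜, V)) hy
  rw [← mdifferentiableWithinAt_univ]
  simpa only [modelWithCornersSelf_coe, range_id] using this

omit [NormedSpace 𝕜 ℂ] in
theorem chartD_chartDinv {x₀ : X} {y : V} (hy : y ∈ (extChartAt 𝓘(𝕜, V) x₀).target) (v : V) :
    chartD 𝕜 x₀ ((extChartAt 𝓘(𝕜, V) x₀).symm y) (chartDinv 𝕜 x₀ y v) = v := by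
  have := mfderiv_extChartAt_comp_mfderivWithin_extChartAt_symm (I := 𝓘(𝕜, V)) hy
  simp only [modelWithCornersSelf_coe, range_id, mfderivWithin_univ] at this
  exact DFunLike.congr_fun this v

omit [NormedSpace 𝕜 ℂ] in
theorem chartDinv_chartD {x₀ : X} {y : V} (hy : y ∈ (extChartAt 𝓘(𝕜, V) x₀).target) (v : V) :
    chartDinv 𝕜 x₀ y (chartD 𝕜 x₀ ((extChartAt 𝓘(𝕜, V) x₀).symm y) v) = v := by
  have := mfderivWithin_extChartAt_symm_comp_mfderiv_extChartAt (I := 𝓘(𝕜, V)) hy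
  simp only [modelWithCornersSelf_coe, range_id, mfderivWithin_univ] at this
  exact DFunLike.congr_fun this v

theorem formInChart_field {x₀ : X} (ξ : ∀ x : X, TangentSpace 𝓘(𝕜, V) x →L[𝕜] ℂ)
    (A : ∀ x : X, TangentSpace 𝓘(𝕜, V) x) {y : V} (hy : y ∈ (extChartAt 𝓘(𝕜, V) x₀).target) :
    formInChart 𝕜 x₀ ξ y (fieldInChart 𝕜 x₀ A y) =
      ξ ((extChartAt 𝓘(𝕜, V) x₀).symm y) (A ((extChartAt 𝓘(𝕜, V) x₀).symm y)) :=
  congrArg (ξ _) (chartDinv_chartD hy _)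

/-- The change of coordinates between two preferred charts. -/
def transition (𝕜 : Type*) [RCLike 𝕜] {V : Type*} [NormedAddCommGroup V] [NormedSpace 𝕜 V]
    {X : Type*} [TopologicalSpace X] [ChartedSpace V X] (x₁ x₀ : X) (y : V) : V :=
  extChartAt 𝓘(𝕜, V) x₀ ((extChartAt 𝓘(𝕜, V) x₁).symm y)

/-- The domain of the change of coordinates between two preferred charts. -/
def transitionDom (𝕜 : Type*) [RCLike 𝕜] {V : Type*} [NormedAddCommGroup V] [NormedSpace 𝕜 V]
    {X : Type*} [TopologicalSpace X] [ChartedSpace V X] (x₁ x₀ : X) : Set V :=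
  (extChartAt 𝓘(𝕜, V) x₁).target ∩
    (extChartAt 𝓘(𝕜, V) x₁).symm ⁻¹' (extChartAt 𝓘(𝕜, V) x₀).source

omit [NormedSpace 𝕜 ℂ] [IsManifold 𝓘(𝕜, V) ∞ X] in
theorem isOpen_transitionDom (x₁ x₀ : X) : IsOpen (transitionDom 𝕜 (V := V) x₁ x₀) :=
  (continuousOn_extChartAt_symm x₁).isOpen_inter_preimage (isOpen_extChartAt_target x₁)
    (isOpen_extChartAt_source x₀)

omit [NormedSpace 𝕜 ℂ] in
theorem contDiffOn_transition (x₁ x₀ : X) :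
    ContDiffOn 𝕜 ∞ (transition 𝕜 (V := V) x₁ x₀) (transitionDom 𝕜 x₁ x₀) := by
  rw [← contMDiffOn_iff_contDiffOn]
  have h1 := contMDiffOn_extChartAt_symm (I := 𝓘(𝕜, V)) (n := ∞) x₁
  have h0 := contMDiffOn_extChartAt (I := 𝓘(𝕜, V)) (n := ∞) (x := x₀)
  refine h0.comp (h1.mono inter_subset_left) fun y hy => ?_
  simpa using hy.2

omit [NormedSpace 𝕜 ℂ] in
theorem fderiv_transition {x₁ x₀ : X} {y : V} (hy : y ∈ transitionDom 𝕜 x₁ x₀) :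
    fderiv 𝕜 (transition 𝕜 x₁ x₀) y =
      (chartD 𝕜 x₀ ((extChartAt 𝓘(𝕜, V) x₁).symm y)).comp (chartDinv 𝕜 x₁ y) := by
  rw [← mfderiv_eq_fderiv]
  exact mfderiv_comp y (mdifferentiableAt_extChartAt (by simpa using hy.2))
    (mdifferentiableAt_chart_symm hy.1)

theorem formInChart_transition (ξ : ∀ x : X, TangentSpace 𝓘(𝕜, V) x →L[𝕜] ℂ) {x₁ x₀ : X} {y : V}
    (hy : y ∈ transitionDom 𝕜 x₁ x₀) :
    formInChart 𝕜 x₁ ξ y = (formInChart 𝕜 x₀ ξ (transition 𝕜 x₁ x₀ y)).comp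
      (fderiv 𝕜 (transition 𝕜 x₁ x₀) y) := by
  ext v
  rw [fderiv_transition hy]
  change ξ _ _ = formInChart 𝕜 x₀ ξ _ (chartD 𝕜 x₀ _ (chartDinv 𝕜 x₁ y v))
  have hx : (extChartAt 𝓘(𝕜, V) x₀).symm (transition 𝕜 x₁ x₀ y) =
      (extChartAt 𝓘(𝕜, V) x₁).symm y := (extChartAt 𝓘(𝕜, V) x₀).left_inv hy.2
  have ht : transition 𝕜 x₁ x₀ y ∈ (extChartAt 𝓘(𝕜, V) x₀).target :=
    (extChartAt 𝓘(𝕜, V) x₀).map_source hy.2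
  have h := chartDinv_chartD (𝕜 := 𝕜) ht (chartDinv 𝕜 x₁ y v)
  rw [formInChart_apply, hx] at *
  rw [h]
  rfl

/-- Coordinate expressions in two charts differ by composition with the smooth transition map and
its derivative, so one chart containing `U` suffices. -/
theorem smoothForm_iff {U : Opens X} {x₀ : X} (hU : (U : Set X) ⊆ (extChartAt 𝓘(𝕜, V) x₀).source)
    (ξ : ∀ x : X, TangentSpace 𝓘(𝕜, V) x →L[𝕜] ℂ) :
    SmoothForm 𝕜 U ξ ↔ ContDiffOn 𝕜 ∞ (formInChart 𝕜 x₀ ξ) (chartDom 𝕜 x₀ U) := by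
  refine ⟨fun h => h x₀, fun h x₁ => ?_⟩
  have hsub : chartDom 𝕜 x₁ U ⊆ transitionDom 𝕜 x₁ x₀ := fun y hy => ⟨hy.1, hU hy.2⟩
  have hmaps : MapsTo (transition 𝕜 x₁ x₀) (chartDom 𝕜 x₁ U) (chartDom 𝕜 x₀ U) := fun y hy =>
    mem_chartDom (hU hy.2) hy.2
  have hτ := (contDiffOn_transition (𝕜 := 𝕜) x₁ x₀).mono hsub
  have hdτ : ContDiffOn 𝕜 ∞ (fderiv 𝕜 (transition 𝕜 x₁ x₀)) (chartDom 𝕜 x₁ U) :=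
    hτ.fderiv_of_isOpen (isOpen_chartDom x₁ U) (by simp)
  refine ((h.comp hτ hmaps).clm_comp hdτ).congr fun y hy => ?_
  exact formInChart_transition ξ (hsub hy)

omit [IsManifold 𝓘(𝕜, V) ∞ X] in
theorem SmoothForm.contDiffAt {U : Opens X} {ξ : ∀ x : X, TangentSpace 𝓘(𝕜, V) x →L[𝕜] ℂ}
    (h : SmoothForm 𝕜 U ξ) {x₀ : X} {y : V} (hy : y ∈ chartDom 𝕜 x₀ U) :
    ContDiffAt 𝕜 ∞ (formInChart 𝕜 x₀ ξ) y :=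
  (h x₀).contDiffAt ((isOpen_chartDom x₀ U).mem_nhds hy)

omit [NormedSpace 𝕜 ℂ] in
-- In the trivialization of the tangent bundle at `x₀` a vector field reads as the derivative of the
-- chart applied to it.
theorem smoothField_iff {U : Opens X} {x₀ : X}
    (hU : (U : Set X) ⊆ (extChartAt 𝓘(𝕜, V) x₀).source) (A : ∀ x : X, TangentSpace 𝓘(𝕜, V) x) :
    SmoothField 𝕜 U A ↔ ContDiffOn 𝕜 ∞ (fieldInChart 𝕜 x₀ A) (chartDom 𝕜 x₀ U) := by
  have hU' : (U : Set X) ⊆ (chartAt V x₀).source := by simpa using hU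
  have hb : (U : Set X) ⊆ (trivializationAt V (TangentSpace 𝓘(𝕜, V)) x₀).baseSet := by
    simpa using hU'
  have h1 : SmoothField 𝕜 U A ↔
      ContMDiffOn 𝓘(𝕜, V) 𝓘(𝕜, V) ∞ (fun x => chartD 𝕜 x₀ x (A x)) U := by
    refine ((trivializationAt V (TangentSpace 𝓘(𝕜, V)) x₀).contMDiffOn_section_iff U.2 hb).trans ?_
    refine contMDiffOn_congr fun x hx => ?_
    have := TangentBundle.continuousLinearMapAt_trivializationAt (I := 𝓘(𝕜, V)) (hU' hx)
    have h2 := DFunLike.congr_fun this (A x)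
    rw [Bundle.Trivialization.continuousLinearMapAt_apply_of_mem 𝕜 _ (hb hx)] at h2
    exact h2
  rw [h1, ← contMDiffOn_iff_contDiffOn]
  constructor
  · intro h
    have h3 := contMDiffOn_extChartAt_symm (I := 𝓘(𝕜, V)) (n := ∞) x₀
    exact h.comp (h3.mono inter_subset_left) fun y hy => hy.2
  · intro h
    have h3 := (contMDiffOn_extChartAt (I := 𝓘(𝕜, V)) (n := ∞) (x := x₀)).mono hU'
    refine (h.comp h3 fun x hx => mem_chartDom (hU hx) hx).congr fun x hx => ?_
    simp only [Function.comp_apply, fieldInChart]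
    rw [(extChartAt 𝓘(𝕜, V) x₀).left_inv (hU hx)]

omit [NormedSpace 𝕜 ℂ] in
theorem SmoothField.mono {U W : Opens X} (hWU : W ≤ U) {A : ∀ x : X, TangentSpace 𝓘(𝕜, V) x}
    (h : SmoothField 𝕜 U A) : SmoothField 𝕜 W A :=
  ContMDiffOn.mono h hWU

omit [IsManifold 𝓘(𝕜, V) ∞ X] in
theorem SmoothForm.mono {U W : Opens X} (hWU : W ≤ U)
    {ξ : ∀ x : X, TangentSpace 𝓘(𝕜, V) x →L[𝕜] ℂ} (h : SmoothForm 𝕜 U ξ) : SmoothForm 𝕜 W ξ :=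
  fun x₀ => (h x₀).mono fun _ hy => ⟨hy.1, hWU hy.2⟩

/-- The domain of the preferred chart at `x₀`. -/
def chartOpens (V : Type*) [TopologicalSpace V] {X : Type*} [TopologicalSpace X]
    [ChartedSpace V X] (x₀ : X) : Opens X := ⟨(chartAt V x₀).source, (chartAt V x₀).open_source⟩

omit [NormedSpace 𝕜 ℂ] in
theorem SmoothField.contDiffAt {U : Opens X} {A : ∀ x : X, TangentSpace 𝓘(𝕜, V) x}
    (h : SmoothField 𝕜 U A) {x₀ : X} {y : V} (hy : y ∈ chartDom 𝕜 x₀ U) :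
    ContDiffAt 𝕜 ∞ (fieldInChart 𝕜 x₀ A) y := by
  have h1 : SmoothField 𝕜 (U ⊓ chartOpens V x₀) A := h.mono inf_le_left
  rw [smoothField_iff (x₀ := x₀) (by
    intro x hx
    simpa [chartOpens] using hx.2)] at h1
  refine h1.contDiffAt ((isOpen_chartDom x₀ _).mem_nhds ⟨hy.1, hy.2, ?_⟩)
  have := (extChartAt 𝓘(𝕜, V) x₀).map_target hy.1
  simpa [chartOpens] using this

omit [IsManifold 𝓘(𝕜, V) ∞ X] in
theorem smoothForm_of_local {U : Opens X} {ξ : ∀ x : X, TangentSpace 𝓘(𝕜, V) x →L[𝕜] ℂ}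
    (h : ∀ x ∈ U, ∃ W : Opens X, x ∈ W ∧ SmoothForm 𝕜 W ξ) : SmoothForm 𝕜 U ξ := by
  intro x₀ y hy
  obtain ⟨W, hxW, hW⟩ := h _ hy.2
  exact (hW.contDiffAt (x₀ := x₀) ⟨hy.1, hxW⟩).contDiffWithinAt

omit [NormedSpace 𝕜 ℂ] in
theorem smoothField_of_local {U : Opens X} {A : ∀ x : X, TangentSpace 𝓘(𝕜, V) x}
    (h : ∀ x ∈ U, ∃ W : Opens X, x ∈ W ∧ SmoothField 𝕜 W A) : SmoothField 𝕜 U A := by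
  intro x hx
  obtain ⟨W, hxW, hW⟩ := h x hx
  exact (ContMDiffOn.contMDiffAt hW (W.2.mem_nhds hxW)).contMDiffWithinAt

omit [NormedSpace 𝕜 ℂ] in
-- The tangent space at `x` is modelled on `V` through the preferred chart at `x` itself.
theorem chartD_self (x : X) (v : V) : chartD 𝕜 x x v = v := by
  have h := TangentBundle.continuousLinearMapAt_trivializationAt (I := 𝓘(𝕜, V))
    (mem_chart_source V x)
  rw [TangentBundle.continuousLinearMapAt_trivializationAt_eq_core (mem_chart_source V x)] at h
  have h2 := DFunLike.congr_fun h v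
  refine h2.symm.trans ?_
  exact (tangentBundleCore 𝓘(𝕜, V) X).coordChange_self (achart V x) x (mem_chart_source V x) v

/-- The exterior derivative of a one-form on a vector space. -/
def extV (α : V → V →L[𝕜] ℂ) (y u v : V) : ℂ := fderiv 𝕜 α y u v - fderiv 𝕜 α y v u

theorem extD_eq {U : Opens X} {ξ : ∀ x : X, TangentSpace 𝓘(𝕜, V) x →L[𝕜] ℂ}
    (h : SmoothForm 𝕜 U ξ) {x₀ : X} {y : V} (hy : y ∈ chartDom 𝕜 x₀ U) (u v : V) :
    extD 𝕜 ξ ((extChartAt 𝓘(𝕜, V) x₀).symm y) u v =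
      extV (formInChart 𝕜 x₀ ξ) y (chartD 𝕜 x₀ ((extChartAt 𝓘(𝕜, V) x₀).symm y) u)
        (chartD 𝕜 x₀ ((extChartAt 𝓘(𝕜, V) x₀).symm y) v) := by
  set x := (extChartAt 𝓘(𝕜, V) x₀).symm y with hx
  set p := extChartAt 𝓘(𝕜, V) x x with hp
  set τ := transition 𝕜 (V := V) x x₀ with hτ
  have hxs : x ∈ (extChartAt 𝓘(𝕜, V) x₀).source := (extChartAt 𝓘(𝕜, V) x₀).map_target hy.1
  have hpx : (extChartAt 𝓘(𝕜, V) x).symm p = x := extChartAt_to_inv x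
  have hpt : p ∈ transitionDom 𝕜 x x₀ := by
    refine ⟨mem_extChartAt_target x, ?_⟩
    rw [mem_preimage, hpx]
    exact hxs
  have hτp : τ p = y := by
    rw [hτ, transition, hpx, hx]
    exact (extChartAt 𝓘(𝕜, V) x₀).right_inv hy.1
  have hinv : ∀ w : V, chartDinv 𝕜 x p w = w := by
    intro w
    have := chartD_chartDinv (𝕜 := 𝕜) (x₀ := x) (y := p) (mem_extChartAt_target x) w
    rwa [hpx, chartD_self] at this
  have hτd : ∀ w, fderiv 𝕜 τ p w = chartD 𝕜 x₀ x w := by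
    intro w
    rw [hτ, fderiv_transition hpt, ContinuousLinearMap.comp_apply, hinv, hpx]
  have hev : formInChart 𝕜 x ξ =ᶠ[nhds p]
      fun z => (formInChart 𝕜 x₀ ξ (τ z)).comp (fderiv 𝕜 τ z) := by
    filter_upwards [(isOpen_transitionDom x x₀).mem_nhds hpt] with z hz
    exact formInChart_transition ξ hz
  have hτc : ContDiffAt 𝕜 ∞ τ p :=
    (contDiffOn_transition x x₀).contDiffAt ((isOpen_transitionDom x x₀).mem_nhds hpt)
  have hα : DifferentiableAt 𝕜 (formInChart 𝕜 x₀ ξ) (τ p) := by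
    rw [hτp]
    exact (h.contDiffAt hy).differentiableAt (by simp)
  have hdτ : DifferentiableAt 𝕜 (fderiv 𝕜 τ) p :=
    (hτc.fderiv_right (m := ∞) (by simp)).differentiableAt (by simp)
  have hτd1 : DifferentiableAt 𝕜 τ p := hτc.differentiableAt (by simp)
  have hder : ∀ a b, fderiv 𝕜 (formInChart 𝕜 x ξ) p a b =
      fderiv 𝕜 (formInChart 𝕜 x₀ ξ) y (fderiv 𝕜 τ p a) (fderiv 𝕜 τ p b) +
        formInChart 𝕜 x₀ ξ y (fderiv 𝕜 (fderiv 𝕜 τ) p a b) := by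
    intro a b
    have hd : HasFDerivAt (fun z => (formInChart 𝕜 x₀ ξ (τ z)).comp (fderiv 𝕜 τ z)) _ p :=
      (hα.hasFDerivAt.comp p hτd1.hasFDerivAt).clm_comp hdτ.hasFDerivAt
    rw [hev.fderiv_eq, hd.fderiv]
    simp [hτp, add_comm]
  -- The second derivative of the transition map is symmetric, so it drops out of the
  -- antisymmetrisation: this is the chart independence of `d`.
  have hsymm : ∀ a b, fderiv 𝕜 (fderiv 𝕜 τ) p a b = fderiv 𝕜 (fderiv 𝕜 τ) p b a := fun a b =>
    (hτc.isSymmSndFDerivAt (by simpa using WithTop.coe_le_coe.2 (le_top : (2 : ℕ∞) ≤ ⊤))) a b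
  have h1 : extD 𝕜 ξ x u v = fderiv 𝕜 (formInChart 𝕜 x ξ) p u v -
      fderiv 𝕜 (formInChart 𝕜 x ξ) p v u := rfl
  rw [h1, hder, hder, hsymm v u, extV, hτd, hτd]
  ring

/-- The derivative of the inverse chart turns a coordinate vector into a tangent vector, so
`extD_eq` reads as a formula in `V`. -/
theorem contract_eq {U : Opens X} {ξ : ∀ x : X, TangentSpace 𝓘(𝕜, V) x →L[𝕜] ℂ}
    (h : SmoothForm 𝕜 U ξ) {x₀ : X} {y : V} (hy : y ∈ chartDom 𝕜 x₀ U)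
    (A : ∀ x : X, TangentSpace 𝓘(𝕜, V) x) (v : V) :
    contract 𝕜 ξ ((extChartAt 𝓘(𝕜, V) x₀).symm y) (A ((extChartAt 𝓘(𝕜, V) x₀).symm y))
      (chartDinv 𝕜 x₀ y v) =
      extV (formInChart 𝕜 x₀ ξ) y (fieldInChart 𝕜 x₀ A y) v := by
  have := extD_eq h hy (A ((extChartAt 𝓘(𝕜, V) x₀).symm y)) (chartDinv 𝕜 x₀ y v)
  rw [chartD_chartDinv hy.1] at this
  exact this

omit [NormedSpace 𝕜 ℂ] in
-- Pull-back by the inverse chart commutes with Lie brackets, and on `V` the bracket is the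
-- difference of directional derivatives.
theorem mlieBracket_eq [CompleteSpace V] {U : Opens X} {A B : ∀ x : X, TangentSpace 𝓘(𝕜, V) x}
    (hA : SmoothField 𝕜 U A) (hB : SmoothField 𝕜 U B) {x₀ : X} {y : V}
    (hy : y ∈ chartDom 𝕜 x₀ U) :
    chartD 𝕜 (V := V) x₀ ((extChartAt 𝓘(𝕜, V) x₀).symm y)
      (VectorField.mlieBracket 𝓘(𝕜, V) A B ((extChartAt 𝓘(𝕜, V) x₀).symm y)) =
    fderiv 𝕜 (fieldInChart 𝕜 x₀ B) y (fieldInChart 𝕜 x₀ A y) -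
      fderiv 𝕜 (fieldInChart 𝕜 x₀ A) y (fieldInChart 𝕜 x₀ B y) := by
  have hpull : ∀ C : ∀ x : X, TangentSpace 𝓘(𝕜, V) x, ∀ z ∈ (extChartAt 𝓘(𝕜, V) x₀).target,
      VectorField.mpullback 𝓘(𝕜, V) 𝓘(𝕜, V) (extChartAt 𝓘(𝕜, V) x₀).symm C z =
        fieldInChart 𝕜 x₀ C z := by
    intro C z hz
    have hinv : ContinuousLinearMap.inverse (chartDinv 𝕜 x₀ z) =
        chartD 𝕜 x₀ ((extChartAt 𝓘(𝕜, V) x₀).symm z) :=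
      ContinuousLinearMap.inverse_eq (ContinuousLinearMap.ext fun v => chartDinv_chartD hz v)
        (ContinuousLinearMap.ext fun v => chartD_chartDinv hz v)
    exact DFunLike.congr_fun hinv (C _)
  have hm : ∀ C : ∀ x : X, TangentSpace 𝓘(𝕜, V) x, SmoothField 𝕜 U C →
      MDifferentiableAt 𝓘(𝕜, V) 𝓘(𝕜, V).tangent
        (fun x => (⟨x, C x⟩ : TangentBundle 𝓘(𝕜, V) X)) ((extChartAt 𝓘(𝕜, V) x₀).symm y) :=
    fun C hC => (ContMDiffOn.contMDiffAt hC (U.2.mem_nhds hy.2)).mdifferentiableAt (by simp)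
  have h2 : minSmoothness 𝕜 2 ≤ ∞ := by
    simpa using WithTop.coe_le_coe.2 (le_top : (2 : ℕ∞) ≤ ⊤)
  have : IsManifold 𝓘(𝕜, V) (minSmoothness 𝕜 2) X := IsManifold.of_le h2
  have hf : ContMDiffAt 𝓘(𝕜, V) 𝓘(𝕜, V) ∞ (extChartAt 𝓘(𝕜, V) x₀).symm y :=
    (contMDiffOn_extChartAt_symm x₀).contMDiffAt ((isOpen_extChartAt_target x₀).mem_nhds hy.1)
  have h := VectorField.mpullback_mlieBracket (I := 𝓘(𝕜, V)) (hm A hA) (hm B hB) hf h2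
  rw [hpull _ y hy.1] at h
  refine h.trans ?_
  have hev : ∀ C : ∀ x : X, TangentSpace 𝓘(𝕜, V) x,
      VectorField.mpullback 𝓘(𝕜, V) 𝓘(𝕜, V) (extChartAt 𝓘(𝕜, V) x₀).symm C =ᶠ[nhds y]
        fieldInChart 𝕜 x₀ C := by
    intro C
    filter_upwards [(isOpen_extChartAt_target x₀).mem_nhds hy.1] with z hz
    exact hpull C z hz
  have hl : ∀ P Q : ∀ z : V, TangentSpace 𝓘(𝕜, V) z,
      VectorField.mlieBracket 𝓘(𝕜, V) P Q y = VectorField.lieBracket 𝕜 P Q y := by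
    intro P Q
    rw [← VectorField.mlieBracketWithin_univ, VectorField.mlieBracketWithin_eq_lieBracketWithin]
    exact congrFun (VectorField.lieBracketWithin_univ (𝕜 := 𝕜) (V := P) (W := Q)) y
  rw [(hev A).mlieBracket_vectorField_eq (hev B)]
  exact hl _ _

end Charts

/-! ## Complex tangent vectors -/

section ComplexTangent

variable {V : Type*} [NormedAddCommGroup V] [NormedSpace ℂ V]
  {X : Type*} [TopologicalSpace X] [ChartedSpace V X]

/-- The complex tangent vector with given real and imaginary parts. -/
def mkCT (x : X) (a b : TangentSpace 𝓘(ℝ, V) x) : CT V x :=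
  (1 : ℂ) ⊗ₜ[ℝ] a + Complex.I ⊗ₜ[ℝ] b

theorem reT_tmul (x : X) (c : ℂ) (v : TangentSpace 𝓘(ℝ, V) x) : reT x (c ⊗ₜ[ℝ] v) = c.re • v := by
  simp [reT]

theorem imT_tmul (x : X) (c : ℂ) (v : TangentSpace 𝓘(ℝ, V) x) : imT x (c ⊗ₜ[ℝ] v) = c.im • v := by
  simp [imT]

@[simp] theorem reT_mkCT (x : X) (a b : TangentSpace 𝓘(ℝ, V) x) : reT x (mkCT x a b) = a := by
  simp [mkCT, reT_tmul]

@[simp] theorem imT_mkCT (x : X) (a b : TangentSpace 𝓘(ℝ, V) x) : imT x (mkCT x a b) = b := by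
  simp [mkCT, imT_tmul]

theorem mkCT_reT_imT (x : X) (z : CT V x) : mkCT x (reT x z) (imT x z) = z := by
  induction z using TensorProduct.induction_on with
  | zero => simp [mkCT]
  | tmul c v =>
    rw [reT_tmul, imT_tmul, mkCT, TensorProduct.tmul_smul, TensorProduct.tmul_smul,
      TensorProduct.smul_tmul', TensorProduct.smul_tmul', ← TensorProduct.add_tmul]
    congr 1
    apply Complex.ext <;> simp
  | add z w hz hw =>
    conv_rhs => rw [← hz, ← hw]
    simp only [mkCT, map_add, TensorProduct.tmul_add]
    abel

theorem CT_ext {x : X} {z w : CT V x} (h1 : reT x z = reT x w) (h2 : imT x z = imT x w) :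
    z = w := by
  rw [← mkCT_reT_imT x z, ← mkCT_reT_imT x w, h1, h2]

theorem reT_smul (x : X) (c : ℂ) (z : CT V x) :
    reT x (c • z) = c.re • reT x z - c.im • imT x z := by
  induction z using TensorProduct.induction_on with
  | zero => simp
  | tmul d v =>
    rw [TensorProduct.smul_tmul', reT_tmul, reT_tmul, imT_tmul, smul_smul, smul_smul, ← sub_smul]
    simp
  | add z w hz hw =>
    rw [smul_add, map_add, hz, hw, map_add, map_add]
    simp only [smul_add]
    abel

theorem imT_smul (x : X) (c : ℂ) (z : CT V x) :
    imT x (c • z) = c.re • imT x z + c.im • reT x z := by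
  induction z using TensorProduct.induction_on with
  | zero => simp
  | tmul d v =>
    rw [TensorProduct.smul_tmul', imT_tmul, reT_tmul, imT_tmul, smul_smul, smul_smul, ← add_smul]
    simp
  | add z w hz hw =>
    rw [smul_add, map_add, hz, hw, map_add, map_add]
    simp only [smul_add]
    abel

theorem ev_add_left {x : X} (ξ η : CForm V x) (z : CT V x) : ev (ξ + η) z = ev ξ z + ev η z := by
  simp only [ev, add_apply]; ring

@[simp] theorem ev_zero_left {x : X} (z : CT V x) : ev (0 : CForm V x) z = 0 := by
  simp [ev]

theorem ev_mkCT {x : X} (ξ : CForm V x) (a b : TangentSpace 𝓘(ℝ, V) x) :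
    ev ξ (mkCT x a b) = ξ a + Complex.I * ξ b := by
  simp [ev]

/-- A tangent vector regarded as a vector of the model space. -/
def asVec {x : X} (a : TangentSpace 𝓘(ℝ, V) x) : V := a

/-- A vector of the model space regarded as a tangent vector. -/
def tvec (x : X) (v : V) : TangentSpace 𝓘(ℝ, V) x := v

/-- A holomorphic tangent vector regarded as a vector of the model space. -/
def asHVec {x : X} (a : HT V x) : V := a

theorem asHVec_holPart (x : X) (z : CT V x) :
    asHVec (holPart x z) = asVec (reT x z) + Complex.I • asVec (imT x z) := by
  induction z using TensorProduct.induction_on with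
  | zero =>
    rw [map_zero, map_zero, map_zero]
    change (0 : V) = 0 + Complex.I • (0 : V)
    simp
  | tmul c v =>
    rw [reT_tmul, imT_tmul]
    have h1 : asHVec (holPart x (c ⊗ₜ[ℝ] v)) = c • asVec v :=
      LinearMap.liftBaseChange_tmul ℂ (LinearMap.id : V →ₗ[ℝ] V) c v
    rw [h1]
    change c • asVec v = c.re • asVec v + Complex.I • c.im • asVec v
    conv_lhs => rw [← Complex.re_add_im c]
    rw [add_smul, mul_comm, mul_smul, Complex.coe_smul, Complex.coe_smul]
  | add z w hz hw =>
    rw [map_add, map_add, map_add]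
    change asHVec (holPart x z) + asHVec (holPart x w) = (asVec (reT x z) + asVec (reT x w)) +
      Complex.I • (asVec (imT x z) + asVec (imT x w))
    rw [hz, hw, smul_add]
    abel

/-- With `z = a + i b`, the eigenvector equation `J z = -i z` has real and imaginary parts `i a - b
= 0` and `a + i b = 0`, which are multiples of one another. -/
theorem mem_T01_iff (x : X) (z : CT V x) : z ∈ T01 V x ↔ holPart x z = 0 := by
  have hJ : ∀ z : CT V x, (J (V := V) x).baseChange ℂ z =
      mkCT x (J x (reT x z)) (J x (imT x z)) := by
    intro z
    conv_lhs => rw [← mkCT_reT_imT x z]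
    simp [mkCT]
  have hre : ∀ z : CT V x, reT x (Complex.I • z) = - imT x z := fun z => by simp [reT_smul]
  have him : ∀ z : CT V x, imT x (Complex.I • z) = reT x z := fun z => by simp [imT_smul]
  have h1 : z ∈ T01 V x ↔ (J (V := V) x).baseChange ℂ z + Complex.I • z = 0 := by
    simp [T01, LinearMap.mem_ker]
  have h2 : holPart x z = 0 ↔ asVec (reT x z) + Complex.I • asVec (imT x z) = 0 := by
    rw [← asHVec_holPart]; rfl
  rw [h1, h2, hJ]
  constructor
  · intro h
    have h3 := congrArg (imT x) h
    rw [map_add, imT_mkCT, him, map_zero] at h3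
    rw [add_comm]
    exact h3
  · intro h
    apply CT_ext
    · rw [map_add, reT_mkCT, hre, map_zero]
      change Complex.I • asVec (reT x z) + -asVec (imT x z) = 0
      have := congrArg (fun v => Complex.I • v) h
      simp only [smul_add, smul_smul, Complex.I_mul_I, smul_zero] at this
      simpa using this
    · rw [map_add, imT_mkCT, him, map_zero, add_comm]
      exact h

theorem ev_holForm (x : X) (ζ : HForm V x) (z : CT V x) : ev (holForm x ζ) z = ζ (holPart x z) := by
  have h := asHVec_holPart x z
  have h2 : (show V →L[ℂ] ℂ from ζ) (asHVec (holPart x z)) =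
    (show V →L[ℂ] ℂ from ζ) (asVec (reT x z)) +
      Complex.I * (show V →L[ℂ] ℂ from ζ) (asVec (imT x z)) := by
    rw [h, map_add, map_smul, smul_eq_mul]
  exact h2.symm

/-- The complex tangent vector of type `(1,0)` with given holomorphic part. -/
def lift10 (x : X) : HT V x →ₗ[ℂ] CT V x where
  toFun a := mkCT x (tvec x ((2⁻¹ : ℂ) • asHVec a))
    (tvec x (-((2⁻¹ : ℂ) • Complex.I • asHVec a)))
  map_add' a b := by
    apply CT_ext
    · rw [map_add, reT_mkCT, reT_mkCT, reT_mkCT]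
      exact smul_add (2⁻¹ : ℂ) (asHVec a) (asHVec b)
    · rw [map_add, imT_mkCT, imT_mkCT, imT_mkCT]
      change -((2⁻¹ : ℂ) • Complex.I • (asHVec a + asHVec b)) = -((2⁻¹ : ℂ) • Complex.I • asHVec a) +
        -((2⁻¹ : ℂ) • Complex.I • asHVec b)
      rw [smul_add, smul_add, neg_add]
  map_smul' c a := by
    have hc : ∀ v : V, c • v = c.re • v + c.im • (Complex.I • v) := by
      intro v
      conv_lhs => rw [← Complex.re_add_im c]
      rw [add_smul, mul_smul, Complex.coe_smul, Complex.coe_smul]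
    apply CT_ext
    · rw [RingHom.id_apply, reT_smul, reT_mkCT, reT_mkCT, imT_mkCT]
      change (2⁻¹ : ℂ) • (c • asHVec a) = c.re • ((2⁻¹ : ℂ) • asHVec a) -
        c.im • (-((2⁻¹ : ℂ) • Complex.I • asHVec a))
      rw [smul_neg, sub_neg_eq_add, smul_comm c.re, smul_comm c.im, ← smul_add, hc]
    · rw [RingHom.id_apply, imT_smul, reT_mkCT, imT_mkCT, imT_mkCT]
      change -((2⁻¹ : ℂ) • Complex.I • (c • asHVec a)) =
        c.re • (-((2⁻¹ : ℂ) • Complex.I • asHVec a)) + c.im • ((2⁻¹ : ℂ) • asHVec a)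
      rw [smul_neg, smul_comm c.re, smul_comm c.im, hc, smul_add, smul_comm Complex.I c.re,
        smul_comm Complex.I c.im, smul_smul Complex.I Complex.I, Complex.I_mul_I]
      simp only [smul_add, smul_neg, neg_smul, one_smul]
      abel

theorem holPart_lift10 (x : X) (a : HT V x) : holPart x (lift10 x a) = a := by
  have h := asHVec_holPart x (lift10 x a)
  have h1 : asVec (reT x (lift10 x a)) = (2⁻¹ : ℂ) • asHVec a := reT_mkCT x _ _
  have h2 : asVec (imT x (lift10 x a)) = -((2⁻¹ : ℂ) • Complex.I • asHVec a) := imT_mkCT x _ _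
  rw [h1, h2, smul_neg, smul_comm Complex.I, smul_smul Complex.I Complex.I, Complex.I_mul_I,
    neg_one_smul, smul_neg, neg_neg, ← add_smul] at h
  rw [show (2⁻¹ + 2⁻¹ : ℂ) = 1 by norm_num, one_smul] at h
  exact h

/-- Vanishing on the vectors `1 ⊗ v + i ⊗ i v` is the complex linearity of the form. -/
theorem exists_holForm (x : X) (ξ : CForm V x) (h : ∀ z ∈ T01 V x, ev ξ z = 0) :
    ∃ ζ : HForm V x, holForm x ζ = ξ := by
  let ξ' : V →L[ℝ] ℂ := ξ
  have hI : ∀ v : V, ξ' (Complex.I • v) = Complex.I * ξ' v := by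
    intro v
    have hz : mkCT x (tvec x v) (tvec x (Complex.I • v)) ∈ T01 V x := by
      rw [mem_T01_iff]
      have h3 := asHVec_holPart x (mkCT x (tvec x v) (tvec x (Complex.I • v)))
      rw [reT_mkCT, imT_mkCT] at h3
      refine h3.trans ?_
      change v + Complex.I • Complex.I • v = 0
      rw [smul_smul, Complex.I_mul_I]
      simp
    have h4 := h _ hz
    rw [ev_mkCT] at h4
    change ξ' v + Complex.I * ξ' (Complex.I • v) = 0 at h4
    linear_combination (-Complex.I) * h4 + ξ' (Complex.I • v) * Complex.I_sq
  let ζ : V →L[ℂ] ℂ :=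
    { toFun := ξ'
      map_add' := ξ'.map_add
      map_smul' := fun c v => by
        conv_lhs => rw [← Complex.re_add_im c]
        rw [add_smul, map_add, mul_smul, Complex.coe_smul, Complex.coe_smul, map_smul, map_smul, hI,
          RingHom.id_apply]
        conv_rhs => rw [← Complex.re_add_im c]
        simp only [Complex.real_smul, smul_eq_mul]
        ring
      cont := ξ'.cont }
  exact ⟨ζ, rfl⟩

theorem holForm_injective (x : X) : Function.Injective (holForm (V := V) x) := by
  intro ζ χ h
  have : ∀ v : V, (show V →L[ℂ] ℂ from ζ) v = (show V →L[ℂ] ℂ from χ) v := fun v =>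
    DFunLike.congr_fun (show (show V →L[ℂ] ℂ from ζ).restrictScalars ℝ =
      (show V →L[ℂ] ℂ from χ).restrictScalars ℝ from h) v
  exact ContinuousLinearMap.ext this

theorem holForm_add (x : X) (ζ χ : HForm V x) : holForm x (ζ + χ) = holForm x ζ + holForm x χ := rfl

theorem holForm_smul (x : X) (c : ℂ) (ζ : HForm V x) : holForm x (c • ζ) = c • holForm x ζ := rfl

theorem holForm_zero (x : X) : holForm x (0 : HForm V x) = 0 := rfl

end ComplexTangent

/-! ### Functions, fields and forms with prescribed coordinate expressions. -/

section ChartFunctions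

variable {𝕜 : Type*} [RCLike 𝕜]
  {V : Type*} [NormedAddCommGroup V] [NormedSpace 𝕜 V]
  {F : Type*} [NormedAddCommGroup F] [NormedSpace 𝕜 F]
  {X : Type*} [TopologicalSpace X] [ChartedSpace V X] [IsManifold 𝓘(𝕜, V) ∞ X]

theorem contMDiffOn_iff_chart {U : Opens X} {x₀ : X}
    (hU : (U : Set X) ⊆ (extChartAt 𝓘(𝕜, V) x₀).source) (f : X → F) :
    ContMDiffOn 𝓘(𝕜, V) 𝓘(𝕜, F) ∞ f U ↔
      ContDiffOn 𝕜 ∞ (fun y => f ((extChartAt 𝓘(𝕜, V) x₀).symm y)) (chartDom 𝕜 x₀ U) := by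
  have hU' : (U : Set X) ⊆ (chartAt V x₀).source := by simpa using hU
  rw [← contMDiffOn_iff_contDiffOn]
  constructor
  · intro h
    have h3 := contMDiffOn_extChartAt_symm (I := 𝓘(𝕜, V)) (n := ∞) x₀
    exact h.comp (h3.mono inter_subset_left) fun y hy => hy.2
  · intro h
    have h3 := (contMDiffOn_extChartAt (I := 𝓘(𝕜, V)) (n := ∞) (x := x₀)).mono hU'
    refine (h.comp h3 fun x hx => mem_chartDom (hU hx) hx).congr fun x hx => ?_
    simp only [Function.comp_apply]
    rw [(extChartAt 𝓘(𝕜, V) x₀).left_inv (hU hx)]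

theorem contDiffAt_chart {U : Opens X} {x₀ : X} {f : X → F}
    (h : ContMDiffOn 𝓘(𝕜, V) 𝓘(𝕜, F) ∞ f U) {y : V} (hy : y ∈ chartDom 𝕜 x₀ U) :
    ContDiffAt 𝕜 ∞ (fun y => f ((extChartAt 𝓘(𝕜, V) x₀).symm y)) y := by
  have h1 := (contMDiffOn_iff_chart (U := U ⊓ chartOpens V x₀) (x₀ := x₀)
    (fun x hx => by simpa [chartOpens] using hx.2) f).1 (h.mono fun x hx => hx.1)
  refine h1.contDiffAt ((isOpen_chartDom x₀ _).mem_nhds ⟨hy.1, hy.2, ?_⟩)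
  have := (extChartAt 𝓘(𝕜, V) x₀).map_target hy.1
  simpa [chartOpens] using this

theorem mfderiv_chartDinv {U : Opens X} {x₀ : X} {f : X → F}
    (h : ContMDiffOn 𝓘(𝕜, V) 𝓘(𝕜, F) ∞ f U) {y : V} (hy : y ∈ chartDom 𝕜 x₀ U) (v : V) :
    mfderiv 𝓘(𝕜, V) 𝓘(𝕜, F) f ((extChartAt 𝓘(𝕜, V) x₀).symm y) (chartDinv 𝕜 x₀ y v) =
      fderiv 𝕜 (fun y => f ((extChartAt 𝓘(𝕜, V) x₀).symm y)) y v := by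
  have h1 : MDifferentiableAt 𝓘(𝕜, V) 𝓘(𝕜, F) f ((extChartAt 𝓘(𝕜, V) x₀).symm y) :=
    (h.contMDiffAt (U.2.mem_nhds hy.2)).mdifferentiableAt (by simp)
  have h2 := mfderiv_comp y h1 (mdifferentiableAt_chart_symm hy.1)
  rw [mfderiv_eq_fderiv] at h2
  exact (DFunLike.congr_fun h2 v).symm

omit [IsManifold 𝓘(𝕜, V) ∞ X] in
theorem contMDiffOn_of_local {U : Opens X} {f : X → F}
    (h : ∀ x ∈ U, ∃ W : Opens X, x ∈ W ∧ ContMDiffOn 𝓘(𝕜, V) 𝓘(𝕜, F) ∞ f W) :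
    ContMDiffOn 𝓘(𝕜, V) 𝓘(𝕜, F) ∞ f U := by
  intro x hx
  obtain ⟨W, hxW, hW⟩ := h x hx
  exact (hW.contMDiffAt (W.2.mem_nhds hxW)).contMDiffWithinAt

/-- A vector field with prescribed coordinate expression. -/
def fieldOfChart (𝕜 : Type*) [RCLike 𝕜] {V : Type*} [NormedAddCommGroup V] [NormedSpace 𝕜 V]
    {X : Type*} [TopologicalSpace X] [ChartedSpace V X] (x₀ : X) (f : V → V) (x : X) :
    TangentSpace 𝓘(𝕜, V) x :=
  chartDinv 𝕜 x₀ (extChartAt 𝓘(𝕜, V) x₀ x) (f (extChartAt 𝓘(𝕜, V) x₀ x))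

theorem fieldInChart_fieldOfChart (x₀ : X) (f : V → V) {y : V}
    (hy : y ∈ (extChartAt 𝓘(𝕜, V) x₀).target) :
    fieldInChart 𝕜 x₀ (fieldOfChart 𝕜 x₀ f) y = f y := by
  have h := (extChartAt 𝓘(𝕜, V) x₀).right_inv hy
  unfold fieldInChart fieldOfChart
  simp only [h]
  exact chartD_chartDinv hy _

variable [NormedSpace 𝕜 ℂ]

/-- A one-form with prescribed coordinate expression. -/
def formOfChart (𝕜 : Type*) [RCLike 𝕜] [NormedSpace 𝕜 ℂ]
    {V : Type*} [NormedAddCommGroup V] [NormedSpace 𝕜 V]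
    {X : Type*} [TopologicalSpace X] [ChartedSpace V X] (x₀ : X) (α : V → V →L[𝕜] ℂ) (x : X) :
    TangentSpace 𝓘(𝕜, V) x →L[𝕜] ℂ :=
  (show V →L[𝕜] ℂ from (α (extChartAt 𝓘(𝕜, V) x₀ x)).comp (chartD 𝕜 x₀ x))

theorem formInChart_formOfChart (x₀ : X) (α : V → V →L[𝕜] ℂ) {y : V}
    (hy : y ∈ (extChartAt 𝓘(𝕜, V) x₀).target) :
    formInChart 𝕜 x₀ (formOfChart 𝕜 x₀ α) y = α y := by
  have h := (extChartAt 𝓘(𝕜, V) x₀).right_inv hy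
  ext v
  rw [formInChart_apply]
  have h2 : formOfChart 𝕜 x₀ α ((extChartAt 𝓘(𝕜, V) x₀).symm y) (chartDinv 𝕜 x₀ y v) =
      α (extChartAt 𝓘(𝕜, V) x₀ ((extChartAt 𝓘(𝕜, V) x₀).symm y))
        (chartD 𝕜 x₀ ((extChartAt 𝓘(𝕜, V) x₀).symm y) (chartDinv 𝕜 x₀ y v)) := rfl
  rw [h2, h, chartD_chartDinv hy]

theorem contMDiffOn_form_apply {U : Opens X} {ξ : ∀ x : X, TangentSpace 𝓘(𝕜, V) x →L[𝕜] ℂ}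
    {A : ∀ x : X, TangentSpace 𝓘(𝕜, V) x} (hξ : SmoothForm 𝕜 U ξ) (hA : SmoothField 𝕜 U A) :
    ContMDiffOn 𝓘(𝕜, V) 𝓘(𝕜, ℂ) ∞ (fun x => ξ x (A x)) U := by
  apply contMDiffOn_of_local
  intro x hx
  have hsub : ((U ⊓ chartOpens V x : Opens X) : Set X) ⊆ (extChartAt 𝓘(𝕜, V) x).source :=
    fun z hz => by simpa [chartOpens] using hz.2
  refine ⟨U ⊓ chartOpens V x, ⟨hx, mem_chart_source V x⟩, ?_⟩
  rw [contMDiffOn_iff_chart hsub]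
  have h1 := (smoothForm_iff hsub ξ).1 (hξ.mono inf_le_left)
  have h2 := (smoothField_iff hsub A).1 (hA.mono inf_le_left)
  exact (h1.clm_apply h2).congr fun y hy => (formInChart_field ξ A hy.1).symm

end ChartFunctions

/-! ### Complex fields and Courant brackets in coordinates. -/

section ComplexCharts

variable {V : Type*} [NormedAddCommGroup V] [NormedSpace ℂ V]
  {X : Type*} [TopologicalSpace X] [ChartedSpace V X]

theorem extChartAt_complex (x₀ : X) : extChartAt 𝓘(ℂ, V) x₀ = extChartAt 𝓘(ℝ, V) x₀ := rfl

variable [IsManifold 𝓘(ℂ, V) ∞ X]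

/-- Expressing the chart derivative by a transition map on `V` makes its real and complex versions
comparable. -/
theorem chartD_eq_fderiv {𝕜 : Type*} [RCLike 𝕜] {V : Type*} [NormedAddCommGroup V]
    [NormedSpace 𝕜 V] {X : Type*} [TopologicalSpace X] [ChartedSpace V X]
    [IsManifold 𝓘(𝕜, V) ∞ X] {x₀ x : X} (hx : x ∈ (extChartAt 𝓘(𝕜, V) x₀).source) (v : V) :
    chartD 𝕜 x₀ x v = fderiv 𝕜 (transition 𝕜 x x₀) (extChartAt 𝓘(𝕜, V) x x) v := by
  set p := extChartAt 𝓘(𝕜, V) x x with hp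
  have hpx : (extChartAt 𝓘(𝕜, V) x).symm p = x := extChartAt_to_inv x
  have hpt : p ∈ transitionDom 𝕜 x x₀ := by
    refine ⟨mem_extChartAt_target x, ?_⟩
    rw [mem_preimage, hpx]
    exact hx
  have hinv := chartD_chartDinv (𝕜 := 𝕜) (x₀ := x) (y := p) (mem_extChartAt_target x) v
  rw [hpx, chartD_self] at hinv
  rw [fderiv_transition hpt, ContinuousLinearMap.comp_apply, hinv, hpx]

/-- Transition maps are holomorphic, so their real derivatives are the restrictions of the complex
ones. -/
theorem chartD_complex {x₀ x : X} (hx : x ∈ (extChartAt 𝓘(ℝ, V) x₀).source) (v : V) :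
    chartD ℂ x₀ x v = chartD ℝ x₀ x v := by
  rw [chartD_eq_fderiv hx, chartD_eq_fderiv (𝕜 := ℂ) hx]
  have hpt : extChartAt 𝓘(ℂ, V) x x ∈ transitionDom ℂ x x₀ := by
    refine ⟨mem_extChartAt_target x, ?_⟩
    rw [mem_preimage, extChartAt_to_inv x]
    exact hx
  have hd : DifferentiableAt ℂ (transition ℂ x x₀) (extChartAt 𝓘(ℂ, V) x x) :=
    ((contDiffOn_transition x x₀).contDiffAt
      ((isOpen_transitionDom x x₀).mem_nhds hpt)).differentiableAt (by simp)
  have := hd.fderiv_restrictScalars ℝ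
  exact (DFunLike.congr_fun this v).symm

theorem chartDinv_complex {x₀ : X} {y : V} (hy : y ∈ (extChartAt 𝓘(ℝ, V) x₀).target) (v : V) :
    chartDinv ℂ x₀ y v = chartDinv ℝ x₀ y v := by
  have hx := (extChartAt 𝓘(ℝ, V) x₀).map_target hy
  have h1 := chartDinv_chartD (𝕜 := ℝ) hy (chartDinv ℂ x₀ y v)
  rw [← chartD_complex hx] at h1
  have h2 := chartD_chartDinv (𝕜 := ℂ) (x₀ := x₀) hy v
  rw [extChartAt_complex] at h2
  rw [h2] at h1
  exact h1.symm

/-- Coordinate expression of the real part of a complex vector field. -/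
def reF (x₀ : X) (Z : ∀ x : X, CT V x) : V → V := fieldInChart ℝ x₀ fun x => reT x (Z x)

/-- Coordinate expression of the imaginary part of a complex vector field. -/
def imF (x₀ : X) (Z : ∀ x : X, CT V x) : V → V := fieldInChart ℝ x₀ fun x => imT x (Z x)

theorem SmoothCField.reF {U : Opens X} {Z : ∀ x : X, CT V x} (hZ : SmoothCField U Z) {x₀ : X}
    {y : V} (hy : y ∈ chartDom ℝ x₀ U) : ContDiffAt ℝ ∞ (reF x₀ Z) y :=
  SmoothField.contDiffAt hZ.1 hy

theorem SmoothCField.imF {U : Opens X} {Z : ∀ x : X, CT V x} (hZ : SmoothCField U Z) {x₀ : X}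
    {y : V} (hy : y ∈ chartDom ℝ x₀ U) : ContDiffAt ℝ ∞ (imF x₀ Z) y :=
  SmoothField.contDiffAt hZ.2 hy

theorem fieldInChart_holPart (x₀ : X) (Z : ∀ x : X, CT V x) {y : V}
    (hy : y ∈ (extChartAt 𝓘(ℝ, V) x₀).target) :
    fieldInChart ℂ x₀ (fun x => holPart x (Z x)) y = reF x₀ Z y + Complex.I • imF x₀ Z y := by
  have hx := (extChartAt 𝓘(ℝ, V) x₀).map_target hy
  set x := (extChartAt 𝓘(ℝ, V) x₀).symm y with hxy
  have h1 : fieldInChart ℂ x₀ (fun x => holPart x (Z x)) y =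
      chartD ℂ x₀ x (asHVec (holPart x (Z x))) := rfl
  have h2 : reF x₀ Z y = chartD ℝ x₀ x (asVec (reT x (Z x))) := rfl
  have h3 : imF x₀ Z y = chartD ℝ x₀ x (asVec (imT x (Z x))) := rfl
  rw [h1, h2, h3, asHVec_holPart, map_add, map_smul, chartD_complex hx, chartD_complex hx]

theorem ev_eq_chart (x₀ : X) (ξ : ∀ x : X, CForm V x) (Z : ∀ x : X, CT V x) {y : V}
    (hy : y ∈ (extChartAt 𝓘(ℝ, V) x₀).target) :
    ev (ξ ((extChartAt 𝓘(ℝ, V) x₀).symm y)) (Z ((extChartAt 𝓘(ℝ, V) x₀).symm y)) =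
      formInChart ℝ x₀ ξ y (reF x₀ Z y) + Complex.I * formInChart ℝ x₀ ξ y (imF x₀ Z y) := by
  have h1 := formInChart_field ξ (fun x => reT x (Z x)) hy
  have h2 := formInChart_field ξ (fun x => imT x (Z x)) hy
  rw [reF, imF, h1, h2]
  rfl

theorem smoothFn_ev {U : Opens X} {ξ : ∀ x : X, CForm V x} {Z : ∀ x : X, CT V x}
    (hξ : SmoothForm ℝ U ξ) (hZ : SmoothCField U Z) :
    SmoothFn V U (fun x => ev (ξ x) (Z x)) := by
  have h1 := contMDiffOn_form_apply hξ hZ.1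
  have h2 := contMDiffOn_form_apply hξ hZ.2
  have h3 : ContDiff ℝ ∞ fun p : ℂ × ℂ => p.1 + Complex.I * p.2 := by fun_prop
  exact h3.contMDiff.comp_contMDiffOn (h1.prodMk_space h2)

theorem form_ext {𝕜 : Type*} [RCLike 𝕜] [NormedSpace 𝕜 ℂ] {V : Type*} [NormedAddCommGroup V]
    [NormedSpace 𝕜 V] {X : Type*} [TopologicalSpace X] [ChartedSpace V X]
    [IsManifold 𝓘(𝕜, V) ∞ X] {x₀ : X} {y : V} (hy : y ∈ (extChartAt 𝓘(𝕜, V) x₀).target)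
    {ξ η : TangentSpace 𝓘(𝕜, V) ((extChartAt 𝓘(𝕜, V) x₀).symm y) →L[𝕜] ℂ}
    (h : ∀ v : V, ξ (chartDinv 𝕜 x₀ y v) = η (chartDinv 𝕜 x₀ y v)) : ξ = η := by
  ext u
  have h1 := h (chartD 𝕜 x₀ ((extChartAt 𝓘(𝕜, V) x₀).symm y) u)
  have h2 := chartDinv_chartD (𝕜 := 𝕜) hy (u : V)
  exact (congrArg ξ h2).symm.trans (h1.trans (congrArg η h2))

theorem chartD_injective {𝕜 : Type*} [RCLike 𝕜] {V : Type*} [NormedAddCommGroup V]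
    [NormedSpace 𝕜 V] {X : Type*} [TopologicalSpace X] [ChartedSpace V X]
    [IsManifold 𝓘(𝕜, V) ∞ X] {x₀ : X} {y : V} (hy : y ∈ (extChartAt 𝓘(𝕜, V) x₀).target) :
    Function.Injective (chartD 𝕜 (V := V) x₀ ((extChartAt 𝓘(𝕜, V) x₀).symm y)) :=
  fun a b h => by rw [← chartDinv_chartD (𝕜 := 𝕜) hy a, h, chartDinv_chartD hy]

theorem cContract_eq {U : Opens X} {ξ : ∀ x : X, CForm V x} (hξ : SmoothForm ℝ U ξ)
    (Z : ∀ x : X, CT V x) {x₀ : X} {y : V} (hy : y ∈ chartDom ℝ x₀ U) (v : V) :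
    cContract Z ξ ((extChartAt 𝓘(ℝ, V) x₀).symm y) (chartDinv ℝ x₀ y v) =
      extV (formInChart ℝ x₀ ξ) y (reF x₀ Z y) v +
        Complex.I * extV (formInChart ℝ x₀ ξ) y (imF x₀ Z y) v := by
  have h1 := contract_eq hξ hy (fun x => reT x (Z x)) v
  have h2 := contract_eq hξ hy (fun x => imT x (Z x)) v
  rw [reF, imF, ← h1, ← h2]
  rfl

theorem fderiv_form_apply {𝕜 : Type*} [RCLike 𝕜] [NormedSpace 𝕜 ℂ] {V : Type*}
    [NormedAddCommGroup V] [NormedSpace 𝕜 V] {α : V → V →L[𝕜] ℂ} {f : V → V} {y : V}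
    (hα : DifferentiableAt 𝕜 α y) (hf : DifferentiableAt 𝕜 f y) (v : V) :
    fderiv 𝕜 (fun y => α y (f y)) y v = fderiv 𝕜 α y v (f y) + α y (fderiv 𝕜 f y v) := by
  rw [(hα.hasFDerivAt.clm_apply hf.hasFDerivAt).fderiv]
  simp [add_comm]

theorem dFn_ev_eq {U : Opens X} {η : ∀ x : X, CForm V x} {Z : ∀ x : X, CT V x}
    (hη : SmoothForm ℝ U η) (hZ : SmoothCField U Z) {x₀ : X} {y : V} (hy : y ∈ chartDom ℝ x₀ U)
    (v : V) :
    dFn (V := V) (fun x => ev (η x) (Z x)) ((extChartAt 𝓘(ℝ, V) x₀).symm y)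
      (chartDinv ℝ x₀ y v) =
      fderiv ℝ (formInChart ℝ x₀ η) y v (reF x₀ Z y) +
        formInChart ℝ x₀ η y (fderiv ℝ (reF x₀ Z) y v) +
        Complex.I * (fderiv ℝ (formInChart ℝ x₀ η) y v (imF x₀ Z y) +
          formInChart ℝ x₀ η y (fderiv ℝ (imF x₀ Z) y v)) := by
  have h1 := mfderiv_chartDinv (smoothFn_ev hη hZ) hy v
  refine h1.trans ?_
  have hev : (fun y => ev (η ((extChartAt 𝓘(ℝ, V) x₀).symm y))
      (Z ((extChartAt 𝓘(ℝ, V) x₀).symm y))) =ᶠ[nhds y] fun y =>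
      formInChart ℝ x₀ η y (reF x₀ Z y) + Complex.I * formInChart ℝ x₀ η y (imF x₀ Z y) := by
    filter_upwards [(isOpen_chartDom x₀ U).mem_nhds hy] with z hz
    exact ev_eq_chart x₀ η Z hz.1
  have hα : DifferentiableAt ℝ (formInChart ℝ x₀ η) y :=
    (hη.contDiffAt hy).differentiableAt (by simp)
  have hr : DifferentiableAt ℝ (reF x₀ Z) y := (hZ.reF hy).differentiableAt (by simp)
  have hi : DifferentiableAt ℝ (imF x₀ Z) y := (hZ.imF hy).differentiableAt (by simp)
  rw [hev.fderiv_eq, fderiv_fun_add (hα.clm_apply hr) ((hα.clm_apply hi).const_mul _),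
    fderiv_const_mul (hα.clm_apply hi)]
  simp only [add_apply, smul_apply, smul_eq_mul]
  rw [fderiv_form_apply hα hr, fderiv_form_apply hα hi]

/-- In `L_Z η = i_Z dη + d(η(Z))` the terms `(∂ᵥη)(Z)` cancel, leaving `(∂_Z η)(v) + η(∂ᵥ Z)`. -/
theorem cCourantForm_eq {U : Opens X} {ξ η : ∀ x : X, CForm V x} {Z : ∀ x : X, CT V x}
    (hξ : SmoothForm ℝ U ξ) (hη : SmoothForm ℝ U η) (hZ : SmoothCField U Z)
    (W : ∀ x : X, CT V x) {x₀ : X} {y : V} (hy : y ∈ chartDom ℝ x₀ U) (v : V) :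
    cCourantForm Z ξ W η ((extChartAt 𝓘(ℝ, V) x₀).symm y) (chartDinv ℝ x₀ y v) =
      fderiv ℝ (formInChart ℝ x₀ η) y (reF x₀ Z y) v +
        Complex.I * fderiv ℝ (formInChart ℝ x₀ η) y (imF x₀ Z y) v +
        formInChart ℝ x₀ η y (fderiv ℝ (reF x₀ Z) y v) +
        Complex.I * formInChart ℝ x₀ η y (fderiv ℝ (imF x₀ Z) y v) -
        (extV (formInChart ℝ x₀ ξ) y (reF x₀ W y) v +
          Complex.I * extV (formInChart ℝ x₀ ξ) y (imF x₀ W y) v) := by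
  have h1 := cContract_eq hη Z hy v
  have h2 := cContract_eq hξ W hy v
  have h3 := dFn_ev_eq hη hZ hy v
  have h4 : cCourantForm Z ξ W η ((extChartAt 𝓘(ℝ, V) x₀).symm y) (chartDinv ℝ x₀ y v) =
      cContract Z η ((extChartAt 𝓘(ℝ, V) x₀).symm y) (chartDinv ℝ x₀ y v) +
      dFn (V := V) (fun x => ev (η x) (Z x)) ((extChartAt 𝓘(ℝ, V) x₀).symm y)
        (chartDinv ℝ x₀ y v) -
      cContract W ξ ((extChartAt 𝓘(ℝ, V) x₀).symm y) (chartDinv ℝ x₀ y v) := rfl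
  rw [h4, h1, h2, h3]
  unfold extV
  ring

theorem hCourantForm_eq {U : Opens X} {ξ η : ∀ x : X, HForm V x} {A : ∀ x : X, HT V x}
    (hξ : SmoothForm ℂ U ξ) (hη : SmoothForm ℂ U η) (hA : SmoothField ℂ U A)
    (B : ∀ x : X, HT V x) {x₀ : X} {y : V} (hy : y ∈ chartDom ℂ x₀ U) (v : V) :
    hCourantForm A ξ B η ((extChartAt 𝓘(ℂ, V) x₀).symm y) (chartDinv ℂ x₀ y v) =
      fderiv ℂ (formInChart ℂ x₀ η) y (fieldInChart ℂ x₀ A y) v +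
        formInChart ℂ x₀ η y (fderiv ℂ (fieldInChart ℂ x₀ A) y v) -
        extV (formInChart ℂ x₀ ξ) y (fieldInChart ℂ x₀ B y) v := by
  have h1 := contract_eq hη hy A v
  have h2 := contract_eq hξ hy B v
  have hα : DifferentiableAt ℂ (formInChart ℂ x₀ η) y :=
    (hη.contDiffAt hy).differentiableAt (by simp)
  have hf : DifferentiableAt ℂ (fieldInChart ℂ x₀ A) y := (hA.contDiffAt hy).differentiableAt (by simp)
  have h3 : dHolFn (V := V) (fun x => η x (A x)) ((extChartAt 𝓘(ℂ, V) x₀).symm y)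
      (chartDinv ℂ x₀ y v) = fderiv ℂ (formInChart ℂ x₀ η) y v (fieldInChart ℂ x₀ A y) +
        formInChart ℂ x₀ η y (fderiv ℂ (fieldInChart ℂ x₀ A) y v) := by
    refine (mfderiv_chartDinv (contMDiffOn_form_apply hη hA) hy v).trans ?_
    rw [← fderiv_form_apply hα hf]
    have hev : (fun y => η ((extChartAt 𝓘(ℂ, V) x₀).symm y)
        (A ((extChartAt 𝓘(ℂ, V) x₀).symm y))) =ᶠ[nhds y] fun y =>
        formInChart ℂ x₀ η y (fieldInChart ℂ x₀ A y) := by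
      filter_upwards [(isOpen_chartDom x₀ U).mem_nhds hy] with z hz
      exact (formInChart_field η A hz.1).symm
    rw [hev.fderiv_eq]
  have h4 : hCourantForm A ξ B η ((extChartAt 𝓘(ℂ, V) x₀).symm y) (chartDinv ℂ x₀ y v) =
      contract ℂ η ((extChartAt 𝓘(ℂ, V) x₀).symm y) (A ((extChartAt 𝓘(ℂ, V) x₀).symm y))
        (chartDinv ℂ x₀ y v) +
      dHolFn (V := V) (fun x => η x (A x)) ((extChartAt 𝓘(ℂ, V) x₀).symm y)
        (chartDinv ℂ x₀ y v) -
      contract ℂ ξ ((extChartAt 𝓘(ℂ, V) x₀).symm y) (B ((extChartAt 𝓘(ℂ, V) x₀).symm y))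
        (chartDinv ℂ x₀ y v) := rfl
  rw [h4, h1, h2, h3]
  unfold extV
  ring

variable [CompleteSpace V]

theorem reF_cLie {U : Opens X} {Z W : ∀ x : X, CT V x} (hZ : SmoothCField U Z)
    (hW : SmoothCField U W) {x₀ : X} {y : V} (hy : y ∈ chartDom ℝ x₀ U) :
    reF x₀ (cLie Z W) y =
      fderiv ℝ (reF x₀ W) y (reF x₀ Z y) - fderiv ℝ (reF x₀ Z) y (reF x₀ W y) -
        (fderiv ℝ (imF x₀ W) y (imF x₀ Z y) - fderiv ℝ (imF x₀ Z) y (imF x₀ W y)) := by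
  have h1 := mlieBracket_eq hZ.1 hW.1 hy
  have h2 := mlieBracket_eq hZ.2 hW.2 hy
  refine (congrArg (chartD ℝ (V := V) x₀ _) (reT_mkCT _ _ _)).trans ?_
  exact (map_sub (chartD ℝ (V := V) x₀ _) _ _).trans (congrArg₂ (· - ·) h1 h2)

theorem imF_cLie {U : Opens X} {Z W : ∀ x : X, CT V x} (hZ : SmoothCField U Z)
    (hW : SmoothCField U W) {x₀ : X} {y : V} (hy : y ∈ chartDom ℝ x₀ U) :
    imF x₀ (cLie Z W) y =
      fderiv ℝ (imF x₀ W) y (reF x₀ Z y) - fderiv ℝ (reF x₀ Z) y (imF x₀ W y) +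
        (fderiv ℝ (reF x₀ W) y (imF x₀ Z y) - fderiv ℝ (imF x₀ Z) y (reF x₀ W y)) := by
  have h1 := mlieBracket_eq hZ.1 hW.2 hy
  have h2 := mlieBracket_eq hZ.2 hW.1 hy
  refine (congrArg (chartD ℝ (V := V) x₀ _) (imT_mkCT _ _ _)).trans ?_
  exact (map_add (chartD ℝ (V := V) x₀ _) _ _).trans (congrArg₂ (· + ·) h1 h2)

end ComplexCharts

/-! ### The potential near an arbitrary point of an open set. -/

section LocalPotential

variable {V : Type*} [NormedAddCommGroup V] [NormedSpace ℂ V] {n : ℕ} (b : Module.Basis (Fin n) ℂ V)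

theorem exists_polydisc_subset_ball {ε : ℝ} (hε : 0 < ε) :
    ∃ r : ℝ, 0 < r ∧ polydisc b (fun _ => r) ⊆ Metric.ball 0 ε := by
  set S := ∑ j, ‖b j‖ with hS
  have hS0 : 0 ≤ S := Finset.sum_nonneg fun _ _ => norm_nonneg _
  refine ⟨ε / (S + 1), by positivity, fun z hz => ?_⟩
  rw [mem_ball_zero_iff]
  have h1 : ‖z‖ ≤ ε / (S + 1) * S := by
    conv_lhs => rw [← b.sum_repr z]
    refine (norm_sum_le _ _).trans ?_
    rw [hS, Finset.mul_sum]
    refine Finset.sum_le_sum fun j _ => ?_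
    rw [norm_smul]
    exact mul_le_mul_of_nonneg_right (le_of_lt (hz j)) (norm_nonneg _)
  refine h1.trans_lt ?_
  rw [div_mul_eq_mul_div, div_lt_iff₀ (by positivity)]
  nlinarith

theorem contDiff_bump_smul {F : Type*} [NormedAddCommGroup F] [NormedSpace ℝ F]
    [FiniteDimensional ℝ V] {O : Set V} (hO : IsOpen O) {y₀ : V} (χ : ContDiffBump y₀)
    (hχ : Metric.closedBall y₀ χ.rOut ⊆ O) {f : V → F} (hf : ContDiffOn ℝ ∞ f O) :
    ContDiff ℝ ∞ fun y => χ y • f y := by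
  rw [contDiff_iff_contDiffAt]
  intro y
  by_cases hy : y ∈ O
  · exact χ.contDiff.contDiffAt.smul (hf.contDiffAt (hO.mem_nhds hy))
  · have h1 : y ∉ tsupport χ := by
      rw [χ.tsupport_eq]
      exact fun h => hy (hχ h)
    have h2 : (fun y => χ y • f y) =ᶠ[nhds y] fun _ => 0 := by
      filter_upwards [notMem_tsupport_iff_eventuallyEq.1 h1] with z hz
      rw [hz]
      simp
    exact contDiffAt_const.congr_of_eventuallyEq h2

variable [FiniteDimensional ℂ V]

/-- Translation to the origin and a cut-off reduce this to `exists_potential`. Skew-symmetry is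
linear at each point, so it survives the cut-off everywhere; the differential condition is only
needed on a polydisc where the cut-off equals one. -/
theorem exists_local_potential {O : Set V} (hO : IsOpen O) {y₀ : V} (hy₀ : y₀ ∈ O)
    (θ : Fin n → V → V →L[ℝ] ℂ) (hθ : ∀ j, ContDiffOn ℝ ∞ (θ j) O)
    (hiso : ∀ i j, ∀ y ∈ O, antiPart (θ i y) (b j) = - antiPart (θ j y) (b i))
    (hinv : ∀ i j u, ∀ y ∈ O, dbar (b i) (θ j) y u - dbar (b j) (θ i) y u +
      antiPart (fderiv ℝ (θ i) y u) (b j) = 0) :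
    ∃ N : Set V, IsOpen N ∧ y₀ ∈ N ∧ ∃ a : V → V →L[ℝ] ℂ, ContDiff ℝ ∞ a ∧ ∀ j u, ∀ y ∈ N,
      dbar (b j) a y u - antiPart (fderiv ℝ a y u) (b j) = θ j y u := by
  have : FiniteDimensional ℝ V := FiniteDimensional.trans ℝ ℂ V
  obtain ⟨ε, hε, hεO⟩ := Metric.isOpen_iff.1 hO y₀ hy₀
  let χ : ContDiffBump y₀ := ⟨ε / 3, ε / 2, by linarith, by linarith⟩
  have hχ : Metric.closedBall y₀ χ.rOut ⊆ O :=
    (Metric.closedBall_subset_ball (by simp only [χ]; linarith)).trans hεO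
  obtain ⟨r, hr, hrb⟩ := exists_polydisc_subset_ball b (ε := ε / 3) (by linarith)
  have hshift : ContDiff ℝ ∞ fun z : V => z + y₀ := contDiff_id.add contDiff_const
  have hg : ∀ j, ContDiff ℝ ∞ fun y => χ y • θ j y := fun j =>
    contDiff_bump_smul hO χ hχ (hθ j)
  have hcoe : ∀ (c : ℝ) (α : V →L[ℝ] ℂ) (w : V), antiPart (c • α) w = c * antiPart α w := by
    intro c α w
    simp only [antiPart, smul_apply, Complex.real_smul]
    ring
  have hball : ∀ z ∈ polydisc b (fun _ => r), z + y₀ ∈ Metric.ball y₀ (ε / 3) := by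
    intro z hz
    simpa [dist_eq_norm] using hrb hz
  have hloc : ∀ j, ∀ z ∈ polydisc b (fun _ => r),
      (fun z => χ (z + y₀) • θ j (z + y₀)) =ᶠ[nhds z] fun z => θ j (z + y₀) := by
    intro j z hz
    have hopen : IsOpen ((fun z : V => z + y₀) ⁻¹' Metric.ball y₀ (ε / 3)) :=
      Metric.isOpen_ball.preimage hshift.continuous
    filter_upwards [hopen.mem_nhds (hball z hz)] with w hw
    rw [χ.one_of_mem_closedBall (Metric.ball_subset_closedBall hw), one_smul]
  have hdb : ∀ (f : V → V →L[ℝ] ℂ) (v z : V), dbar v (fun z => f (z + y₀)) z =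
      dbar v f (z + y₀) := by
    intro f v z
    rw [dbar, dbar, fderiv_comp_add_right]
  obtain ⟨a, ha, ha'⟩ := exists_potential b hr (fun j z => χ (z + y₀) • θ j (z + y₀))
    (fun j => (hg j).comp hshift)
    (fun i j z => by
      rw [hcoe, hcoe]
      by_cases hz : z + y₀ ∈ O
      · rw [hiso i j _ hz]; ring
      · rw [χ.zero_of_le_dist]
        · simp
        · by_contra h
          exact hz (hχ (by simpa using (not_le.1 h).le)))
    (fun i j u z hz => by
      have hzO : z + y₀ ∈ O := hεO (Metric.ball_subset_ball (by linarith) (hball z hz))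
      have hd : DifferentiableAt ℝ (θ i) (z + y₀) :=
        ((hθ i).contDiffAt (hO.mem_nhds hzO)).differentiableAt (by simp)
      have hd' : DifferentiableAt ℝ (fun z => θ i (z + y₀)) z :=
        hd.comp z (by fun_prop : DifferentiableAt ℝ (fun z : V => z + y₀) z)
      have he : (fun z => antiPart (χ (z + y₀) • θ i (z + y₀)) (b j)) =ᶠ[nhds z]
          fun z => θ i (z + y₀) (b j) + Complex.I * θ i (z + y₀) (Complex.I • b j) := by
        filter_upwards [hloc i z hz] with w hw
        rw [hw, antiPart]
      rw [dbar_congr (hloc i z hz), dbar_congr (hloc j z hz), he.fderiv_eq, hdb, hdb,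
        fderiv_fun_add (hd'.clm_apply (differentiableAt_const _))
          ((hd'.clm_apply (differentiableAt_const _)).const_mul _),
        fderiv_const_mul (hd'.clm_apply (differentiableAt_const _)), add_apply, smul_apply,
        fderiv_form_apply hd' (differentiableAt_const _),
        fderiv_form_apply hd' (differentiableAt_const _), fderiv_comp_add_right]
      simp only [fderiv_fun_const, Pi.zero_apply, zero_apply, map_zero, add_zero, smul_eq_mul]
      exact hinv i j u _ hzO)
  have hback : ContDiff ℝ ∞ fun z : V => z - y₀ := contDiff_id.sub contDiff_const
  refine ⟨(fun z : V => z - y₀) ⁻¹' polydisc b (fun _ => r / 4),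
    (isOpen_polydisc b _).preimage hback.continuous, ?_, fun y => a (y - y₀), ha.comp hback, ?_⟩
  · intro j
    simp only [sub_self, map_zero, norm_zero]
    linarith
  · intro j u y hy
    have h1 := ha' j u (y - y₀) hy
    have hy' : y - y₀ ∈ polydisc b (fun _ => r) := fun j => (hy j).trans (by linarith)
    have h2 := (hloc j _ hy').self_of_nhds
    simp only [sub_add_cancel] at h1 h2
    rw [h2] at h1
    rw [dbar, fderiv_comp_sub]
    exact h1

end LocalPotential

/-! ## Contraction with an exact two-form -/

section Flip

variable {V : Type*} [NormedAddCommGroup V] [NormedSpace ℝ V]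

theorem contDiffAt_flip {G : V → V →L[ℝ] V →L[ℝ] ℂ} {y : V} (h : ContDiffAt ℝ ∞ G y) :
    ContDiffAt ℝ ∞ (fun y => (G y).flip) y := by
  have h1 := LinearIsometryEquiv.contDiff (𝕜 := ℝ) (n := ∞) (E := V →L[ℝ] V →L[ℝ] ℂ)
    (F := V →L[ℝ] V →L[ℝ] ℂ) (ContinuousLinearMap.flipₗᵢ ℝ V V ℂ)
  exact h1.contDiffAt.comp y h

theorem hasFDerivAt_flip {G : V → V →L[ℝ] V →L[ℝ] ℂ} {y : V}
    (h : DifferentiableAt ℝ G y) :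
    ∃ T : V →L[ℝ] V →L[ℝ] V →L[ℝ] ℂ, HasFDerivAt (fun y => (G y).flip) T y ∧
      ∀ u v w, T u v w = fderiv ℝ G y u w v := by
  have h1 := LinearIsometryEquiv.hasFDerivAt (𝕜 := ℝ) (E := V →L[ℝ] V →L[ℝ] ℂ)
    (F := V →L[ℝ] V →L[ℝ] ℂ) (x := G y) (ContinuousLinearMap.flipₗᵢ ℝ V V ℂ)
  exact ⟨_, h1.comp y h.hasFDerivAt, fun _ _ _ => rfl⟩

/-- The exterior derivative of a one-form on a vector space, as a bilinear form. -/
def extB (α : V → V →L[ℝ] ℂ) (y : V) : V →L[ℝ] V →L[ℝ] ℂ := fderiv ℝ α y - (fderiv ℝ α y).flip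

theorem extB_apply (α : V → V →L[ℝ] ℂ) (y u v : V) :
    extB α y u v = fderiv ℝ α y u v - fderiv ℝ α y v u := rfl

theorem contDiffAt_extB {α : V → V →L[ℝ] ℂ} {y : V} (h : ContDiffAt ℝ ∞ α y) :
    ContDiffAt ℝ ∞ (extB α) y := by
  have h1 : ContDiffAt ℝ ∞ (fderiv ℝ α) y := h.fderiv_right (by simp)
  exact h1.sub (contDiffAt_flip h1)

/-- This reduces the derivative of an exact two-form to second derivatives of the one-form, whose
symmetry then expresses `d² = 0`. -/
theorem fderiv_extB {α : V → V →L[ℝ] ℂ} {y : V} (h : ContDiffAt ℝ ∞ α y) (u v w : V) :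
    fderiv ℝ (extB α) y u v w =
      fderiv ℝ (fderiv ℝ α) y u v w - fderiv ℝ (fderiv ℝ α) y u w v := by
  have h1 : DifferentiableAt ℝ (fderiv ℝ α) y :=
    (h.fderiv_right (m := ∞) (by simp)).differentiableAt (by simp)
  obtain ⟨T, hT, hT'⟩ := hasFDerivAt_flip h1
  have h3 := (HasFDerivAt.sub (𝕜 := ℝ) (F := V →L[ℝ] V →L[ℝ] ℂ) h1.hasFDerivAt hT).fderiv
  rw [show extB α = (fderiv ℝ α - fun y => (fderiv ℝ α y).flip) from rfl, h3, ← hT' u v w]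
  rfl

end Flip

section BField

variable {V : Type*} [NormedAddCommGroup V] [NormedSpace ℂ V]
  {X : Type*} [TopologicalSpace X] [ChartedSpace V X]

/-- The contraction of a complex tangent vector with the exterior derivative of a one-form. -/
def contractL (ξ : ∀ x : X, CForm V x) (x : X) : CT V x →ₗ[ℂ] CForm V x where
  toFun z := contract ℝ ξ x (reT x z) + Complex.I • contract ℝ ξ x (imT x z)
  map_add' z w := by
    have h : ∀ a b, contract ℝ ξ x (a + b) = contract ℝ ξ x a + contract ℝ ξ x b := fun a b =>
      map_add (extD ℝ ξ x) _ _
    rw [map_add, map_add, h, h, smul_add]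
    abel
  map_smul' c z := by
    have h : ∀ a b, contract ℝ ξ x (a + b) = contract ℝ ξ x a + contract ℝ ξ x b := fun a b =>
      map_add (extD ℝ ξ x) _ _
    have h' : ∀ a b, contract ℝ ξ x (a - b) = contract ℝ ξ x a - contract ℝ ξ x b := fun a b =>
      map_sub (extD ℝ ξ x) _ _
    have h2 : ∀ (c : ℝ) a, contract ℝ ξ x (c • a) = (c : ℂ) • contract ℝ ξ x a := fun c a =>
      (map_smul (extD ℝ ξ x) c _).trans (Complex.coe_smul _ _).symm
    rw [reT_smul, imT_smul, h, h', h2, h2, h2, h2, RingHom.id_apply]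
    generalize contract ℝ ξ x (reT x z) = p
    generalize contract ℝ ξ x (imT x z) = q
    have key : ∀ p q : V →L[ℝ] ℂ, (c.re : ℂ) • p - (c.im : ℂ) • q +
        Complex.I • ((c.re : ℂ) • q + (c.im : ℂ) • p) = c • (p + Complex.I • q) := by
      intro p q
      ext v
      simp only [add_apply, sub_apply, smul_apply, smul_eq_mul]
      linear_combination (p v + Complex.I * q v) * Complex.re_add_im c -
        (c.im : ℂ) * q v * Complex.I_sq
    exact key p q

/-- Skew-symmetry of the two-form is what makes the corresponding shear of a splitting preserve the
pairing. -/
theorem ev_contractL_antisymm (ξ : ∀ x : X, CForm V x) (x : X) (z w : CT V x) :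
    ev (contractL ξ x z) w + ev (contractL ξ x w) z = 0 := by
  have h : ∀ a b, contract ℝ ξ x a b = - contract ℝ ξ x b a := by
    intro a b
    exact (neg_sub _ _).symm
  have e : ∀ z w : CT V x, ev (contractL ξ x z) w =
      contract ℝ ξ x (reT x z) (reT x w) + Complex.I * contract ℝ ξ x (imT x z) (reT x w) +
      Complex.I * (contract ℝ ξ x (reT x z) (imT x w) +
        Complex.I * contract ℝ ξ x (imT x z) (imT x w)) := fun z w => rfl
  rw [e, e, h (reT x z) (reT x w), h (imT x z) (reT x w), h (reT x z) (imT x w),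
    h (imT x z) (imT x w)]
  ring

variable [IsManifold 𝓘(ℂ, V) ∞ X]

theorem formInChart_contractL {U : Opens X} {ξ : ∀ x : X, CForm V x} (hξ : SmoothForm ℝ U ξ)
    (Z : ∀ x : X, CT V x) {x₀ : X} {y : V} (hy : y ∈ chartDom ℝ x₀ U) :
    formInChart ℝ x₀ (fun x => contractL ξ x (Z x)) y =
      extB (formInChart ℝ x₀ ξ) y (reF x₀ Z y) +
        Complex.I • extB (formInChart ℝ x₀ ξ) y (imF x₀ Z y) := by
  ext v
  exact cContract_eq hξ Z hy v

theorem smoothForm_contractL {U : Opens X} {ξ : ∀ x : X, CForm V x} (hξ : SmoothForm ℝ U ξ)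
    {Z : ∀ x : X, CT V x} (hZ : SmoothCField U Z) :
    SmoothForm ℝ U (fun x => contractL ξ x (Z x)) := by
  intro x₀ y hy
  have hE := contDiffAt_extB (hξ.contDiffAt hy)
  have h1 : ContDiffAt ℝ ∞ (fun y => extB (formInChart ℝ x₀ ξ) y (reF x₀ Z y) +
      Complex.I • extB (formInChart ℝ x₀ ξ) y (imF x₀ Z y)) y :=
    (hE.clm_apply (hZ.reF hy)).add ((hE.clm_apply (hZ.imF hy)).const_smul Complex.I)
  refine (h1.congr_of_eventuallyEq ?_).contDiffWithinAt
  filter_upwards [(isOpen_chartDom x₀ U).mem_nhds hy] with z hz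
  exact formInChart_contractL hξ Z hz

theorem fderiv_formInChart_contractL {U : Opens X} {ξ : ∀ x : X, CForm V x}
    (hξ : SmoothForm ℝ U ξ) {Z : ∀ x : X, CT V x} (hZ : SmoothCField U Z) {x₀ : X} {y : V}
    (hy : y ∈ chartDom ℝ x₀ U) (u v : V) :
    fderiv ℝ (formInChart ℝ x₀ (fun x => contractL ξ x (Z x))) y u v =
      fderiv ℝ (extB (formInChart ℝ x₀ ξ)) y u (reF x₀ Z y) v +
      extB (formInChart ℝ x₀ ξ) y (fderiv ℝ (reF x₀ Z) y u) v +
      Complex.I * (fderiv ℝ (extB (formInChart ℝ x₀ ξ)) y u (imF x₀ Z y) v +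
        extB (formInChart ℝ x₀ ξ) y (fderiv ℝ (imF x₀ Z) y u) v) := by
  have hE : DifferentiableAt ℝ (extB (formInChart ℝ x₀ ξ)) y :=
    (contDiffAt_extB (hξ.contDiffAt hy)).differentiableAt (by simp)
  have hr : DifferentiableAt ℝ (reF x₀ Z) y := (hZ.reF hy).differentiableAt (by simp)
  have hi : DifferentiableAt ℝ (imF x₀ Z) y := (hZ.imF hy).differentiableAt (by simp)
  have hev : formInChart ℝ x₀ (fun x => contractL ξ x (Z x)) =ᶠ[nhds y]
      fun y => extB (formInChart ℝ x₀ ξ) y (reF x₀ Z y) +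
        Complex.I • extB (formInChart ℝ x₀ ξ) y (imF x₀ Z y) := by
    filter_upwards [(isOpen_chartDom x₀ U).mem_nhds hy] with z hz
    exact formInChart_contractL hξ Z hz
  have h1 := (hE.hasFDerivAt.clm_apply hr.hasFDerivAt).add
    ((hE.hasFDerivAt.clm_apply hi.hasFDerivAt).const_smul Complex.I)
  have h2 : HasFDerivAt (fun y => extB (formInChart ℝ x₀ ξ) y (reF x₀ Z y) +
        Complex.I • extB (formInChart ℝ x₀ ξ) y (imF x₀ Z y)) _ y := h1
  rw [hev.fderiv_eq, h2.fderiv]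
  simp [add_comm, mul_add]

theorem cCourantForm_add {U : Opens X} {ξ ξ' η η' : ∀ x : X, CForm V x} {Z : ∀ x : X, CT V x}
    (hξ : SmoothForm ℝ U ξ) (hξ' : SmoothForm ℝ U ξ') (hη : SmoothForm ℝ U η)
    (hη' : SmoothForm ℝ U η') (hZ : SmoothCField U Z) (W : ∀ x : X, CT V x) {x : X} (hx : x ∈ U) :
    cCourantForm Z (fun x => ξ x + ξ' x) W (fun x => η x + η' x) x =
      cCourantForm Z ξ W η x + cCourantForm Z ξ' W η' x := by
  have hadd : ∀ {ξ ξ' : ∀ x : X, CForm V x}, SmoothForm ℝ U ξ → SmoothForm ℝ U ξ' →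
      SmoothForm ℝ U (fun x => ξ x + ξ' x) := fun h h' x₀ => (h x₀).add (h' x₀)
  have hy := mem_chartDom (𝕜 := ℝ) (V := V) (mem_extChartAt_source x) hx
  set y := extChartAt 𝓘(ℝ, V) x x with hyx
  have hxy : (extChartAt 𝓘(ℝ, V) x).symm y = x := extChartAt_to_inv x
  have hd : ∀ {ξ : ∀ x : X, CForm V x}, SmoothForm ℝ U ξ →
      DifferentiableAt ℝ (formInChart ℝ x ξ) y := fun h =>
    (h.contDiffAt hy).differentiableAt (by simp)
  have hf : ∀ {ξ ξ' : ∀ x : X, CForm V x}, SmoothForm ℝ U ξ → SmoothForm ℝ U ξ' → ∀ u v,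
      fderiv ℝ (formInChart ℝ x fun x => ξ x + ξ' x) y u v =
        fderiv ℝ (formInChart ℝ x ξ) y u v + fderiv ℝ (formInChart ℝ x ξ') y u v := by
    intro ξ ξ' h h' u v
    have := fderiv_fun_add (hd h) (hd h')
    rw [show (formInChart ℝ x fun x => ξ x + ξ' x) =
      fun y => formInChart ℝ x ξ y + formInChart ℝ x ξ' y from rfl, this]
    rfl
  have hv : ∀ {ξ ξ' : ∀ x : X, CForm V x} (v : V), formInChart ℝ x (fun x => ξ x + ξ' x) y v =
    formInChart ℝ x ξ y v + formInChart ℝ x ξ' y v := fun v => rfl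
  have key : cCourantForm Z (fun x => ξ x + ξ' x) W (fun x => η x + η' x)
      ((extChartAt 𝓘(ℝ, V) x).symm y) =
      cCourantForm Z ξ W η ((extChartAt 𝓘(ℝ, V) x).symm y) +
        cCourantForm Z ξ' W η' ((extChartAt 𝓘(ℝ, V) x).symm y) := by
    apply form_ext hy.1
    intro v
    refine (cCourantForm_eq (hadd hξ hξ') (hadd hη hη') hZ W hy v).trans (Eq.trans ?_
      (congrArg₂ (· + ·) (cCourantForm_eq hξ hη hZ W hy v)
        (cCourantForm_eq hξ' hη' hZ W hy v)).symm)
    unfold extV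
    simp only [hf hη hη', hf hξ hξ', hv]
    ring
  rwa [hxy] at key

variable [CompleteSpace V]

/-- Contraction with an exact two-form is compatible with the Courant bracket. -/
theorem cCourantForm_contractL {U : Opens X} {ξ : ∀ x : X, CForm V x} (hξ : SmoothForm ℝ U ξ)
    {Z Y : ∀ x : X, CT V x} (hZ : SmoothCField U Z) (hY : SmoothCField U Y) {x : X} (hx : x ∈ U) :
    cCourantForm Z (fun x => contractL ξ x (Z x)) Y (fun x => contractL ξ x (Y x)) x =
      contractL ξ x (cLie Z Y x) := by
  have hy := mem_chartDom (𝕜 := ℝ) (V := V) (mem_extChartAt_source x) hx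
  set y := extChartAt 𝓘(ℝ, V) x x with hyx
  have hxy : (extChartAt 𝓘(ℝ, V) x).symm y = x := extChartAt_to_inv x
  have hα := hξ.contDiffAt hy
  -- For a two-form `B`, `L_Z i_Y B - i_Y d(i_Z B) = i_{[Z,Y]} B + i_Y i_Z dB`. Here `B = dξ`, and
  -- `dB = 0` enters as symmetry of the second derivative.
  have hsymm : ∀ u v w, fderiv ℝ (fderiv ℝ (formInChart ℝ x ξ)) y u v w =
      fderiv ℝ (fderiv ℝ (formInChart ℝ x ξ)) y v u w := fun u v w => by
    rw [second_fderiv_symm hα]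
  have key : cCourantForm Z (fun x => contractL ξ x (Z x)) Y (fun x => contractL ξ x (Y x))
      ((extChartAt 𝓘(ℝ, V) x).symm y) = contractL ξ ((extChartAt 𝓘(ℝ, V) x).symm y)
        (cLie Z Y ((extChartAt 𝓘(ℝ, V) x).symm y)) := by
    apply form_ext hy.1
    intro v
    have hR : contractL ξ ((extChartAt 𝓘(ℝ, V) x).symm y)
        (cLie Z Y ((extChartAt 𝓘(ℝ, V) x).symm y)) (chartDinv ℝ x y v) = _ :=
      cContract_eq hξ (cLie Z Y) hy v
    rw [hR, cCourantForm_eq (smoothForm_contractL hξ hZ) (smoothForm_contractL hξ hY) hZ Y hy,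
      reF_cLie hZ hY hy, imF_cLie hZ hY hy]
    unfold extV
    simp only [fderiv_formInChart_contractL hξ hZ hy, fderiv_formInChart_contractL hξ hY hy,
      formInChart_contractL hξ Y hy, fderiv_extB hα, extB_apply, add_apply, smul_apply, map_add,
      map_sub, sub_apply, smul_eq_mul]
    have hv : ∀ w u, fderiv ℝ (fderiv ℝ (formInChart ℝ x ξ)) y w v u =
      fderiv ℝ (fderiv ℝ (formInChart ℝ x ξ)) y v w u := fun w u => hsymm w v u
    simp only [hv]
    rw [hsymm (reF x Z y) (reF x Y y), hsymm (imF x Z y) (reF x Y y),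
      hsymm (reF x Z y) (imF x Y y), hsymm (imF x Z y) (imF x Y y)]
    ring_nf
    simp only [Complex.I_sq]
    ring
  rwa [hxy] at key

end BField

/-! ## Sections of vector bundles -/

namespace IsVectorBundle

section General

variable {X : Type*} [TopologicalSpace X] {Fn : Opens X → (X → ℂ) → Prop}
  {F : X → Type*} [∀ x, AddCommGroup (F x)] [∀ x, Module ℂ (F x)]
  {Sec : Opens X → (∀ x, F x) → Prop}

/-- Near each point sections are described by coefficients in a frame, which see only the values
over the open set. -/
theorem congr (h : IsVectorBundle Fn F Sec) {U : Opens X} {s s' : ∀ x, F x} (hs : Sec U s)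
    (he : ∀ x ∈ U, s x = s' x) : Sec U s' :=
  h.glue U s' fun x hx => by
    obtain ⟨U₀, hx₀, r, e, -, he'⟩ := h.frame x
    refine ⟨U ⊓ U₀, ⟨hx, hx₀⟩, inf_le_left, (he' _ _ inf_le_right).2 ?_⟩
    obtain ⟨c, hc, hc'⟩ := (he' _ _ inf_le_right).1 (h.restrict _ _ _ inf_le_left hs)
    exact ⟨c, hc, fun y hy => (he y hy.1).symm.trans (hc' y hy)⟩

end General

variable {V : Type*} [NormedAddCommGroup V] [NormedSpace ℂ V]
  {X : Type*} [TopologicalSpace X] [ChartedSpace V X]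
  {F : X → Type*} [∀ x, AddCommGroup (F x)] [∀ x, Module ℂ (F x)]

theorem _root_.Courant.smoothFn_mul {U : Opens X} {f g : X → ℂ} (hf : SmoothFn V U f)
    (hg : SmoothFn V U g) : SmoothFn V U fun x => f x * g x :=
  ContMDiff.comp_contMDiffOn (contDiff_mul (𝕜 := ℝ) (𝔸 := ℂ)).contMDiff
    (ContMDiffOn.prodMk_space hf hg)

variable {Sec : Opens X → (∀ x, F x) → Prop} (h : IsVectorBundle (SmoothFn V) F Sec)

include h in
theorem add {U : Opens X} {s t : ∀ x, F x} (hs : Sec U s) (ht : Sec U t) :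
    Sec U fun x => s x + t x :=
  h.glue U _ fun x hx => by
    obtain ⟨U₀, hx₀, r, e, -, he'⟩ := h.frame x
    refine ⟨U ⊓ U₀, ⟨hx, hx₀⟩, inf_le_left, (he' _ _ inf_le_right).2 ?_⟩
    obtain ⟨c, hc, hc'⟩ := (he' _ _ inf_le_right).1 (h.restrict _ _ _ inf_le_left hs)
    obtain ⟨d, hd, hd'⟩ := (he' _ _ inf_le_right).1 (h.restrict _ _ _ inf_le_left ht)
    refine ⟨fun i x => c i x + d i x, fun i => (hc i).add (hd i), fun y hy => ?_⟩
    simp only [hc' y hy, hd' y hy, add_smul, Finset.sum_add_distrib]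

include h in
theorem smul {U : Opens X} {f : X → ℂ} {s : ∀ x, F x} (hf : SmoothFn V U f) (hs : Sec U s) :
    Sec U fun x => f x • s x :=
  h.glue U _ fun x hx => by
    obtain ⟨U₀, hx₀, r, e, -, he'⟩ := h.frame x
    refine ⟨U ⊓ U₀, ⟨hx, hx₀⟩, inf_le_left, (he' _ _ inf_le_right).2 ?_⟩
    obtain ⟨c, hc, hc'⟩ := (he' _ _ inf_le_right).1 (h.restrict _ _ _ inf_le_left hs)
    refine ⟨fun i x => f x * c i x, fun i => ?_, fun y hy => ?_⟩
    · exact smoothFn_mul (ContMDiffOn.mono hf fun y hy => hy.1) (hc i)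
    · simp only [hc' y hy, Finset.smul_sum, smul_smul]

include h in
theorem zero (U : Opens X) : Sec U fun _ => 0 :=
  h.glue U _ fun x hx => by
    obtain ⟨U₀, hx₀, r, e, -, he'⟩ := h.frame x
    exact ⟨U ⊓ U₀, ⟨hx, hx₀⟩, inf_le_left, (he' _ _ inf_le_right).2
      ⟨fun _ _ => 0, fun _ => contMDiffOn_const, fun y hy => by simp⟩⟩

include h in
theorem neg {U : Opens X} {s : ∀ x, F x} (hs : Sec U s) : Sec U fun x => - s x := by
  have h1 := h.smul (f := fun _ => -1) contMDiffOn_const hs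
  simpa using h1

include h in
theorem sub {U : Opens X} {s t : ∀ x, F x} (hs : Sec U s) (ht : Sec U t) :
    Sec U fun x => s x - t x := by
  have h1 := h.add hs (h.neg ht)
  simpa [sub_eq_add_neg] using h1

include h in
theorem sum {U : Opens X} {r : ℕ} {e : Fin r → ∀ x, F x} (he : ∀ i, Sec U (e i)) :
    Sec U fun x => ∑ i, e i x := by
  induction r with
  | zero => simpa using h.zero U
  | succ r ih =>
    simp only [Fin.sum_univ_succ]
    exact h.add (he 0) (ih fun i => he i.succ)

end IsVectorBundle

/-! ## Constant vector fields of type `(0,1)` in a chart -/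

section T01

variable {V : Type*} [NormedAddCommGroup V] [NormedSpace ℂ V]
  {X : Type*} [TopologicalSpace X] [ChartedSpace V X]

/-- The imaginary part of a `(0,1)`-vector is `i` times its real part. -/
theorem T01_ext {x : X} {z w : CT V x} (hz : z ∈ T01 V x) (hw : w ∈ T01 V x)
    (h : reT x z = reT x w) : z = w := by
  have key : ∀ z : CT V x, z ∈ T01 V x → asVec (imT x z) = Complex.I • asVec (reT x z) := by
    intro z hz
    have h1 := (asHVec_holPart x z).symm.trans (congrArg asHVec ((mem_T01_iff x z).1 hz))
    have h2 : asVec (reT x z) + Complex.I • asVec (imT x z) = 0 := h1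
    rw [eq_neg_of_add_eq_zero_left h2, smul_neg, smul_smul, Complex.I_mul_I]
    simp
  refine CT_ext h ?_
  have h3 : asVec (imT x z) = asVec (imT x w) := by rw [key z hz, key w hw, h]
  exact h3

/-- The field of vectors of type `(0,1)` which is constant in the preferred chart at `x₀`. -/
def antiField (x₀ : X) (v : V) (x : X) : CT V x :=
  mkCT x (fieldOfChart ℝ x₀ (fun _ => v) x) (fieldOfChart ℝ x₀ (fun _ => Complex.I • v) x)

variable [IsManifold 𝓘(ℂ, V) ∞ X]

theorem reF_mkCT (x₀ : X) (f g : V → V) {y : V} (hy : y ∈ (extChartAt 𝓘(ℝ, V) x₀).target) :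
    reF x₀ (fun x => mkCT x (fieldOfChart ℝ x₀ f x) (fieldOfChart ℝ x₀ g x)) y = f y := by
  rw [reF, ← fieldInChart_fieldOfChart (𝕜 := ℝ) x₀ f hy]
  simp only [reT_mkCT]

theorem imF_mkCT (x₀ : X) (f g : V → V) {y : V} (hy : y ∈ (extChartAt 𝓘(ℝ, V) x₀).target) :
    imF x₀ (fun x => mkCT x (fieldOfChart ℝ x₀ f x) (fieldOfChart ℝ x₀ g x)) y = g y := by
  rw [imF, ← fieldInChart_fieldOfChart (𝕜 := ℝ) x₀ g hy]
  simp only [imT_mkCT]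

theorem smoothCField_iff {U : Opens X} {x₀ : X}
    (hU : (U : Set X) ⊆ (extChartAt 𝓘(ℝ, V) x₀).source) (Z : ∀ x : X, CT V x) :
    SmoothCField U Z ↔ ContDiffOn ℝ ∞ (reF x₀ Z) (chartDom ℝ x₀ U) ∧
      ContDiffOn ℝ ∞ (imF x₀ Z) (chartDom ℝ x₀ U) :=
  and_congr (smoothField_iff hU _) (smoothField_iff hU _)

theorem smoothCField_mkCT {U : Opens X} {x₀ : X}
    (hU : (U : Set X) ⊆ (extChartAt 𝓘(ℝ, V) x₀).source) {f g : V → V}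
    (hf : ContDiffOn ℝ ∞ f (chartDom ℝ x₀ U)) (hg : ContDiffOn ℝ ∞ g (chartDom ℝ x₀ U)) :
    SmoothCField U fun x : X => mkCT x (fieldOfChart ℝ x₀ f x) (fieldOfChart ℝ x₀ g x) :=
  (smoothCField_iff hU _).2 ⟨hf.congr fun _ hy => reF_mkCT x₀ f g hy.1,
    hg.congr fun _ hy => imF_mkCT x₀ f g hy.1⟩

theorem SmoothCField.mono {U W : Opens X} (hWU : W ≤ U) {Z : ∀ x : X, CT V x}
    (h : SmoothCField U Z) : SmoothCField W Z := ⟨SmoothField.mono hWU h.1, SmoothField.mono hWU h.2⟩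

theorem antiField_mem {x₀ x : X} (hx : x ∈ (extChartAt 𝓘(ℝ, V) x₀).source) (v : V) :
    antiField x₀ v x ∈ T01 V x := by
  have hy : extChartAt 𝓘(ℝ, V) x₀ x ∈ (extChartAt 𝓘(ℝ, V) x₀).target :=
    (extChartAt 𝓘(ℝ, V) x₀).map_source hx
  rw [mem_T01_iff]
  have h := asHVec_holPart x (antiField x₀ v x)
  rw [antiField, reT_mkCT, imT_mkCT] at h
  refine h.trans ?_
  change chartDinv ℝ x₀ (extChartAt 𝓘(ℝ, V) x₀ x) v +
    Complex.I • chartDinv ℝ x₀ (extChartAt 𝓘(ℝ, V) x₀ x) (Complex.I • v) = 0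
  rw [← chartDinv_complex hy, ← chartDinv_complex hy, map_smul, smul_smul, Complex.I_mul_I]
  simp

theorem antiField_chartD {x₀ x : X} (hx : x ∈ (extChartAt 𝓘(ℝ, V) x₀).source) {z : CT V x}
    (hz : z ∈ T01 V x) : antiField x₀ (chartD ℝ x₀ x (reT x z) : V) x = z := by
  have hy : extChartAt 𝓘(ℝ, V) x₀ x ∈ (extChartAt 𝓘(ℝ, V) x₀).target :=
    (extChartAt 𝓘(ℝ, V) x₀).map_source hx
  refine T01_ext (V := V) (antiField_mem hx (chartD ℝ x₀ x (reT x z) : V)) hz ?_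
  rw [antiField, reT_mkCT]
  have h := chartDinv_chartD (𝕜 := ℝ) hy (reT x z)
  rwa [(extChartAt 𝓘(ℝ, V) x₀).left_inv hx] at h

/-- The identification `v ↦ 1 ⊗ v + i ⊗ i v` of `V` with the `(0,1)`-vectors is conjugate linear. -/
theorem antiField_smul {x₀ x : X} (hx : x ∈ (extChartAt 𝓘(ℝ, V) x₀).source) (c : ℂ) (v : V) :
    antiField x₀ (c • v) x = star c • antiField x₀ v x := by
  refine T01_ext (antiField_mem hx _) (Submodule.smul_mem _ _ (antiField_mem hx _)) ?_
  unfold antiField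
  rw [reT_smul, reT_mkCT, reT_mkCT, imT_mkCT]
  change chartDinv ℝ x₀ (extChartAt 𝓘(ℝ, V) x₀ x) (c • v) =
    (star c).re • chartDinv ℝ x₀ (extChartAt 𝓘(ℝ, V) x₀ x) v -
      (star c).im • chartDinv ℝ x₀ (extChartAt 𝓘(ℝ, V) x₀ x) (Complex.I • v)
  rw [← map_smul, ← map_smul, ← map_sub]
  congr 1
  conv_lhs => rw [← Complex.re_add_im c, add_smul, ← smul_smul]
  simp

omit [IsManifold 𝓘(ℂ, V) ∞ X] in
theorem antiField_add (x₀ x : X) (v w : V) :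
    antiField x₀ (v + w) x = antiField x₀ v x + antiField x₀ w x := by
  apply CT_ext
  · rw [map_add, antiField, antiField, antiField, reT_mkCT, reT_mkCT, reT_mkCT]
    exact map_add (chartDinv ℝ x₀ (extChartAt 𝓘(ℝ, V) x₀ x)) v w
  · rw [map_add, antiField, antiField, antiField, imT_mkCT, imT_mkCT, imT_mkCT]
    exact (congrArg _ (smul_add _ v w)).trans
      (map_add (chartDinv ℝ x₀ (extChartAt 𝓘(ℝ, V) x₀ x)) _ _)

end T01

/-! ## Splittings of a complex Courant algebroid -/

section Splitting

variable {V : Type*} [NormedAddCommGroup V] [NormedSpace ℂ V]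
  {X : Type*} [TopologicalSpace X] [ChartedSpace V X] [IsManifold 𝓘(ℂ, V) ∞ X]
  {E : X → Type*} [∀ x, AddCommGroup (E x)] [∀ x, Module ℂ (E x)]

/-- The splitting `σ` of the anchor identifies `E` over `U` with the standard Courant algebroid. -/
structure IsSplitting (C : ComplexCourantAlgebroid V E) (U : Opens X)
    (σ : ∀ x, CT V x →ₗ[ℂ] E x) : Prop where
  right_inv : ∀ x ∈ U, ∀ z, C.π x (σ x z) = z
  smooth : ∀ (W : Opens X) (Z : ∀ x, CT V x), W ≤ U → SmoothCField W Z →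
    C.IsSmooth W (fun x => σ x (Z x))
  pairing : ∀ x ∈ U, ∀ (z w : CT V x) (ξ η : CForm V x),
    C.pairing x (σ x z + C.ι x ξ) (σ x w + C.ι x η) = (1 / 2) * (ev ξ w + ev η z)
  bracket : ∀ (W : Opens X) (Z Y : ∀ x, CT V x) (ξ η : ∀ x, CForm V x), W ≤ U →
    SmoothCField W Z → SmoothForm ℝ W ξ → SmoothCField W Y → SmoothForm ℝ W η →
    ∀ x ∈ W, C.bracket (fun y => σ y (Z y) + C.ι y (ξ y)) (fun y => σ y (Y y) + C.ι y (η y)) x =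
      σ x (cLie Z Y x) + C.ι x (cCourantForm Z ξ Y η x)

variable {C : ComplexCourantAlgebroid V E}

theorem ComplexCourantAlgebroid.π_ι (C : ComplexCourantAlgebroid V E) (x : X) (ξ : CForm V x) :
    C.π x (C.ι x ξ) = 0 := by
  have h : C.ι x ξ ∈ LinearMap.ker (C.π x) := by
    rw [← C.exact x]
    exact ⟨ξ, rfl⟩
  exact h

namespace IsSplitting

variable {U : Opens X} {σ : ∀ x, CT V x →ₗ[ℂ] E x} (hσ : IsSplitting C U σ)

include hσ in
theorem mono {W : Opens X} (hW : W ≤ U) : IsSplitting C W σ where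
  right_inv x hx := hσ.right_inv x (hW hx)
  smooth W' Z h := hσ.smooth W' Z (h.trans hW)
  pairing x hx := hσ.pairing x (hW hx)
  bracket W' Z Y ξ η h := hσ.bracket W' Z Y ξ η (h.trans hW)

include hσ in
theorem π_apply {x : X} (hx : x ∈ U) (z : CT V x) (ξ : CForm V x) :
    C.π x (σ x z + C.ι x ξ) = z := by
  rw [map_add, hσ.right_inv x hx, C.π_ι, add_zero]

include hσ in
theorem smooth_add {W : Opens X} (hW : W ≤ U) {Z : ∀ x, CT V x} {ξ : ∀ x, CForm V x}
    (hZ : SmoothCField W Z) (hξ : SmoothForm ℝ W ξ) :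
    C.IsSmooth W fun x => σ x (Z x) + C.ι x (ξ x) :=
  C.isVectorBundle.add (hσ.smooth W Z hW hZ) (C.ι_smooth W ξ hξ)

include hσ in
-- A converse of `ι_smooth`: the coefficients of `ξ` are recovered by pairing with the lifts of
-- coordinate vector fields, and the pairing of smooth sections is smooth.
theorem smoothForm [FiniteDimensional ℂ V] {W : Opens X} (hW : W ≤ U) {ξ : ∀ x, CForm V x}
    (h : C.IsSmooth W fun x => C.ι x (ξ x)) : SmoothForm ℝ W ξ := by
  have : FiniteDimensional ℝ V := FiniteDimensional.trans ℝ ℂ V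
  refine smoothForm_of_local fun x₀ hx₀ => ?_
  have hsub : ((W ⊓ chartOpens V x₀ : Opens X) : Set X) ⊆ (extChartAt 𝓘(ℝ, V) x₀).source :=
    fun x hx => by simpa [chartOpens] using hx.2
  refine ⟨W ⊓ chartOpens V x₀, ⟨hx₀, mem_chart_source V x₀⟩, ?_⟩
  rw [smoothForm_iff hsub, contDiffOn_clm_apply]
  intro v
  set Z : ∀ x : X, CT V x := fun x =>
    mkCT x (fieldOfChart ℝ x₀ (fun _ => v) x) (fieldOfChart ℝ x₀ (fun _ => 0) x) with hZ
  have hZs : SmoothCField (W ⊓ chartOpens V x₀) Z :=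
    smoothCField_mkCT hsub contDiffOn_const contDiffOn_const
  have h1 := C.pairing_smooth _ _ _ (C.isVectorBundle.restrict _ _ _ inf_le_left h)
    (hσ.smooth (W ⊓ chartOpens V x₀) Z (inf_le_left.trans hW) hZs)
  have h2 := (contMDiffOn_iff_chart hsub _).1 h1
  -- The factor `2` undoes the `1 / 2` in the pairing.
  refine (contDiffOn_const.mul h2).congr (f := fun y => (2 : ℂ) * _) fun y hy => ?_
  rw [C.pairing_ι, hσ.right_inv _ (hW hy.2.1), ev_eq_chart x₀ ξ Z hy.1, hZ, reF_mkCT _ _ _ hy.1,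
    imF_mkCT _ _ _ hy.1, map_zero]
  ring

include hσ in
theorem exists_decomp [FiniteDimensional ℂ V] {W : Opens X} (hW : W ≤ U) {s : ∀ x, E x}
    (hs : C.IsSmooth W s) : ∃ ξ : ∀ x, CForm V x, SmoothForm ℝ W ξ ∧
      ∀ x ∈ W, s x = σ x (C.π x (s x)) + C.ι x (ξ x) := by
  have h : ∀ x, ∃ ξ : CForm V x, x ∈ U → s x = σ x (C.π x (s x)) + C.ι x ξ := by
    intro x
    by_cases hx : x ∈ U
    · have h1 : s x - σ x (C.π x (s x)) ∈ LinearMap.range (C.ι x) := by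
        rw [C.exact x, LinearMap.mem_ker, map_sub, hσ.right_inv x hx, sub_self]
      obtain ⟨ξ, hξ⟩ := h1
      exact ⟨ξ, fun _ => by rw [hξ]; abel⟩
    · exact ⟨0, fun h => absurd h hx⟩
  choose ξ hξ using h
  refine ⟨ξ, hσ.smoothForm hW ?_, fun x hx => hξ x (hW hx)⟩
  refine C.isVectorBundle.congr (C.isVectorBundle.sub hs
    (hσ.smooth W _ hW (C.π_smooth W s hs))) fun x hx => ?_
  nth_rewrite 1 [hξ x (hW hx)]
  abel

include hσ in
theorem bracket_eq {W : Opens X} (hW : W ≤ U) {s t : ∀ x, E x} {Z Y : ∀ x, CT V x}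
    {ξ η : ∀ x, CForm V x} (hZ : SmoothCField W Z) (hξ : SmoothForm ℝ W ξ)
    (hY : SmoothCField W Y) (hη : SmoothForm ℝ W η)
    (hs : ∀ x ∈ W, s x = σ x (Z x) + C.ι x (ξ x)) (ht : ∀ x ∈ W, t x = σ x (Y x) + C.ι x (η x))
    {x : X} (hx : x ∈ W) :
    C.bracket s t x = σ x (cLie Z Y x) + C.ι x (cCourantForm Z ξ Y η x) := by
  rw [← hσ.bracket W Z Y ξ η hW hZ hξ hY hη x hx]
  exact (C.bracket_local W _ _ _ _ (hσ.smooth_add hW hZ hξ) (hσ.smooth_add hW hY hη)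
    (fun x hx => (hs x hx).symm) (fun x hx => (ht x hx).symm) x hx).symm

include hσ in
/-- Splittings may be changed by an exact two-form. -/
theorem add_contractL [CompleteSpace V] {α : ∀ x, CForm V x} (hα : SmoothForm ℝ U α) :
    IsSplitting C U fun x => σ x + C.ι x ∘ₗ contractL α x where
  right_inv x hx z := hσ.π_apply hx z _
  smooth W Z hW hZ := hσ.smooth_add hW hZ (smoothForm_contractL (hα.mono hW) hZ)
  pairing x hx z w ξ η := by
    simp only [LinearMap.add_apply, LinearMap.comp_apply]
    rw [add_assoc, add_assoc, ← map_add, ← map_add, hσ.pairing x hx, ev_add_left, ev_add_left]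
    linear_combination (1 / 2 : ℂ) * ev_contractL_antisymm α x z w
  bracket W Z Y ξ η hW hZ hξ hY hη x hx := by
    have hα' := hα.mono hW
    have h1 := smoothForm_contractL hα' hZ
    have h2 := smoothForm_contractL hα' hY
    have hadd : ∀ {ξ ξ' : ∀ x : X, CForm V x}, SmoothForm ℝ W ξ → SmoothForm ℝ W ξ' →
      SmoothForm ℝ W (fun x => ξ x + ξ' x) := fun h h' x₀ => (h x₀).add (h' x₀)
    -- The Courant form is additive in the pair of forms, so the shear contributes exactly the
    -- contraction of `dα` with the bracket of the anchors.
    rw [hσ.bracket_eq hW hZ (hadd h1 hξ) hY (hadd h2 hη) (fun x _ => ?_) (fun x _ => ?_) hx,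
      cCourantForm_add h1 hξ h2 hη hZ Y hx, cCourantForm_contractL hα' hZ hY hx, map_add, ← add_assoc]
    · rfl
    all_goals
      rw [map_add, ← add_assoc]
      rfl

end IsSplitting

theorem exists_isSplitting (C : ComplexCourantAlgebroid V E) (x₀ : X) :
    ∃ U : Opens X, x₀ ∈ U ∧ ∃ σ, IsSplitting C U σ := by
  obtain ⟨U, hx, σ, h1, h2, h3, h4⟩ := C.local_trivialization x₀
  exact ⟨U, hx, σ, h1, h2, h3, h4⟩

end Splitting

/-! ## Smooth solutions of linear equations -/

/-- Inversion of bounded operators is smooth at invertible operators, and bijective operators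
between Banach spaces are invertible. -/
theorem exists_contDiffOn_solution {V F G : Type*} [NormedAddCommGroup V] [NormedSpace ℝ V]
    [NormedAddCommGroup F] [NormedSpace ℝ F] [CompleteSpace F]
    [NormedAddCommGroup G] [NormedSpace ℝ G] [CompleteSpace G] {O : Set V} (hO : IsOpen O)
    {N : V → F →L[ℝ] G} (hN : ContDiffOn ℝ ∞ N O) (hb : ∀ y ∈ O, Function.Bijective (N y))
    {g : V → G} (hg : ContDiffOn ℝ ∞ g O) :
    ∃ f : V → F, ContDiffOn ℝ ∞ f O ∧ ∀ y ∈ O, N y (f y) = g y := by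
  have key : ∀ y ∈ O, ∃ e : F ≃L[ℝ] G, (e : F →L[ℝ] G) = N y := fun y hy =>
    ⟨ContinuousLinearEquiv.ofBijective (N y) (LinearMap.ker_eq_bot.2 (hb y hy).1)
      (LinearMap.range_eq_top.2 (hb y hy).2), ContinuousLinearEquiv.coe_ofBijective _ _ _⟩
  refine ⟨fun y => (N y).inverse (g y), fun y hy => ?_, fun y hy => ?_⟩
  · obtain ⟨e, he⟩ := key y hy
    have h1 : ContDiffAt ℝ ∞ ContinuousLinearMap.inverse (N y) := by
      rw [← he]
      exact contDiffAt_map_inverse e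
    have h2 := h1.comp y (hN.contDiffAt (hO.mem_nhds hy))
    exact (h2.clm_apply (hg.contDiffAt (hO.mem_nhds hy))).contDiffWithinAt
  · obtain ⟨e, he⟩ := key y hy
    simp [← he]

/-! ## Lifts of vector fields of type `(0,1)` -/

section AntiField

variable {V : Type*} [NormedAddCommGroup V] [NormedSpace ℂ V]
  {X : Type*} [TopologicalSpace X] [ChartedSpace V X] [IsManifold 𝓘(ℂ, V) ∞ X]

/-- The real part of a complex tangent vector in the preferred chart at `x₀`; a coordinate on
`T₀₁X`. -/
def reCoord (x₀ x : X) : CT V x →ₗ[ℝ] V where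
  toFun z := chartD ℝ x₀ x (asVec (reT x z))
  map_add' z w := (congrArg (chartD (V := V) ℝ x₀ x) (map_add (reT x) z w)).trans
    (map_add (chartD ℝ x₀ x) (asVec (reT x z)) (asVec (reT x w)))
  map_smul' c z := (congrArg (chartD (V := V) ℝ x₀ x) (map_smul (reT x) c z)).trans
    (map_smul (chartD ℝ x₀ x) c (asVec (reT x z)))

omit [IsManifold 𝓘(ℂ, V) ∞ X] in
theorem reF_apply (x₀ : X) (Z : ∀ x : X, CT V x) (y : V) :
    reF x₀ Z y = reCoord x₀ _ (Z ((extChartAt 𝓘(ℝ, V) x₀).symm y)) := rfl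

theorem reCoord_antiField {x₀ x : X} (hx : x ∈ (extChartAt 𝓘(ℝ, V) x₀).source) (v : V) :
    reCoord x₀ x (antiField x₀ v x) = v := by
  have hy : extChartAt 𝓘(ℝ, V) x₀ x ∈ (extChartAt 𝓘(ℝ, V) x₀).target :=
    (extChartAt 𝓘(ℝ, V) x₀).map_source hx
  have h := chartD_chartDinv (𝕜 := ℝ) hy v
  rw [(extChartAt 𝓘(ℝ, V) x₀).left_inv hx] at h
  have h2 : reT x (antiField x₀ v x) = fieldOfChart ℝ x₀ (fun _ => v) x := by
    unfold antiField
    rw [reT_mkCT]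
  exact (congrArg (chartD (V := V) ℝ x₀ x) h2).trans h

theorem antiField_reCoord {x₀ x : X} (hx : x ∈ (extChartAt 𝓘(ℝ, V) x₀).source) {z : CT V x}
    (hz : z ∈ T01 V x) : antiField x₀ (reCoord x₀ x z) x = z := antiField_chartD hx hz

theorem reCoord_smul {x₀ x : X} (hx : x ∈ (extChartAt 𝓘(ℝ, V) x₀).source) {z : CT V x}
    (hz : z ∈ T01 V x) (c : ℂ) : reCoord x₀ x (c • z) = star c • reCoord x₀ x z := by
  have h1 := antiField_smul hx (star c) (reCoord x₀ x z)
  rw [star_star, antiField_reCoord hx hz] at h1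
  rw [← h1, reCoord_antiField hx]

theorem reCoord_sum {x₀ x : X} (hx : x ∈ (extChartAt 𝓘(ℝ, V) x₀).source) {r : ℕ}
    {z : Fin r → CT V x} (hz : ∀ i, z i ∈ T01 V x) (c : Fin r → ℂ) :
    reCoord x₀ x (∑ i, c i • z i) = ∑ i, star (c i) • reCoord x₀ x (z i) := by
  rw [map_sum]
  exact Finset.sum_congr rfl fun i _ => reCoord_smul hx (hz i) (c i)

theorem reCoord_injOn {x₀ x : X} (hx : x ∈ (extChartAt 𝓘(ℝ, V) x₀).source) {z w : CT V x}
    (hz : z ∈ T01 V x) (hw : w ∈ T01 V x) (h : reCoord x₀ x z = reCoord x₀ x w) : z = w := by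
  rw [← antiField_reCoord hx hz, h, antiField_reCoord hx hw]

end AntiField

section Normal

variable {V : Type*} [NormedAddCommGroup V] [NormedSpace ℂ V] [FiniteDimensional ℂ V]
  {X : Type*} [TopologicalSpace X] [ChartedSpace V X] [IsManifold 𝓘(ℂ, V) ∞ X]
  {E : X → Type*} [∀ x, AddCommGroup (E x)] [∀ x, Module ℂ (E x)]
  {C : ComplexCourantAlgebroid V E} (L : Lifting C)

omit [FiniteDimensional ℂ V] in
theorem Lifting.π_mem {x : X} {a : E x} (ha : a ∈ L.D x) : C.π x a ∈ T01 V x := by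
  rw [← L.anchor_map x]
  exact ⟨a, ha, rfl⟩

omit [FiniteDimensional ℂ V] in
theorem Lifting.eq_zero {x : X} {a : E x} (ha : a ∈ L.D x) (h : C.π x a = 0) : a = 0 :=
  L.anchor_injOn x ha (L.D x).zero_mem (by rw [h, map_zero])

/-- The anchor is an isomorphism from `D` to `T₀₁X`, and real parts identify `T₀₁X` with `V`. In a
frame of `D` this is a smooth family of bijections `ℂʳ → V`, so the coefficients of the lift depend
smoothly on the point. -/
theorem Lifting.exists_antiField_lift (x₀ : X) : ∃ U : Opens X, x₀ ∈ U ∧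
    (U : Set X) ⊆ (extChartAt 𝓘(ℝ, V) x₀).source ∧ ∀ v : V, ∃ d : ∀ x, E x, C.IsSmooth U d ∧
      ∀ x ∈ U, d x ∈ L.D x ∧ C.π x (d x) = antiField x₀ v x := by
  have : CompleteSpace V := FiniteDimensional.complete ℂ V
  obtain ⟨U₀, hx₀, r, e, he, hD⟩ := L.subbundle x₀
  set U := U₀ ⊓ chartOpens V x₀
  have hU : (U : Set X) ⊆ (extChartAt 𝓘(ℝ, V) x₀).source :=
    fun x hx => by simpa [chartOpens] using hx.2
  have heU : ∀ i, C.IsSmooth U (e i) := fun i =>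
    C.isVectorBundle.restrict _ _ _ inf_le_left (he i)
  have heD : ∀ x ∈ U, ∀ i, e i x ∈ L.D x := fun x hx i => by
    rw [← (hD x hx.1).2]
    exact Submodule.subset_span ⟨i, rfl⟩
  refine ⟨U, ⟨hx₀, mem_chart_source V x₀⟩, hU, fun v => ?_⟩
  set ρ : Fin r → V → V := fun i => reF x₀ fun x => C.π x (e i x) with hρ
  -- Conjugated coefficients, because the real part is a conjugate linear coordinate on `T₀₁X`.
  let M : V → (Fin r → ℂ) →L[ℝ] V := fun y =>
    ∑ i, ((Complex.conjCLE : ℂ →L[ℝ] ℂ).comp (ContinuousLinearMap.proj i)).smulRight (ρ i y)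
  have hM : ∀ y c, M y c = ∑ i, star (c i) • ρ i y := by
    intro y c
    simp [M]
  have hMx : ∀ x ∈ U, ∀ c, M (extChartAt 𝓘(ℝ, V) x₀ x) c =
      reCoord x₀ x (C.π x (∑ i, c i • e i x)) := by
    intro x hx c
    rw [map_sum]
    simp only [map_smul]
    rw [reCoord_sum (hU hx) fun i => L.π_mem (heD x hx i), hM]
    simp only [hρ, reF_apply]
    rw [(extChartAt 𝓘(ℝ, V) x₀).left_inv (hU hx)]
  have hxy : ∀ y ∈ chartDom ℝ x₀ U, ∃ x ∈ U, extChartAt 𝓘(ℝ, V) x₀ x = y := fun y hy =>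
    ⟨_, hy.2, (extChartAt 𝓘(ℝ, V) x₀).right_inv hy.1⟩
  obtain ⟨c, hc, hc'⟩ := exists_contDiffOn_solution (isOpen_chartDom x₀ U) (N := M) (by
      refine contDiffOn_clm_apply.2 fun c => ?_
      simp only [hM]
      refine ContDiffOn.sum fun i _ => ?_
      have h1 := ((smoothCField_iff hU _).1 (C.π_smooth U _ (heU i))).1
      exact h1.const_smul (star (c i)))
    (by
      intro y hy
      obtain ⟨x, hx, rfl⟩ := hxy y hy
      constructor
      · refine (injective_iff_map_eq_zero (M _)).2 fun c hc => ?_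
        rw [hMx x hx] at hc
        have hmem : ∑ i, c i • e i x ∈ L.D x :=
          Submodule.sum_mem _ fun i _ => Submodule.smul_mem _ _ (heD x hx i)
        have h0 : C.π x (∑ i, c i • e i x) = 0 := reCoord_injOn (hU hx) (L.π_mem hmem)
          (Submodule.zero_mem _) (hc.trans (map_zero _).symm)
        exact funext (Fintype.linearIndependent_iff.1 (hD x hx.1).1 c (L.eq_zero hmem h0))
      · intro w
        have h1 : antiField x₀ w x ∈ (L.D x).map (C.π x) := by
          rw [L.anchor_map]
          exact antiField_mem (hU hx) w
        obtain ⟨a, ha, ha'⟩ := h1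
        have ha2 : a ∈ L.D x := ha
        rw [← (hD x hx.1).2, Submodule.mem_span_range_iff_exists_fun] at ha2
        obtain ⟨c, rfl⟩ := ha2
        exact ⟨c, by rw [hMx x hx, ha', reCoord_antiField (hU hx)]⟩)
    (g := fun _ => v) contDiffOn_const
  refine ⟨fun x => ∑ i, c (extChartAt 𝓘(ℝ, V) x₀ x) i • e i x, ?_, fun x hx => ?_⟩
  · refine C.isVectorBundle.sum fun i => C.isVectorBundle.smul ?_ (heU i)
    refine (contMDiffOn_iff_chart hU _).2 ?_
    refine (contDiffOn_pi.1 hc i).congr fun y hy => ?_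
    rw [(extChartAt 𝓘(ℝ, V) x₀).right_inv hy.1]
  · have hmem : ∑ i, c (extChartAt 𝓘(ℝ, V) x₀ x) i • e i x ∈ L.D x :=
      Submodule.sum_mem _ fun i _ => Submodule.smul_mem _ _ (heD x hx i)
    refine ⟨hmem, reCoord_injOn (hU hx) (L.π_mem hmem) (antiField_mem (hU hx) v) ?_⟩
    rw [← hMx x hx, reCoord_antiField (hU hx)]
    exact hc' _ (mem_chartDom (hU hx) hx)

/-- Near every point there is a splitting of the anchor which maps `T₀₁X` to `D`. -/
theorem Lifting.exists_adapted (x₀ : X) : ∃ U : Opens X, x₀ ∈ U ∧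
    (U : Set X) ⊆ (extChartAt 𝓘(ℝ, V) x₀).source ∧ ∃ σ, IsSplitting C U σ ∧
      ∀ x ∈ U, ∀ z ∈ T01 V x, σ x z ∈ L.D x := by
  have : CompleteSpace V := FiniteDimensional.complete ℂ V
  obtain ⟨U₁, hx₁, σ, hσ₁⟩ := exists_isSplitting C x₀
  obtain ⟨U₂, hx₂, hU₂, hd₂⟩ := L.exists_antiField_lift x₀
  set U := U₁ ⊓ U₂ with hUdef
  have hσ : IsSplitting C U σ := hσ₁.mono inf_le_left
  have hU : (U : Set X) ⊆ (extChartAt 𝓘(ℝ, V) x₀).source := fun x hx => hU₂ hx.2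
  let b := Module.finBasis ℂ V
  choose d hd hd' using fun j => hd₂ (b j)
  have hdU : ∀ j, C.IsSmooth U (d j) := fun j => C.isVectorBundle.restrict _ _ _ inf_le_right (hd j)
  choose θ hθ hdθ using fun j => hσ.exists_decomp le_rfl (hdU j)
  have hdθ' : ∀ j, ∀ x ∈ U, d j x = σ x (antiField x₀ (b j) x) + C.ι x (θ j x) := by
    intro j x hx
    rw [← (hd' j x hx.2).2]
    exact hdθ j x hx
  have hA : ∀ j, SmoothCField U (antiField x₀ (b j)) := fun j =>
    smoothCField_mkCT hU contDiffOn_const contDiffOn_const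
  have hre : ∀ j, ∀ y ∈ chartDom ℝ x₀ U, reF x₀ (antiField x₀ (b j)) y = b j := fun j y hy =>
    reF_mkCT x₀ _ _ hy.1
  have him : ∀ j, ∀ y ∈ chartDom ℝ x₀ U, imF x₀ (antiField x₀ (b j)) y = Complex.I • b j :=
    fun j y hy => imF_mkCT x₀ _ _ hy.1
  have hDre : ∀ j, ∀ y ∈ chartDom ℝ x₀ U, fderiv ℝ (reF x₀ (antiField x₀ (b j))) y = 0 := by
    intro j y hy
    have h1 : reF x₀ (antiField (X := X) x₀ (b j)) =ᶠ[nhds y] fun _ => b j := by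
      filter_upwards [(isOpen_chartDom x₀ U).mem_nhds hy] with z hz using hre j z hz
    rw [h1.fderiv_eq]
    simp
  have hDim : ∀ j, ∀ y ∈ chartDom ℝ x₀ U, fderiv ℝ (imF x₀ (antiField x₀ (b j))) y = 0 := by
    intro j y hy
    have h1 : imF x₀ (antiField (X := X) x₀ (b j)) =ᶠ[nhds y] fun _ => Complex.I • b j := by
      filter_upwards [(isOpen_chartDom x₀ U).mem_nhds hy] with z hz using him j z hz
    rw [h1.fderiv_eq]
    simp
  -- The `θ j` are the form components of the lifts of the constant `(0,1)`-fields. Isotropy and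
  -- involutivity of `D` are the two hypotheses for a potential.
  obtain ⟨N, hN, hyN, a, ha, haθ⟩ := exists_local_potential b (isOpen_chartDom x₀ U)
    (mem_chartDom (𝕜 := ℝ) (V := V) (mem_extChartAt_source x₀) ⟨hx₁, hx₂⟩)
    (fun j => formInChart ℝ x₀ (θ j)) (fun j => hθ j x₀)
    (by
      intro i j y hy
      have h1 := L.isotropic _ _ (hd' i _ hy.2.2).1 _ (hd' j _ hy.2.2).1
      rw [hdθ' i _ hy.2, hdθ' j _ hy.2, hσ.pairing _ hy.2, ev_eq_chart x₀ (θ i) _ hy.1,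
        ev_eq_chart x₀ (θ j) _ hy.1, hre i y hy, hre j y hy, him i y hy, him j y hy] at h1
      unfold antiPart
      linear_combination 2 * h1)
    (by
      intro i j u y hy
      set x := (extChartAt 𝓘(ℝ, V) x₀).symm y
      have h1 := L.involutive U₂ _ _ (hd i) (hd j) (fun x hx => (hd' i x hx).1)
        (fun x hx => (hd' j x hx).1) x hy.2.2
      rw [hσ.bracket_eq le_rfl (hA i) (hθ i) (hA j) (hθ j) (hdθ' i) (hdθ' j) hy.2] at h1
      -- Constant fields commute, so the bracket of the two lifts has zero anchor; lying in `D`, it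
      -- vanishes, and so does its form component.
      have h2 : cLie (antiField x₀ (b i)) (antiField x₀ (b j)) x = 0 := by
        apply CT_ext
        · apply chartD_injective (𝕜 := ℝ) hy.1
          refine (reF_cLie (hA i) (hA j) hy).trans ?_
          rw [hDre i y hy, hDre j y hy, hDim i y hy, hDim j y hy, map_zero]
          refine Eq.trans ?_ (map_zero (chartD ℝ x₀ x)).symm
          simp
        · apply chartD_injective (𝕜 := ℝ) hy.1
          refine (imF_cLie (hA i) (hA j) hy).trans ?_
          rw [hDre i y hy, hDre j y hy, hDim i y hy, hDim j y hy, map_zero]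
          refine Eq.trans ?_ (map_zero (chartD ℝ x₀ x)).symm
          simp
      have h3 := L.eq_zero h1 (by rw [hσ.π_apply hy.2, h2])
      rw [h2, map_zero, zero_add] at h3
      have h4 := C.ι_injective x (h3.trans (map_zero _).symm)
      have h5 := cCourantForm_eq (hθ i) (hθ j) (hA i) (antiField x₀ (b j)) hy u
      rw [h4, hDre i y hy, hDim i y hy, hre i y hy, him i y hy, hre j y hy, him j y hy] at h5
      simp only [zero_apply, map_zero] at h5
      unfold extV at h5
      simp only [dbar, antiPart, add_apply, smul_apply, smul_eq_mul]
      exact Eq.trans (by ring) h5.symm)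
  set α : ∀ x : X, CForm V x := formOfChart ℝ x₀ a
  set U' : Opens X := ⟨U ∩ extChartAt 𝓘(ℝ, V) x₀ ⁻¹' N, ((continuousOn_extChartAt x₀).mono
    hU).isOpen_inter_preimage U.2 hN⟩
  have hU' : U' ≤ U := fun x hx => hx.1
  have hα : SmoothForm ℝ U' α := by
    rw [smoothForm_iff (x₀ := x₀) fun x hx => hU (hU' hx)]
    exact ha.contDiffOn.congr fun y hy => formInChart_formOfChart x₀ a hy.1
  -- The contraction of `dα` with the `j`-th `(0,1)`-field is the form component of its lift, so the
  -- sheared splitting sends this field to the lift, in `D`.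
  have hθα : ∀ j, ∀ x ∈ U', contractL α x (antiField x₀ (b j) x) = θ j x := by
    intro j x hx
    have hy := mem_chartDom (𝕜 := ℝ) (V := V) (hU (hU' hx)) hx
    have hy' := mem_chartDom (𝕜 := ℝ) (V := V) (hU (hU' hx)) (hU' hx)
    have hxx := (extChartAt 𝓘(ℝ, V) x₀).left_inv (hU (hU' hx))
    set y := extChartAt 𝓘(ℝ, V) x₀ x
    rw [← hxx]
    refine form_ext hy.1 fun u => ?_
    refine (cContract_eq hα (antiField x₀ (b j)) hy u).trans ((Eq.trans ?_
      (haθ j u y hx.2)).trans rfl)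
    have hev : formInChart ℝ x₀ α =ᶠ[nhds y] a := by
      filter_upwards [(isOpen_chartDom x₀ U).mem_nhds hy'] with z hz using
        formInChart_formOfChart x₀ a hz.1
    rw [hre j y hy', him j y hy']
    unfold extV
    rw [hev.fderiv_eq]
    simp only [dbar, antiPart, add_apply, smul_apply, smul_eq_mul]
    ring
  refine ⟨U', ⟨⟨hx₁, hx₂⟩, hyN⟩, fun x hx => hU (hU' hx), _,
    (hσ.mono hU').add_contractL hα, fun x hx z hz => ?_⟩
  have hxs := hU (hU' hx)
  rw [← antiField_reCoord hxs hz]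
  generalize reCoord x₀ x z = v
  have hv : (v : V) ∈ Submodule.span ℂ (Set.range b) := by rw [b.span_eq]; trivial
  induction hv using Submodule.span_induction with
  | mem v hv =>
    obtain ⟨j, rfl⟩ := hv
    simp only [LinearMap.add_apply, LinearMap.comp_apply]
    rw [hθα j x hx, ← hdθ' j x (hU' hx)]
    exact (hd' j x (hU' hx).2).1
  | zero =>
    have h0 := antiField_smul hxs 0 (0 : V)
    rw [zero_smul, star_zero, zero_smul] at h0
    rw [h0, map_zero]
    exact Submodule.zero_mem _
  | add v w _ _ hv hw =>
    rw [antiField_add, map_add]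
    exact Submodule.add_mem _ hv hw
  | smul c v _ hv =>
    rw [antiField_smul hxs, map_smul]
    exact Submodule.smul_mem _ _ hv

end Normal

/-! ### Holomorphic tangent and cotangent vectors in a chart. -/

section Model

variable {V : Type*} [NormedAddCommGroup V] [NormedSpace ℂ V]
  {X : Type*} [TopologicalSpace X] [ChartedSpace V X]

/-- The preferred chart at `x₀` on holomorphic tangent vectors. -/
def hvec (x₀ x : X) : HT V x →ₗ[ℂ] V where
  toFun a := chartD ℂ x₀ x (asHVec a)
  map_add' a b := map_add (chartD ℂ x₀ x) (asHVec a) (asHVec b)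
  map_smul' c a := map_smul (chartD ℂ x₀ x) c (asHVec a)

/-- The holomorphic tangent vector with given coordinates in the preferred chart at `x₀`. -/
def hvecInv (x₀ x : X) : V →ₗ[ℂ] HT V x where
  toFun v := chartDinv ℂ x₀ (extChartAt 𝓘(ℝ, V) x₀ x) v
  map_add' a b := map_add (chartDinv ℂ x₀ (extChartAt 𝓘(ℝ, V) x₀ x)) a b
  map_smul' c a := map_smul (chartDinv ℂ x₀ (extChartAt 𝓘(ℝ, V) x₀ x)) c a

/-- The holomorphic cotangent vector with given coordinates in the preferred chart at `x₀`. -/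
def hform (x₀ x : X) : (V →L[ℂ] ℂ) →ₗ[ℂ] HForm V x where
  toFun φ := formOfChart ℂ x₀ (fun _ => φ) x
  map_add' _ _ := rfl
  map_smul' _ _ := rfl

/-- `holForm` as a linear map. -/
def holFormL (x : X) : HForm V x →ₗ[ℂ] CForm V x where
  toFun := holForm x
  map_add' := holForm_add x
  map_smul' := holForm_smul x

variable [IsManifold 𝓘(ℂ, V) ∞ X] {x₀ x : X} (hx : x ∈ (extChartAt 𝓘(ℝ, V) x₀).source)

include hx

theorem hvec_hvecInv (v : V) : hvec x₀ x (hvecInv x₀ x v) = v := by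
  have h := chartD_chartDinv (𝕜 := ℂ) ((extChartAt 𝓘(ℝ, V) x₀).map_source hx) v
  have h2 : (extChartAt 𝓘(ℂ, V) x₀).symm (extChartAt 𝓘(ℝ, V) x₀ x) = x :=
    (extChartAt 𝓘(ℝ, V) x₀).left_inv hx
  rw [h2] at h
  exact h

theorem hvecInv_hvec (a : HT V x) : hvecInv x₀ x (hvec x₀ x a) = a := by
  have h := chartDinv_chartD (𝕜 := ℂ) ((extChartAt 𝓘(ℝ, V) x₀).map_source hx) (asHVec a)
  have h2 : (extChartAt 𝓘(ℂ, V) x₀).symm (extChartAt 𝓘(ℝ, V) x₀ x) = x :=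
    (extChartAt 𝓘(ℝ, V) x₀).left_inv hx
  rw [h2] at h
  exact h

omit [IsManifold 𝓘(ℂ, V) ∞ X] hx in
theorem hform_apply (φ : V →L[ℂ] ℂ) (a : HT V x) : hform x₀ x φ a = φ (hvec x₀ x a) := rfl

theorem hform_hvecInv (φ : V →L[ℂ] ℂ) (v : V) : hform x₀ x φ (hvecInv x₀ x v) = φ v := by
  rw [hform_apply, hvec_hvecInv hx]

theorem hform_injective : Function.Injective (hform (V := V) x₀ x) := by
  intro φ φ' h
  ext v
  rw [← hform_hvecInv hx φ, h, hform_hvecInv hx]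

theorem hform_surjective : Function.Surjective (hform (V := V) x₀ x) := by
  intro ζ
  refine ⟨(show V →L[ℂ] ℂ from ζ).comp (chartDinv ℂ x₀ (extChartAt 𝓘(ℝ, V) x₀ x)), ?_⟩
  ext a
  exact congrArg ζ (hvecInv_hvec hx a)

theorem hvec_holPart (z : CT V x) : hvec x₀ x (holPart x z) =
    reCoord x₀ x z + Complex.I • chartD ℝ x₀ x (asVec (imT x z)) := by
  refine (congrArg (chartD (V := V) ℂ x₀ x) (asHVec_holPart x z)).trans ?_
  rw [map_add, map_smul, chartD_complex hx, chartD_complex hx]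
  rfl

/-- A real vector already represents a given holomorphic one: classes modulo `T₀₁X` do not require a
representative of type `(1,0)`. -/
theorem hvec_holPart_mkCT (v : V) :
    hvec x₀ x (holPart x (mkCT x (fieldOfChart ℝ x₀ (fun _ => v) x)
      (fieldOfChart ℝ x₀ (fun _ => 0) x))) = v := by
  have hy := (extChartAt 𝓘(ℝ, V) x₀).map_source hx
  have hxx := (extChartAt 𝓘(ℝ, V) x₀).left_inv hx
  have h1 := reF_mkCT x₀ (fun _ => v) (fun _ => 0) hy
  have h2 := imF_mkCT x₀ (fun _ => v) (fun _ => 0) hy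
  rw [reF_apply, hxx] at h1
  unfold imF fieldInChart at h2
  rw [hxx] at h2
  rw [hvec_holPart hx, h1]
  refine (congrArg (fun w : V => v + Complex.I • w) h2).trans ?_
  simp

theorem holForm_hform_apply (φ : V →L[ℂ] ℂ) (v : V) : holForm x (hform x₀ x φ)
    (chartDinv ℝ x₀ (extChartAt 𝓘(ℝ, V) x₀ x) v) = φ v := by
  rw [← hform_hvecInv hx φ v, ← chartDinv_complex ((extChartAt 𝓘(ℝ, V) x₀).map_source hx)]
  rfl

/-- A complex form which is complex linear in the chart. -/
theorem eq_holForm_hform {ξ : CForm V x} {φ : V →L[ℂ] ℂ}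
    (h : ∀ v : V, ξ (chartDinv ℝ x₀ (extChartAt 𝓘(ℝ, V) x₀ x) v) = φ v) :
    ξ = holForm x (hform x₀ x φ) := by
  have hy := (extChartAt 𝓘(ℝ, V) x₀).map_source hx
  have h2 := chartDinv_chartD (𝕜 := ℝ) hy
  rw [(extChartAt 𝓘(ℝ, V) x₀).left_inv hx] at h2
  ext u
  have h3 := (h (chartD ℝ x₀ x (asVec u))).trans (holForm_hform_apply hx φ (chartD ℝ x₀ x (asVec u))).symm
  rw [h2] at h3
  exact h3

end Model

/-! ## Local models of the reduction -/

section LocalModel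

variable {V : Type*} [NormedAddCommGroup V] [NormedSpace ℂ V]
  {X : Type*} [TopologicalSpace X] [ChartedSpace V X] [IsManifold 𝓘(ℂ, V) ∞ X]
  {E : X → Type*} [∀ x, AddCommGroup (E x)] [∀ x, Module ℂ (E x)]
  {C : ComplexCourantAlgebroid V E} (L : Lifting C)

variable (V) in
/-- The model fibre of the reduction. -/
abbrev ModelFibre : Type _ := V × (V →L[ℂ] ℂ)

/-- An adapted splitting, and the coordinates it induces on the reduction. -/
structure IsLocalModel (x₀ : X) (U : Opens X) (σ : ∀ x, CT V x →ₗ[ℂ] E x)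
    (κ : ∀ x, L.Reduced x →ₗ[ℂ] ModelFibre V) : Prop where
  subset : (U : Set X) ⊆ (extChartAt 𝓘(ℝ, V) x₀).source
  split : IsSplitting C U σ
  mem : ∀ x ∈ U, ∀ z ∈ T01 V x, σ x z ∈ L.D x
  bijective : ∀ x ∈ U, Function.Bijective (κ x)
  hasClass : ∀ x ∈ U, ∀ (z : CT V x) (φ : V →L[ℂ] ℂ), ∃ q,
    L.HasClass (σ x z + C.ι x (holForm x (hform x₀ x φ))) q ∧
      κ x q = (hvec x₀ x (holPart x z), φ)

variable {L}

theorem Lifting.HasClass.eq {x : X} {a : E x} {p q : L.Reduced x} (hp : L.HasClass a p)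
    (hq : L.HasClass a q) : p = q := by
  obtain ⟨_, rfl⟩ := hp
  obtain ⟨_, rfl⟩ := hq
  rfl

theorem Lifting.exists_hasClass {x : X} (q : L.Reduced x) : ∃ a, L.HasClass a q := by
  obtain ⟨⟨a, ha⟩, rfl⟩ := Submodule.Quotient.mk_surjective _ q
  exact ⟨a, ha, rfl⟩

theorem Lifting.hasClass_iff_sub_mem {x : X} {a b : E x} {p q : L.Reduced x}
    (hp : L.HasClass a p) (hq : L.HasClass b q) : p = q ↔ a - b ∈ L.D x := by
  obtain ⟨h1, rfl⟩ := hp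
  obtain ⟨h2, rfl⟩ := hq
  rw [Submodule.Quotient.eq]
  rfl

variable {x₀ : X} {U : Opens X} {σ : ∀ x, CT V x →ₗ[ℂ] E x}

/-- Both sides lie in `D` and have the same anchor, which is injective on `D`. So `D` is exactly the
image of `T₀₁X`. -/
theorem IsSplitting.eq_of_mem (hσ : IsSplitting C U σ) (hD : ∀ x ∈ U, ∀ z ∈ T01 V x, σ x z ∈ L.D x)
    {x : X} (hx : x ∈ U) {a : E x} (ha : a ∈ L.D x) : a = σ x (C.π x a) := by
  have h1 : a - σ x (C.π x a) ∈ L.D x := sub_mem ha (hD x hx _ (L.π_mem ha))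
  exact sub_eq_zero.1 (L.eq_zero h1 (by rw [map_sub, hσ.right_inv x hx, sub_self]))

theorem IsSplitting.pairing_apply (hσ : IsSplitting C U σ) {x : X}
    (hx : x ∈ U) (z : CT V x) (ξ : CForm V x) (w : CT V x) :
    C.pairing x (σ x z + C.ι x ξ) (σ x w) = (1 / 2) * ev ξ w := by
  have h := hσ.pairing x hx z w ξ 0
  rwa [map_zero, add_zero, ev_zero_left, add_zero] at h

/-- Orthogonality to the image of `T₀₁X` says that the form component kills `T₀₁X`, hence is complex
linear. -/
theorem IsSplitting.exists_hform (hU : (U : Set X) ⊆ (extChartAt 𝓘(ℝ, V) x₀).source)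
    (hσ : IsSplitting C U σ) (hD : ∀ x ∈ U, ∀ z ∈ T01 V x, σ x z ∈ L.D x) {x : X} (hx : x ∈ U)
    {a : E x} (ha : a ∈ L.perp x) :
    ∃ φ : V →L[ℂ] ℂ, a = σ x (C.π x a) + C.ι x (holForm x (hform x₀ x φ)) := by
  have h1 : a - σ x (C.π x a) ∈ LinearMap.range (C.ι x) := by
    rw [C.exact x, LinearMap.mem_ker, map_sub, hσ.right_inv x hx, sub_self]
  obtain ⟨ξ, hξ⟩ := h1
  have h2 : a = σ x (C.π x a) + C.ι x ξ := by rw [hξ]; abel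
  obtain ⟨ζ, rfl⟩ := exists_holForm x ξ fun z hz => by
    have h3 := ha _ (hD x hx z hz)
    rw [h2, hσ.pairing_apply hx] at h3
    simpa using h3
  obtain ⟨φ, rfl⟩ := hform_surjective (hU hx) ζ
  exact ⟨φ, h2⟩

/-- The coordinates invert the map sending `(v, φ)` to the class of a `(1,0)`-lift of `v` plus `φ`.
-/
theorem IsSplitting.exists_coord (hU : (U : Set X) ⊆ (extChartAt 𝓘(ℝ, V) x₀).source)
    (hσ : IsSplitting C U σ) (hD : ∀ x ∈ U, ∀ z ∈ T01 V x, σ x z ∈ L.D x) :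
    ∃ κ, IsLocalModel L x₀ U σ κ := by
  have key : ∀ x, ∃ κ : L.Reduced x →ₗ[ℂ] ModelFibre V, x ∈ U → Function.Bijective κ ∧
      ∀ (z : CT V x) (φ : V →L[ℂ] ℂ), ∃ q,
        L.HasClass (σ x z + C.ι x (holForm x (hform x₀ x φ))) q ∧
          κ q = (hvec x₀ x (holPart x z), φ) := by
    intro x
    by_cases hx : x ∈ U
    swap
    · exact ⟨0, fun h => absurd h hx⟩
    have hxs := hU hx
    have hperp : ∀ (z : CT V x) (φ : V →L[ℂ] ℂ),
        σ x z + C.ι x (holForm x (hform x₀ x φ)) ∈ L.perp x := by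
      intro z φ d hd
      rw [hσ.eq_of_mem hD hx hd, hσ.pairing_apply hx, ev_holForm, (mem_T01_iff x _).1 (L.π_mem hd), map_zero,
        mul_zero]
    let τ₀ : ModelFibre V →ₗ[ℂ] E x :=
      σ x ∘ₗ lift10 x ∘ₗ hvecInv x₀ x ∘ₗ LinearMap.fst ℂ V (V →L[ℂ] ℂ) +
        C.ι x ∘ₗ holFormL x ∘ₗ hform x₀ x ∘ₗ LinearMap.snd ℂ V (V →L[ℂ] ℂ)
    have hτ₀ : ∀ p, τ₀ p = σ x (lift10 x (hvecInv x₀ x p.1)) +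
      C.ι x (holForm x (hform x₀ x p.2)) := fun p => rfl
    let τ : ModelFibre V →ₗ[ℂ] L.Reduced x :=
      ((L.D x).submoduleOf (L.perp x)).mkQ ∘ₗ
        LinearMap.codRestrict (L.perp x) τ₀ fun p => hperp _ _
    have hτ : ∀ p, L.HasClass (τ₀ p) (τ p) := fun p => ⟨hperp _ _, rfl⟩
    have hτ' : ∀ z φ, L.HasClass (σ x z + C.ι x (holForm x (hform x₀ x φ)))
        (τ (hvec x₀ x (holPart x z), φ)) := by
      intro z φ
      obtain ⟨q, hq⟩ : ∃ q, L.HasClass (σ x z + C.ι x (holForm x (hform x₀ x φ))) q :=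
        ⟨_, hperp _ _, rfl⟩
      have h2 : q = τ (hvec x₀ x (holPart x z), φ) := by
        rw [Lifting.hasClass_iff_sub_mem hq (hτ _), hτ₀]
        simp only [hvecInv_hvec hxs, add_sub_add_right_eq_sub]
        rw [← map_sub]
        refine hD x hx _ ((mem_T01_iff x _).2 ?_)
        rw [map_sub, holPart_lift10, sub_self]
      rwa [← h2]
    have hbij : Function.Bijective τ := by
      constructor
      · refine (injective_iff_map_eq_zero τ).2 fun p hp => ?_
        have h0 : L.HasClass (0 : E x) (0 : L.Reduced x) := ⟨zero_mem _, rfl⟩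
        have h1 := (Lifting.hasClass_iff_sub_mem (hτ p) h0).1 hp
        rw [sub_zero, hτ₀] at h1
        have h2 := L.π_mem h1
        rw [hσ.π_apply hx, mem_T01_iff, holPart_lift10] at h2
        rw [h2, map_zero, map_zero, zero_add] at h1
        have h3 := L.eq_zero h1 (C.π_ι x _)
        have h4 := holForm_injective x
          ((C.ι_injective x (h3.trans (map_zero _).symm)).trans (holForm_zero x).symm)
        refine Prod.ext ?_ (hform_injective hxs (h4.trans (map_zero _).symm))
        rw [← hvec_hvecInv hxs p.1, h2, map_zero]
        rfl
      · intro q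
        obtain ⟨a, ha⟩ := Lifting.exists_hasClass q
        obtain ⟨φ, h2⟩ := hσ.exists_hform hU hD hx ha.1
        have h4 := hτ' (C.π x a) φ
        rw [← h2] at h4
        exact ⟨_, h4.eq ha⟩
    refine ⟨(LinearEquiv.ofBijective τ hbij).symm, fun _ => ⟨LinearEquiv.bijective _, ?_⟩⟩
    intro z φ
    exact ⟨_, hτ' z φ, (LinearEquiv.ofBijective τ hbij).symm_apply_apply _⟩
  choose κ hκ using key
  exact ⟨κ, hU, hσ, hD, fun x hx => (hκ x hx).1, fun x hx => (hκ x hx).2⟩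

end LocalModel

/-! ### Smoothness over the reals of families of complex-linear operators. -/

section OperatorValued

variable {V : Type*} [NormedAddCommGroup V] [NormedSpace ℂ V] {F : Type*} [NormedAddCommGroup F]
  [NormedSpace ℂ F] {O : Set V} {f : V → V →L[ℂ] F}

theorem contDiffOn_clm_of_apply [FiniteDimensional ℂ V]
    (h : ∀ v, ContDiffOn ℝ ∞ (fun y => f y v) O) : ContDiffOn ℝ ∞ f O := by
  let b := Module.finBasis ℂ V
  have hf : f = fun y => ∑ i, ContinuousLinearMap.smulRightL ℂ V F (coordL b i) (f y (b i)) := by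
    funext y
    ext v
    conv_lhs => rw [← b.sum_repr v, map_sum]
    simp [sum_apply]
  rw [hf]
  refine ContDiffOn.sum fun i _ => ?_
  exact ((ContinuousLinearMap.smulRightL ℂ V F (coordL b i)).restrictScalars
    ℝ).contDiff.comp_contDiffOn (h (b i))

theorem contDiffOn_apply_clm (h : ContDiffOn ℝ ∞ f O) (v : V) :
    ContDiffOn ℝ ∞ (fun y => f y v) O :=
  ((ContinuousLinearMap.apply ℂ F v).restrictScalars ℝ).contDiff.comp_contDiffOn h

end OperatorValued

/-! ### Sections, brackets and `∂̄` in a local model. -/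

section LocalRep

variable {V : Type*} [NormedAddCommGroup V] [NormedSpace ℂ V]
  {X : Type*} [TopologicalSpace X] [ChartedSpace V X] [IsManifold 𝓘(ℂ, V) ∞ X]
  {E : X → Type*} [∀ x, AddCommGroup (E x)] [∀ x, Module ℂ (E x)]

/-- In the splitting `σ` the section `s` has anchor `Y` and a form component of type `(1,0)`, and
`F` is the coordinate expression of its `(1,0)`-part. -/
structure IsLocalRep (C : ComplexCourantAlgebroid V E) (σ : ∀ x, CT V x →ₗ[ℂ] E x) (x₀ : X)
    (W : Opens X) (s : ∀ x, E x) (Y : ∀ x : X, CT V x) (F : V → ModelFibre V) : Prop where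
  field : SmoothCField W Y
  smooth : ContDiffOn ℝ ∞ F (chartDom ℝ x₀ W)
  eq : ∀ x ∈ W, s x =
    σ x (Y x) + C.ι x (holForm x (hform x₀ x (F (extChartAt 𝓘(ℝ, V) x₀ x)).2))
  fst : ∀ x ∈ W, hvec x₀ x (holPart x (Y x)) = (F (extChartAt 𝓘(ℝ, V) x₀ x)).1

/-- The complex one-form of type `(1,0)` with given coordinate expression. -/
def repForm (x₀ : X) (F : V → ModelFibre V) (x : X) : CForm V x :=
  holForm x (hform x₀ x (F (extChartAt 𝓘(ℝ, V) x₀ x)).2)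

theorem formInChart_repForm (x₀ : X) (F : V → ModelFibre V) {y : V}
    (hy : y ∈ (extChartAt 𝓘(ℝ, V) x₀).target) (v : V) :
    formInChart ℝ x₀ (repForm x₀ F) y v = (F y).2 v := by
  have h := holForm_hform_apply ((extChartAt 𝓘(ℝ, V) x₀).map_target hy)
    (F (extChartAt 𝓘(ℝ, V) x₀ ((extChartAt 𝓘(ℝ, V) x₀).symm y))).2 v
  rw [(extChartAt 𝓘(ℝ, V) x₀).right_inv hy] at h
  rw [formInChart_apply, repForm, (extChartAt 𝓘(ℝ, V) x₀).right_inv hy]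
  exact h

theorem smoothForm_repForm [FiniteDimensional ℂ V] {x₀ : X} {W : Opens X}
    (hW : (W : Set X) ⊆ (extChartAt 𝓘(ℝ, V) x₀).source) {F : V → ModelFibre V}
    (hF : ContDiffOn ℝ ∞ F (chartDom ℝ x₀ W)) : SmoothForm ℝ W (repForm (X := X) x₀ F) := by
  have : FiniteDimensional ℝ V := FiniteDimensional.trans ℝ ℂ V
  rw [smoothForm_iff hW, contDiffOn_clm_apply]
  exact fun v => (contDiffOn_apply_clm hF.snd v).congr fun y hy => formInChart_repForm x₀ F hy.1 v

/-- The coordinate expression of a section of the reduction. -/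
def rep {F : X → Type*} [∀ x, AddCommGroup (F x)] [∀ x, Module ℂ (F x)]
    (x₀ : X) (κ : ∀ x, F x →ₗ[ℂ] ModelFibre V) (s : ∀ x, F x) (y : V) : ModelFibre V :=
  κ ((extChartAt 𝓘(ℝ, V) x₀).symm y) (s ((extChartAt 𝓘(ℝ, V) x₀).symm y))

variable {C : ComplexCourantAlgebroid V E} {L : Lifting C} {x₀ : X} {U W : Opens X}
  {σ : ∀ x, CT V x →ₗ[ℂ] E x} {κ : ∀ x, L.Reduced x →ₗ[ℂ] ModelFibre V}
  (hL : IsLocalModel L x₀ U σ κ)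

include hL

theorem IsLocalModel.rep_apply {F : X → Type*} [∀ x, AddCommGroup (F x)] [∀ x, Module ℂ (F x)]
    (κ : ∀ x, F x →ₗ[ℂ] ModelFibre V) (s : ∀ x, F x) {x : X} (hx : x ∈ U) :
    rep x₀ κ s (extChartAt 𝓘(ℝ, V) x₀ x) = κ x (s x) := by
  rw [rep, (extChartAt 𝓘(ℝ, V) x₀).left_inv (hL.subset hx)]

/-- Every representative of a class has the same `(1,0)` data, whatever the `(0,1)`-part of its
anchor. -/
theorem IsLocalModel.of_hasClass {x : X} (hx : x ∈ U) {a : E x} {q : L.Reduced x}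
    (h : L.HasClass a q) : a = σ x (C.π x a) + C.ι x (holForm x (hform x₀ x (κ x q).2)) ∧
      hvec x₀ x (holPart x (C.π x a)) = (κ x q).1 := by
  obtain ⟨φ, hφ⟩ := hL.split.exists_hform hL.subset hL.mem hx h.1
  obtain ⟨q', hq', hκ⟩ := hL.hasClass x hx (C.π x a) φ
  rw [← hφ] at hq'
  rw [h.eq hq', hκ]
  exact ⟨hφ, rfl⟩

theorem IsLocalModel.pairing_eq {x : X} (hx : x ∈ U) {a b : E x} {p q : L.Reduced x}
    (ha : L.HasClass a p) (hb : L.HasClass b q) :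
    C.pairing x a b = (1 / 2) * ((κ x p).2 (κ x q).1 + (κ x q).2 (κ x p).1) := by
  obtain ⟨h1, h2⟩ := hL.of_hasClass hx ha
  obtain ⟨h3, h4⟩ := hL.of_hasClass hx hb
  rw [h1, h3, hL.split.pairing x hx, ev_holForm, ev_holForm, hform_apply, hform_apply, h2, h4]

theorem IsLocalModel.isLocalRep [FiniteDimensional ℂ V] (hW : W ≤ U) {s : ∀ x, L.Reduced x}
    {s' : ∀ x, E x} (h : L.IsLift W s s') :
    IsLocalRep C σ x₀ W s' (fun x => C.π x (s' x)) (rep x₀ κ s) := by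
  have hY := C.π_smooth W s' h.1
  have heq : ∀ x ∈ W, s' x = σ x (C.π x (s' x)) + C.ι x (repForm x₀ (rep x₀ κ s) x) := by
    intro x hx
    rw [repForm, hL.rep_apply κ s (hW hx)]
    exact (hL.of_hasClass (hW hx) (h.2 x hx)).1
  have hfst : ∀ x ∈ W, hvec x₀ x (holPart x (C.π x (s' x))) =
      (rep x₀ κ s (extChartAt 𝓘(ℝ, V) x₀ x)).1 := by
    intro x hx
    rw [hL.rep_apply κ s (hW hx)]
    exact (hL.of_hasClass (hW hx) (h.2 x hx)).2
  refine ⟨hY, ?_, heq, hfst⟩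
  have hWs : (W : Set X) ⊆ (extChartAt 𝓘(ℝ, V) x₀).source := fun x hx => hL.subset (hW hx)
  refine ContDiffOn.prodMk (f := fun y => (rep x₀ κ s y).1) (g := fun y => (rep x₀ κ s y).2) ?_ ?_
  · have h1 := (smoothCField_iff hWs _).1 hY
    refine (h1.1.add (h1.2.const_smul Complex.I)).congr fun y hy => ?_
    have h2 := hfst _ hy.2
    rw [(extChartAt 𝓘(ℝ, V) x₀).right_inv hy.1] at h2
    rw [← h2]
    exact fieldInChart_holPart x₀ (fun x => C.π x (s' x)) hy.1
  · have h1 : SmoothForm ℝ W (repForm x₀ (rep x₀ κ s)) := by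
      refine hL.split.smoothForm hW (C.isVectorBundle.congr (C.isVectorBundle.sub h.1
        (hL.split.smooth W _ hW hY)) fun x hx => ?_)
      nth_rewrite 1 [heq x hx]
      abel
    refine contDiffOn_clm_of_apply fun v => ?_
    exact ((h1 x₀).clm_apply contDiffOn_const).congr fun y hy =>
      (formInChart_repForm x₀ _ hy.1 v).symm

theorem IsLocalModel.exists_isLocalRep (hW : W ≤ U) {F : V → ModelFibre V}
    (hF : ContDiffOn ℝ ∞ F (chartDom ℝ x₀ W)) : ∃ s Y, IsLocalRep C σ x₀ W s Y F := by
  have hWs : (W : Set X) ⊆ (extChartAt 𝓘(ℝ, V) x₀).source := fun x hx => hL.subset (hW hx)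
  -- The lift has vanishing imaginary part; its holomorphic part is then its real part.
  let Y : ∀ x : X, CT V x := fun x => mkCT x (fieldOfChart ℝ x₀ (fun y => (F y).1) x)
    (fieldOfChart ℝ x₀ (fun _ => 0) x)
  have hY : SmoothCField W Y := smoothCField_mkCT hWs hF.fst contDiffOn_const
  have hY' : ∀ x ∈ W, hvec x₀ x (holPart x (Y x)) = (F (extChartAt 𝓘(ℝ, V) x₀ x)).1 :=
    fun x hx => hvec_holPart_mkCT (hWs hx) (F (extChartAt 𝓘(ℝ, V) x₀ x)).1
  exact ⟨fun x => σ x (Y x) + C.ι x (holForm x (hform x₀ x (F (extChartAt 𝓘(ℝ, V) x₀ x)).2)), Y,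
    hY, hF, fun x _ => rfl, hY'⟩

theorem IsLocalModel.hasClass_of_rep (hW : W ≤ U) {s : ∀ x, E x} {Y : ∀ x : X, CT V x}
    {F : V → ModelFibre V} (h : IsLocalRep C σ x₀ W s Y F) {x : X} (hx : x ∈ W) :
    ∃ q, L.HasClass (s x) q ∧ κ x q = F (extChartAt 𝓘(ℝ, V) x₀ x) := by
  obtain ⟨q, hq, hκ⟩ := hL.hasClass x (hW hx) (Y x) (F (extChartAt 𝓘(ℝ, V) x₀ x)).2
  rw [← h.eq x hx] at hq
  rw [h.fst x hx] at hκ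
  exact ⟨q, hq, hκ⟩

theorem IsLocalModel.isLift [FiniteDimensional ℂ V] (hW : W ≤ U) {s' : ∀ x, E x}
    {Y : ∀ x : X, CT V x} {F : V → ModelFibre V} (h : IsLocalRep C σ x₀ W s' Y F)
    {s : ∀ x, L.Reduced x} (hs : ∀ x ∈ W, κ x (s x) = F (extChartAt 𝓘(ℝ, V) x₀ x)) :
    L.IsLift W s s' := by
  have hWs : (W : Set X) ⊆ (extChartAt 𝓘(ℝ, V) x₀).source := fun x hx => hL.subset (hW hx)
  refine ⟨C.isVectorBundle.congr (hL.split.smooth_add hW h.field (smoothForm_repForm hWs h.smooth))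
    fun x hx => (h.eq x hx).symm, fun x hx => ?_⟩
  obtain ⟨q, hq, hκ⟩ := hL.hasClass_of_rep hW h hx
  rwa [(hL.bijective x (hW hx)).1 ((hs x hx).trans hκ.symm)]

theorem IsLocalModel.reducedSmooth_iff [FiniteDimensional ℂ V] (hW : W ≤ U)
    (s : ∀ x, L.Reduced x) :
    L.ReducedSmooth W s ↔ ContDiffOn ℝ ∞ (rep x₀ κ s) (chartDom ℝ x₀ W) := by
  constructor
  · intro h y hy
    obtain ⟨W', hyW', hW', s', hs'⟩ := h _ hy.2
    have h1 := (hL.isLocalRep (hW'.trans hW) hs').smooth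
    exact (h1.contDiffAt ((isOpen_chartDom x₀ W').mem_nhds ⟨hy.1, hyW'⟩)).contDiffWithinAt
  · intro h x hx
    obtain ⟨s', Y, hs'⟩ := hL.exists_isLocalRep hW h
    exact ⟨W, hx, le_rfl, s', hL.isLift hW hs' fun x hx => (hL.rep_apply κ s (hW hx)).symm⟩

/-- The bracket of two sections in coordinates. -/
theorem IsLocalModel.bracket [FiniteDimensional ℂ V] (hW : W ≤ U) {s t : ∀ x, E x}
    {Y Z : ∀ x : X, CT V x} {F G : V → ModelFibre V} (hs : IsLocalRep C σ x₀ W s Y F)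
    (ht : IsLocalRep C σ x₀ W t Z G) {y : V} (hy : y ∈ chartDom ℝ x₀ W) {p : ModelFibre V}
    (h1 : p.1 = (fderiv ℝ G y (reF x₀ Y y)).1 + Complex.I • (fderiv ℝ G y (imF x₀ Y y)).1 -
      ((fderiv ℝ F y (reF x₀ Z y)).1 + Complex.I • (fderiv ℝ F y (imF x₀ Z y)).1))
    (h2 : ∀ v, p.2 v = (fderiv ℝ G y (reF x₀ Y y)).2 v +
      Complex.I * (fderiv ℝ G y (imF x₀ Y y)).2 v + (G y).2 (fderiv ℝ F y v).1 -
      ((fderiv ℝ F y (reF x₀ Z y)).2 v + Complex.I * (fderiv ℝ F y (imF x₀ Z y)).2 v) +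
      (fderiv ℝ F y v).2 (G y).1) :
    ∃ q, L.HasClass (C.bracket s t ((extChartAt 𝓘(ℝ, V) x₀).symm y)) q ∧
      κ ((extChartAt 𝓘(ℝ, V) x₀).symm y) q = p := by
  have : CompleteSpace V := FiniteDimensional.complete ℂ V
  have hWs : (W : Set X) ⊆ (extChartAt 𝓘(ℝ, V) x₀).source := fun x hx => hL.subset (hW hx)
  have hsF := smoothForm_repForm hWs hs.smooth
  have htG := smoothForm_repForm hWs ht.smooth
  have hO := isOpen_chartDom (𝕜 := ℝ) (V := V) x₀ W
  have hxs := hWs hy.2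
  have hyx := (extChartAt 𝓘(ℝ, V) x₀).right_inv hy.1
  have hdiff : ∀ {F : V → ModelFibre V}, ContDiffOn ℝ ∞ F (chartDom ℝ x₀ W) →
      DifferentiableAt ℝ F y := fun h => (h.contDiffAt (hO.mem_nhds hy)).differentiableAt (by simp)
  have hfd : ∀ {F : V → ModelFibre V}, ContDiffOn ℝ ∞ F (chartDom ℝ x₀ W) → ∀ u v,
      fderiv ℝ (formInChart ℝ x₀ (repForm x₀ F)) y u v = (fderiv ℝ F y u).2 v := by
    intro F hF u v
    have hd : DifferentiableAt ℝ (formInChart ℝ x₀ (repForm x₀ F)) y :=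
      ((smoothForm_repForm hWs hF).contDiffAt hy).differentiableAt (by simp)
    have e1 := fderiv_form_apply hd (differentiableAt_const v) u
    have e2 : (fun y => formInChart ℝ x₀ (repForm x₀ F) y v) =ᶠ[nhds y] fun y => (F y).2 v := by
      filter_upwards [hO.mem_nhds hy] with z hz using formInChart_repForm x₀ F hz.1 v
    have e3 : HasFDerivAt (fun y => (F y).2 v) (((ContinuousLinearMap.apply ℂ ℂ v).restrictScalars
        ℝ).comp ((ContinuousLinearMap.snd ℝ V (V →L[ℂ] ℂ)).comp (fderiv ℝ F y))) y :=
      ((ContinuousLinearMap.apply ℂ ℂ v).restrictScalars ℝ).hasFDerivAt.comp y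
        ((hdiff hF).hasFDerivAt.snd)
    rw [e2.fderiv_eq, e3.fderiv] at e1
    simpa using e1.symm
  -- `F` records only the combination `reF + i imF` of the anchor. Complex linearity of the form
  -- components ensures that the term `η(∂ᵥ Y)` sees no more than that.
  have hfield : ∀ {s : ∀ x, E x} {Y : ∀ x : X, CT V x} {F : V → ModelFibre V},
      IsLocalRep C σ x₀ W s Y F → reF x₀ Y y + Complex.I • imF x₀ Y y = (F y).1 ∧ ∀ v,
        fderiv ℝ (reF x₀ Y) y v + Complex.I • fderiv ℝ (imF x₀ Y) y v = (fderiv ℝ F y v).1 := by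
    intro s Y F h
    have e1 : ∀ z ∈ chartDom ℝ x₀ W, reF x₀ Y z + Complex.I • imF x₀ Y z = (F z).1 := by
      intro z hz
      have e := h.fst _ hz.2
      rw [(extChartAt 𝓘(ℝ, V) x₀).right_inv hz.1] at e
      rw [← e, ← fieldInChart_holPart x₀ Y hz.1]
      rfl
    refine ⟨e1 y hy, fun v => ?_⟩
    have hr : DifferentiableAt ℝ (reF x₀ Y) y := (h.field.reF hy).differentiableAt (by simp)
    have hi : DifferentiableAt ℝ (imF x₀ Y) y := (h.field.imF hy).differentiableAt (by simp)
    have e2 : (fun y => (F y).1) =ᶠ[nhds y] fun z => reF x₀ Y z + Complex.I • imF x₀ Y z := by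
      filter_upwards [hO.mem_nhds hy] with z hz using (e1 z hz).symm
    have e3 := (hr.hasFDerivAt.add (hi.hasFDerivAt.const_smul Complex.I)).congr_of_eventuallyEq e2
    have e4 := (hdiff h.smooth).hasFDerivAt.fst.unique e3
    exact (DFunLike.congr_fun e4 v).symm
  obtain ⟨fY, dY⟩ := hfield hs
  obtain ⟨fZ, dZ⟩ := hfield ht
  have hbr := hL.split.bracket_eq hW hs.field hsF ht.field htG hs.eq ht.eq hy.2
  have hcf : cCourantForm Y (repForm x₀ F) Z (repForm x₀ G) ((extChartAt 𝓘(ℝ, V) x₀).symm y) =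
      holForm _ (hform x₀ _ p.2) := by
    refine eq_holForm_hform hxs fun v => ?_
    rw [hyx]
    refine (cCourantForm_eq hsF htG hs.field Z hy v).trans ?_
    unfold extV
    simp only [hfd hs.smooth, hfd ht.smooth, formInChart_repForm x₀ _ hy.1]
    rw [h2, ← dY, ← fZ]
    simp only [map_add, map_smul, smul_eq_mul]
    ring
  have hfst : hvec x₀ _ (holPart _ (cLie Y Z ((extChartAt 𝓘(ℝ, V) x₀).symm y))) = p.1 := by
    refine (fieldInChart_holPart x₀ (cLie Y Z) hy.1).trans ?_
    rw [reF_cLie hs.field ht.field hy, imF_cLie hs.field ht.field hy, h1, ← dY, ← dY, ← dZ, ← dZ]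
    simp only [smul_add, smul_sub, smul_smul, Complex.I_mul_I, neg_smul, one_smul]
    abel
  obtain ⟨q, hq, hκ⟩ := hL.hasClass _ (hW hy.2) (cLie Y Z ((extChartAt 𝓘(ℝ, V) x₀).symm y)) p.2
  rw [← hcf, ← hbr] at hq
  exact ⟨q, hq, by rw [hκ, hfst]⟩

/-- The operator `∂̄` in coordinates. -/
theorem IsLocalModel.bracket_lift [FiniteDimensional ℂ V] (hW : W ≤ U) {Z' s' : ∀ x, E x}
    {s : ∀ x, L.Reduced x} (hZ : C.IsSmooth W Z') (hZ' : ∀ x ∈ W, Z' x ∈ L.D x)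
    (hs : L.IsLift W s s') {x : X} (hx : x ∈ W) :
    ∃ q, L.HasClass (C.bracket Z' s' x) q ∧
      κ x q = dbar (reCoord x₀ x (C.π x (Z' x))) (rep x₀ κ s) (extChartAt 𝓘(ℝ, V) x₀ x) := by
  have hxs := hL.subset (hW hx)
  -- A section of `D` has zero coordinates, so only derivatives along its anchor remain in the
  -- bracket formula.
  have h1 : IsLocalRep C σ x₀ W Z' (fun x => C.π x (Z' x)) fun _ => 0 := by
    refine ⟨C.π_smooth W Z' hZ, contDiffOn_const, fun x hx => ?_, fun x hx => ?_⟩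
    · have h : C.ι x (holForm x (hform x₀ x (0 : ModelFibre V).2)) = 0 := by
        rw [Prod.snd_zero, map_zero, holForm_zero, map_zero]
      rw [h, add_zero]
      exact hL.split.eq_of_mem hL.mem (hW hx) (hZ' x hx)
    · rw [(mem_T01_iff x _).1 (L.π_mem (hZ' x hx)), map_zero]
      rfl
  have hy := mem_chartDom (𝕜 := ℝ) (V := V) hxs hx
  have hr := (hL.subset (hW hx) : x ∈ (extChartAt 𝓘(ℝ, V) x₀).source)
  have hxx := (extChartAt 𝓘(ℝ, V) x₀).left_inv hr
  -- For an anchor of type `(0,1)` the imaginary part is `i` times the real part, so differentiation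
  -- along it is `dbar`.
  have him : imF x₀ (fun x => C.π x (Z' x)) (extChartAt 𝓘(ℝ, V) x₀ x) =
      Complex.I • reF x₀ (fun x => C.π x (Z' x)) (extChartAt 𝓘(ℝ, V) x₀ x) := by
    have h := fieldInChart_holPart x₀ (fun x => C.π x (Z' x)) hy.1
    have h0 := h1.fst _ hy.2
    have h3 := h.symm.trans h0
    have h4 := congrArg (fun w => Complex.I • w) h3
    simp only [smul_add, smul_smul, Complex.I_mul_I, neg_smul, one_smul, Prod.fst_zero,
      smul_zero] at h4
    exact (eq_of_sub_eq_zero ((sub_eq_add_neg _ _).trans h4)).symm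
  have h5 := hL.bracket hW h1 (hL.isLocalRep hW hs) hy
    (p := dbar (reF x₀ (fun x => C.π x (Z' x)) (extChartAt 𝓘(ℝ, V) x₀ x)) (rep x₀ κ s)
      (extChartAt 𝓘(ℝ, V) x₀ x)) (by rw [him]; simp [dbar]) (by intro v; rw [him]; simp [dbar])
  rw [reF_apply, hxx] at h5
  exact h5

end LocalRep

/-! ## Holomorphic functions -/

section Holomorphic

universe u

variable {V : Type u} [NormedAddCommGroup V] [NormedSpace ℂ V]

section

variable {F : Type*} [NormedAddCommGroup F] [NormedSpace ℂ F]

theorem dbar_vec_add (u v : V) (f : V → F) (z : V) :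
    dbar (u + v) f z = dbar u f z + dbar v f z := by
  simp only [dbar, smul_add, map_add]
  abel

/-- `dbar v` differentiates along the `(0,1)`-vector of `v`, which depends conjugate linearly on
`v`. -/
theorem dbar_vec_smul (c : ℂ) (v : V) (f : V → F) (z : V) :
    dbar (c • v) f z = star c • dbar v f z := by
  have h : ∀ w : V, c • w = c.re • w + c.im • (Complex.I • w) := by
    intro w
    conv_lhs => rw [← Complex.re_add_im c, add_smul, ← smul_smul]
    simp
  have hs : star c = c.re - c.im * Complex.I := by
    apply Complex.ext <;> simp
  simp only [dbar]
  rw [smul_comm Complex.I c v, h v, h (Complex.I • v), hs]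
  simp only [map_add, map_smul, smul_smul, Complex.I_mul_I, neg_smul, one_smul, map_neg]
  generalize fderiv ℝ f z v = p
  generalize fderiv ℝ f z (Complex.I • v) = q
  simp only [← Complex.coe_smul]
  match_scalars
  · ring
  · linear_combination (c.im : ℂ) * Complex.I_sq

theorem dbar_clm_comp {G : Type*} [NormedAddCommGroup G] [NormedSpace ℂ G] (T : F →L[ℂ] G)
    {f : V → F} {z : V} (hf : DifferentiableAt ℝ f z) (v : V) :
    dbar v (fun y => T (f y)) z = T (dbar v f z) := by
  have h : HasFDerivAt (fun y => T (f y)) ((T.restrictScalars ℝ).comp (fderiv ℝ f z)) z :=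
    (T.restrictScalars ℝ).hasFDerivAt.comp z hf.hasFDerivAt
  rw [dbar, dbar, h.fderiv, T.map_add, T.map_smul]
  rfl

theorem differentiableAt_of_dbar {f : V → F} {z : V} (hf : DifferentiableAt ℝ f z)
    (h : ∀ v, dbar v f z = 0) : DifferentiableAt ℂ f z := by
  have hI : ∀ v, fderiv ℝ f z (Complex.I • v) = Complex.I • fderiv ℝ f z v := by
    intro v
    have h1 : fderiv ℝ f z v + Complex.I • fderiv ℝ f z (Complex.I • v) = 0 := h v
    rw [eq_neg_of_add_eq_zero_left h1, smul_neg, smul_smul, Complex.I_mul_I]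
    simp
  have hc : ∀ (c : ℂ) v, fderiv ℝ f z (c • v) = c • fderiv ℝ f z v := by
    intro c v
    rw [← Complex.re_add_im c, add_smul, add_smul, ← smul_smul, ← smul_smul, map_add, Complex.coe_smul,
      Complex.coe_smul, map_smul, map_smul, hI, Complex.coe_smul, Complex.coe_smul]
  let g : V →L[ℂ] F :=
    { toFun := fderiv ℝ f z
      map_add' := map_add _
      map_smul' := hc
      cont := (fderiv ℝ f z).continuous }
  exact (hasFDerivAt_of_restrictScalars (f' := g) ℝ hf.hasFDerivAt rfl).differentiableAt

theorem dbar_of_differentiableAt {f : V → F} {z : V} (hf : DifferentiableAt ℂ f z) (v : V) :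
    dbar v f z = 0 := by
  rw [dbar, hf.fderiv_restrictScalars ℝ]
  change fderiv ℂ f z v + Complex.I • fderiv ℂ f z (Complex.I • v) = 0
  rw [map_smul, smul_smul, Complex.I_mul_I]
  simp

end

variable [FiniteDimensional ℂ V]

/-- The Cauchy–Riemann equations give a complex derivative, which is again smooth and annihilated by
`dbar`, since `dbar` commutes with derivatives. The induction applies to it, so the codomain `F` is
quantified inside and shares the universe of `V`. -/
theorem contDiffOn_complex_nat {O : Set V} (hO : IsOpen O) (n : ℕ) :
    ∀ {F : Type u} [NormedAddCommGroup F] [NormedSpace ℂ F] {f : V → F},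
      ContDiffOn ℝ ∞ f O → (∀ z ∈ O, ∀ v, dbar v f z = 0) → ContDiffOn ℂ n f O := by
  induction n with
  | zero =>
    intro F _ _ f hf _
    exact contDiffOn_zero.2 hf.continuousOn
  | succ n ih =>
    intro F _ _ f hf hd
    have hat : ∀ z ∈ O, ContDiffAt ℝ ∞ f z := fun z hz => hf.contDiffAt (hO.mem_nhds hz)
    have hdiff : ∀ z ∈ O, DifferentiableAt ℂ f z := fun z hz =>
      differentiableAt_of_dbar ((hat z hz).differentiableAt (by simp)) (hd z hz)
    have heq : ∀ u, ∀ z ∈ O, fderiv ℂ f z u = fderiv ℝ f z u := fun u z hz => by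
      rw [(hdiff z hz).fderiv_restrictScalars ℝ]
      rfl
    have hs : ContDiffOn ℝ ∞ (fderiv ℂ f) O := contDiffOn_clm_of_apply fun u =>
      ((hf.fderiv_of_isOpen hO (m := ∞) (by simp)).clm_apply contDiffOn_const).congr (heq u)
    push_cast
    rw [contDiffOn_succ_iff_fderiv_of_isOpen hO]
    refine ⟨fun z hz => (hdiff z hz).differentiableWithinAt, by simp, ih hs fun z hz v => ?_⟩
    have hsz : DifferentiableAt ℝ (fderiv ℂ f) z :=
      (hs.contDiffAt (hO.mem_nhds hz)).differentiableAt (by simp)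
    ext u
    have h1 := dbar_clm_comp (ContinuousLinearMap.apply ℂ F u) hsz v
    have h2 : (fun y => ContinuousLinearMap.apply ℂ F u (fderiv ℂ f y)) =ᶠ[nhds z]
        fun y => fderiv ℝ f y u := by
      filter_upwards [hO.mem_nhds hz] with y hy using heq u y hy
    have h3 : fderiv ℝ (dbar v f) z u = 0 := by
      have : dbar v f =ᶠ[nhds z] fun _ => 0 := by
        filter_upwards [hO.mem_nhds hz] with y hy using hd y hy v
      rw [this.fderiv_eq]
      simp
    have h4 : DifferentiableAt ℝ (fderiv ℝ f) z :=
      ((hat z hz).fderiv_right (m := ∞) (by simp)).differentiableAt (by simp)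
    have h5 : ∀ w, fderiv ℝ (fun y => fderiv ℝ f y u) z w = fderiv ℝ (fderiv ℝ f) z w u := by
      intro w
      have : HasFDerivAt (fun y => fderiv ℝ f y u) ((fderiv ℝ (fderiv ℝ f) z).flip u) z := by
        simpa using h4.hasFDerivAt.clm_apply (hasFDerivAt_const u z)
      rw [this.fderiv]
      rfl
    rw [fderiv_dbar (hat z hz), second_fderiv_symm (hat z hz) u v,
      second_fderiv_symm (hat z hz) u (Complex.I • v), ← h5, ← h5] at h3
    exact h1.symm.trans ((dbar_congr h2 v).trans h3)

/-- A smooth function annihilated by `∂̄` is holomorphic. -/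
theorem contDiffOn_complex_iff {F : Type u} [NormedAddCommGroup F] [NormedSpace ℂ F] {O : Set V}
    (hO : IsOpen O) (f : V → F) :
    ContDiffOn ℂ ∞ f O ↔ ContDiffOn ℝ ∞ f O ∧ ∀ z ∈ O, ∀ v, dbar v f z = 0 := by
  refine ⟨fun h => ⟨h.restrict_scalars ℝ, fun z hz v => dbar_of_differentiableAt
    ((h.contDiffAt (hO.mem_nhds hz)).differentiableAt (by simp)) v⟩, fun h => ?_⟩
  exact contDiffOn_infty.2 fun n => contDiffOn_complex_nat hO n h.1 h.2

end Holomorphic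

/-! ## Vector bundles given by coordinates -/

/-- The inverse images of a basis of `M` form a frame in which the coefficients are the coordinates.
It serves both the smooth and the holomorphic structure. -/
theorem isVectorBundle_of_coord {X : Type*} [TopologicalSpace X] {Fn : Opens X → (X → ℂ) → Prop}
    {F : X → Type*} [∀ x, AddCommGroup (F x)] [∀ x, Module ℂ (F x)]
    {Sec : Opens X → (∀ x, F x) → Prop}
    {M : Type*} [AddCommGroup M] [Module ℂ M] {r : ℕ} (b : Module.Basis (Fin r) ℂ M)
    (restrict : ∀ (U W : Opens X) (s : ∀ x, F x), W ≤ U → Sec U s → Sec W s)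
    (glue : ∀ (U : Opens X) (s : ∀ x, F x),
      (∀ x ∈ U, ∃ W : Opens X, x ∈ W ∧ W ≤ U ∧ Sec W s) → Sec U s)
    (congr : ∀ (U : Opens X) (f g : X → ℂ), (∀ x ∈ U, f x = g x) → Fn U f → Fn U g)
    (coord : ∀ x₀ : X, ∃ U : Opens X, x₀ ∈ U ∧ ∃ κ : ∀ x, F x →ₗ[ℂ] M,
      (∀ x ∈ U, Function.Bijective (κ x)) ∧ ∀ (W : Opens X) (s : ∀ x, F x), W ≤ U →
        (Sec W s ↔ ∀ i, Fn W fun x => b.coord i (κ x (s x)))) : IsVectorBundle Fn F Sec where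
  restrict := restrict
  glue := glue
  frame x₀ := by
    obtain ⟨U, hx₀, κ, hκ, hs⟩ := coord x₀
    have key : ∀ i x, ∃ e : F x, x ∈ U → κ x e = b i := by
      intro i x
      by_cases hx : x ∈ U
      · obtain ⟨e, he⟩ := (hκ x hx).2 (b i)
        exact ⟨e, fun _ => he⟩
      · exact ⟨0, fun h => absurd h hx⟩
    choose e he using key
    have hsum : ∀ x ∈ U, ∀ c : Fin r → ℂ, κ x (∑ i, c i • e i x) = ∑ i, c i • b i := by
      intro x hx c
      simp only [map_sum, map_smul, he _ x hx]
    have hrepr : ∀ x ∈ U, ∀ q : F x, q = ∑ i, b.coord i (κ x q) • e i x := fun x hx q =>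
      (hκ x hx).1 (by rw [hsum x hx]; exact (b.sum_repr _).symm)
    refine ⟨U, hx₀, r, e, fun x hx => ⟨?_, ?_⟩, fun W s hW => ⟨fun h => ?_, ?_⟩⟩
    · refine Fintype.linearIndependent_iff.2 fun c hc i => ?_
      have h1 := hsum x hx c
      rw [hc, map_zero] at h1
      exact Fintype.linearIndependent_iff.1 b.linearIndependent c h1.symm i
    · refine eq_top_iff.2 fun q _ => ?_
      rw [hrepr x hx q]
      exact Submodule.sum_mem _ fun i _ => Submodule.smul_mem _ _ (Submodule.subset_span ⟨i, rfl⟩)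
    · exact ⟨fun i x => b.coord i (κ x (s x)), (hs W s hW).1 h, fun x hx => hrepr x (hW hx) _⟩
    · rintro ⟨c, hc, hc'⟩
      refine (hs W s hW).2 fun i => congr W (c i) _ (fun x hx => ?_) (hc i)
      rw [hc' x hx, hsum x (hW hx)]
      simp [Finsupp.single_apply]

section DbarField

variable {V : Type*} [NormedAddCommGroup V] [NormedSpace ℂ V]

theorem contDiffAt_dbar_field {F : Type*} [NormedAddCommGroup F] [NormedSpace ℂ F]
    {f : V → F} {w : V → V} {y : V} (hf : ContDiffAt ℝ ∞ f y) (hw : ContDiffAt ℝ ∞ w y) :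
    ContDiffAt ℝ ∞ (fun y => dbar (w y) f y) y := by
  have h : ContDiffAt ℝ ∞ (fderiv ℝ f) y := hf.fderiv_right (by simp)
  exact (h.clm_apply hw).add ((h.clm_apply (hw.const_smul Complex.I)).const_smul Complex.I)

/-- The product rule for a varying direction. The factor `i` from `dbar v` moves into the direction
as `-i`, by conjugate linearity. -/
theorem dbar_dbar_field {F : Type*} [NormedAddCommGroup F] [NormedSpace ℂ F]
    {f : V → F} {w : V → V} {y : V} (hf : ContDiffAt ℝ ∞ f y) (hw : DifferentiableAt ℝ w y)
    (v : V) : dbar v (fun y => dbar (w y) f y) y =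
      dbar v (dbar (w y) f) y + dbar (fderiv ℝ w y v - Complex.I • fderiv ℝ w y (Complex.I • v)) f y
    := by
  have h : DifferentiableAt ℝ (fderiv ℝ f) y :=
    (hf.fderiv_right (m := ∞) (by simp)).differentiableAt (by simp)
  have h1 : ∀ u, fderiv ℝ (fun y => dbar (w y) f y) y u =
      fderiv ℝ (dbar (w y) f) y u + dbar (fderiv ℝ w y u) f y := by
    intro u
    have e := (h.hasFDerivAt.clm_apply hw.hasFDerivAt).add
      ((h.hasFDerivAt.clm_apply (hw.hasFDerivAt.const_smul Complex.I)).const_smul Complex.I)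
    have e' : HasFDerivAt (fun y => dbar (w y) f y) _ y := e
    rw [e'.fderiv, fderiv_dbar hf]
    simp [dbar]
    abel
  have h2 : dbar v (dbar (w y) f) y = fderiv ℝ (dbar (w y) f) y v +
      Complex.I • fderiv ℝ (dbar (w y) f) y (Complex.I • v) := rfl
  rw [dbar, h1, h1, sub_eq_add_neg, ← neg_smul, dbar_vec_add, dbar_vec_smul, h2]
  simp only [smul_add, star_neg, Complex.star_def, Complex.conj_I, neg_neg]
  abel

end DbarField

/-! ### The reduction as a smooth bundle with its `∂̄`-operator. -/

section Dolbeault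

variable {V : Type*} [NormedAddCommGroup V] [NormedSpace ℂ V] [FiniteDimensional ℂ V]
  {X : Type*} [TopologicalSpace X] [ChartedSpace V X] [IsManifold 𝓘(ℂ, V) ∞ X]
  {E : X → Type*} [∀ x, AddCommGroup (E x)] [∀ x, Module ℂ (E x)]
  {C : ComplexCourantAlgebroid V E} (L : Lifting C)

namespace Lifting

theorem exists_localModel (x₀ : X) : ∃ U : Opens X, x₀ ∈ U ∧ ∃ κ σ, IsLocalModel L x₀ U σ κ := by
  obtain ⟨U, hx₀, hU, σ, hσ, hD⟩ := L.exists_adapted x₀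
  obtain ⟨κ, hκ⟩ := hσ.exists_coord hU hD
  exact ⟨U, hx₀, κ, σ, hκ⟩

/-- The domain of a local model at `x₀`. -/
def modelDom (x₀ : X) : Opens X := (L.exists_localModel x₀).choose

theorem mem_modelDom (x₀ : X) : x₀ ∈ L.modelDom x₀ := (L.exists_localModel x₀).choose_spec.1

/-- The coordinates of a local model at `x₀`. -/
def modelCoord (x₀ : X) : ∀ x, L.Reduced x →ₗ[ℂ] ModelFibre V :=
  (L.exists_localModel x₀).choose_spec.2.choose

theorem exists_isLocalModel (x₀ : X) :
    ∃ σ, IsLocalModel L x₀ (L.modelDom x₀) σ (L.modelCoord x₀) :=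
  (L.exists_localModel x₀).choose_spec.2.choose_spec

/-- The coordinates at `x` of the local model at `x`. -/
def coordEquiv (x : X) : L.Reduced x ≃ₗ[ℂ] ModelFibre V :=
  LinearEquiv.ofBijective (L.modelCoord x x)
    ((L.exists_isLocalModel x).choose_spec.bijective x (L.mem_modelDom x))

theorem coordEquiv_apply (x : X) (q : L.Reduced x) : L.coordEquiv x q = L.modelCoord x x q := rfl

/-- The operator `∂̄` of the reduction. -/
def dbarOp (s : ∀ x, L.Reduced x) (x : X) : T01 V x →ₗ[ℂ] L.Reduced x where
  toFun z := (L.coordEquiv x).symm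
    (dbar (reCoord x x (z : CT V x)) (rep x (L.modelCoord x) s) (extChartAt 𝓘(ℝ, V) x x))
  map_add' z w := by
    rw [Submodule.coe_add, map_add, dbar_vec_add, map_add]
  map_smul' c z := by
    rw [Submodule.coe_smul, reCoord_smul (mem_extChartAt_source x) z.2, dbar_vec_smul, star_star,
      map_smul, RingHom.id_apply]

theorem coord_dbarOp_self (s : ∀ x, L.Reduced x) (x : X) (z : T01 V x) :
    L.modelCoord x x (L.dbarOp s x z) =
      dbar (reCoord x x (z : CT V x)) (rep x (L.modelCoord x) s) (extChartAt 𝓘(ℝ, V) x x) :=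
  (L.coordEquiv x).apply_symm_apply _

variable {L}

omit [FiniteDimensional ℂ V] in
theorem IsLift.mono {U W : Opens X} (hW : W ≤ U) {s : ∀ x, L.Reduced x} {s' : ∀ x, E x}
    (h : L.IsLift U s s') : L.IsLift W s s' :=
  ⟨C.isVectorBundle.restrict _ _ _ hW h.1, fun x hx => h.2 x (hW hx)⟩

omit [FiniteDimensional ℂ V] in
theorem ReducedSmooth.mono {U W : Opens X} (hW : W ≤ U) {s : ∀ x, L.Reduced x}
    (h : L.ReducedSmooth U s) : L.ReducedSmooth W s := by
  intro x hx
  obtain ⟨W', hx', -, s', hs'⟩ := h x (hW hx)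
  exact ⟨W ⊓ W', ⟨hx, hx'⟩, inf_le_left, s', hs'.mono inf_le_right⟩

omit [FiniteDimensional ℂ V] in
theorem reducedSmooth_of_local {U : Opens X} {s : ∀ x, L.Reduced x}
    (h : ∀ x ∈ U, ∃ W : Opens X, x ∈ W ∧ W ≤ U ∧ L.ReducedSmooth W s) : L.ReducedSmooth U s := by
  intro x hx
  obtain ⟨W, hxW, hW, h⟩ := h x hx
  obtain ⟨W', hx', hW', s', hs'⟩ := h x hxW
  exact ⟨W', hx', hW'.trans hW, s', hs'⟩

/-- The operator `∂̄` is induced by the bracket. -/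
theorem hasClass_dbarOp {U : Opens X} {Z' s' : ∀ x, E x} {s : ∀ x, L.Reduced x}
    (hZ : C.IsSmooth U Z') (hZ' : ∀ x ∈ U, Z' x ∈ L.D x) (hs : L.IsLift U s s') {x : X}
    (hx : x ∈ U) (z : T01 V x) (hz : C.π x (Z' x) = z) :
    L.HasClass (C.bracket Z' s' x) (L.dbarOp s x z) := by
  obtain ⟨σ, hσ⟩ := L.exists_isLocalModel x
  set W := U ⊓ L.modelDom x
  have hxW : x ∈ W := ⟨hx, L.mem_modelDom x⟩
  obtain ⟨q, hq, hκ⟩ := hσ.bracket_lift (W := W) inf_le_right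
    (C.isVectorBundle.restrict _ _ _ inf_le_left hZ) (fun x hx => hZ' x hx.1)
    (hs.mono inf_le_left) hxW
  rw [hz, ← coord_dbarOp_self] at hκ
  rwa [← (hσ.bijective x (L.mem_modelDom x)).1 hκ]

end Lifting

namespace IsLocalModel

variable {L} {x₀ : X} {U W : Opens X} {σ : ∀ x, CT V x →ₗ[ℂ] E x}
  {κ : ∀ x, L.Reduced x →ₗ[ℂ] ModelFibre V} (hL : IsLocalModel L x₀ U σ κ)

include hL

/-- `dbarOp` is defined at each point by the model chosen there, but it is the class of a bracket in
`E`. Computing that bracket in another model gives the same formula. -/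
theorem coord_dbarOp (hW : W ≤ U) {s : ∀ x, L.Reduced x} (hs : L.ReducedSmooth W s) {x : X}
    (hx : x ∈ W) (z : T01 V x) : κ x (L.dbarOp s x z) =
      dbar (reCoord x₀ x (z : CT V x)) (rep x₀ κ s) (extChartAt 𝓘(ℝ, V) x₀ x) := by
  obtain ⟨W', hx', hW', s', hs'⟩ := hs x hx
  -- The vector `z` extends to a constant `(0,1)`-field, whose image under the splitting is a
  -- section of `D`.
  set A : ∀ x : X, CT V x := antiField x₀ (reCoord x₀ x (z : CT V x)) with hA
  have hAx : A x = z := antiField_reCoord (hL.subset (hW hx)) z.2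
  have hAs : SmoothCField W' A :=
    smoothCField_mkCT (fun x hx => hL.subset (hW (hW' hx))) contDiffOn_const contDiffOn_const
  have hAD : ∀ x ∈ W', σ x (A x) ∈ L.D x := fun y hy =>
    hL.mem y (hW (hW' hy)) _ (antiField_mem (hL.subset (hW (hW' hy))) _)
  have hπ : C.π x (σ x (A x)) = z := by rw [hL.split.right_inv x (hW hx), hAx]
  have hsm := hL.split.smooth W' A (hW'.trans hW) hAs
  obtain ⟨q, hq, hκ⟩ := hL.bracket_lift (hW'.trans hW) hsm hAD hs' hx'
  rw [(Lifting.hasClass_dbarOp hsm hAD hs' hx' z hπ).eq hq, hκ, hπ]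

theorem rep_dbarOp (hW : W ≤ U) {s : ∀ x, L.Reduced x} (hs : L.ReducedSmooth W s)
    (Z : ∀ x, T01 V x) {y : V} (hy : y ∈ chartDom ℝ x₀ W) :
    rep x₀ κ (fun x => L.dbarOp s x (Z x)) y =
      dbar (reF x₀ (fun x => (Z x : CT V x)) y) (rep x₀ κ s) y := by
  rw [rep, hL.coord_dbarOp hW hs hy.2, (extChartAt 𝓘(ℝ, V) x₀).right_inv hy.1, reF_apply]

theorem contDiffAt_rep (hW : W ≤ U) {s : ∀ x, L.Reduced x} (hs : L.ReducedSmooth W s) {y : V}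
    (hy : y ∈ chartDom ℝ x₀ W) : ContDiffAt ℝ ∞ (rep x₀ κ s) y :=
  ((hL.reducedSmooth_iff hW s).1 hs).contDiffAt ((isOpen_chartDom x₀ W).mem_nhds hy)

end IsLocalModel

/-- The reduction is a smooth vector bundle. -/
theorem Lifting.reduced_isVectorBundle :
    IsVectorBundle (SmoothFn V) L.Reduced L.ReducedSmooth := by
  let b := Module.finBasis ℂ (ModelFibre V)
  refine isVectorBundle_of_coord b (fun U W s hW h => ReducedSmooth.mono hW h)
    (fun U s h => reducedSmooth_of_local h) (fun U f g hfg hf => ?_) fun x₀ => ?_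
  · exact ContMDiffOn.congr hf fun x hx => (hfg x hx).symm
  · obtain ⟨U, hx₀, κ, σ, hL⟩ := L.exists_localModel x₀
    refine ⟨U, hx₀, κ, hL.bijective, fun W s hW => ?_⟩
    have hWs : (W : Set X) ⊆ (extChartAt 𝓘(ℝ, V) x₀).source := fun x hx => hL.subset (hW hx)
    rw [hL.reducedSmooth_iff hW]
    refine Iff.trans ?_ (forall_congr' fun i => (contMDiffOn_iff_chart hWs _).symm)
    constructor
    · intro h i
      exact ((coordL b i).restrictScalars ℝ).contDiff.comp_contDiffOn h
    · intro h
      have e : rep x₀ κ s = fun y => ∑ i, (b.coord i) (rep x₀ κ s y) • b i := by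
        funext y
        exact (b.sum_repr _).symm
      rw [e]
      exact ContDiffOn.sum fun i _ => (h i).smul (contDiffOn_const (c := b i))

/-- The operator `∂̄` of the reduction. -/
def Lifting.dolbeault : DolbeaultOperator V L.Reduced L.ReducedSmooth where
  op := L.dbarOp
  smooth U s Z hs hZ := by
    refine reducedSmooth_of_local fun x hx => ?_
    obtain ⟨σ, hL⟩ := L.exists_isLocalModel x
    refine ⟨U ⊓ L.modelDom x, ⟨hx, L.mem_modelDom x⟩, inf_le_left, ?_⟩
    rw [hL.reducedSmooth_iff inf_le_right]
    have hs' := ReducedSmooth.mono (inf_le_left : U ⊓ L.modelDom x ≤ U) hs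
    have hZ' := SmoothCField.mono (inf_le_left : U ⊓ L.modelDom x ≤ U) hZ
    intro y hy
    refine ContDiffAt.contDiffWithinAt ?_
    refine (contDiffAt_dbar_field (hL.contDiffAt_rep inf_le_right hs' hy)
      (hZ'.reF hy)).congr_of_eventuallyEq ?_
    filter_upwards [(isOpen_chartDom x (U ⊓ L.modelDom x)).mem_nhds hy] with z hz using
      hL.rep_dbarOp inf_le_right hs' Z hz
  congr U s s' hs he x hx := by
    refine LinearMap.ext fun z => (L.coordEquiv x).injective ?_
    rw [coordEquiv_apply, coordEquiv_apply, coord_dbarOp_self, coord_dbarOp_self]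
    refine dbar_congr ?_ _
    have hy := mem_chartDom (𝕜 := ℝ) (V := V) (mem_extChartAt_source x) hx
    filter_upwards [(isOpen_chartDom x U).mem_nhds hy] with y hy
    rw [rep, rep, he _ hy.2]
  add U s t hs ht x hx := by
    obtain ⟨σ, hL⟩ := L.exists_isLocalModel x
    refine LinearMap.ext fun z => (L.coordEquiv x).injective ?_
    rw [LinearMap.add_apply, map_add]
    simp only [coordEquiv_apply, coord_dbarOp_self]
    have hy := mem_chartDom (𝕜 := ℝ) (V := V) (mem_extChartAt_source x)
      (show x ∈ U ⊓ L.modelDom x from ⟨hx, L.mem_modelDom x⟩)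
    have d : ∀ {s}, L.ReducedSmooth U s → DifferentiableAt ℝ (rep x (L.modelCoord x) s)
        (extChartAt 𝓘(ℝ, V) x x) := fun h =>
      (hL.contDiffAt_rep inf_le_right (ReducedSmooth.mono inf_le_left h) hy).differentiableAt
        (by simp)
    rw [← dbar_add (d hs) (d ht)]
    congr 1
    funext y
    exact map_add _ _ _
  leibniz U f s hf hs x hx z := by
    obtain ⟨σ, hL⟩ := L.exists_isLocalModel x
    apply (L.coordEquiv x).injective
    rw [map_add, map_smul, map_smul]
    simp only [coordEquiv_apply, coord_dbarOp_self]
    have hyU := mem_chartDom (𝕜 := ℝ) (V := V) (mem_extChartAt_source x) hx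
    have hy := mem_chartDom (𝕜 := ℝ) (V := V) (mem_extChartAt_source x)
      (show x ∈ U ⊓ L.modelDom x from ⟨hx, L.mem_modelDom x⟩)
    have hxx : (extChartAt 𝓘(ℝ, V) x).symm (extChartAt 𝓘(ℝ, V) x x) = x := extChartAt_to_inv x
    have d : DifferentiableAt ℝ (rep x (L.modelCoord x) s) (extChartAt 𝓘(ℝ, V) x x) :=
      (hL.contDiffAt_rep inf_le_right (ReducedSmooth.mono inf_le_left hs) hy).differentiableAt
        (by simp)
    have df : DifferentiableAt ℝ (fun y => f ((extChartAt 𝓘(ℝ, V) x).symm y))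
        (extChartAt 𝓘(ℝ, V) x x) := (contDiffAt_chart hf hyU).differentiableAt (by simp)
    set v := reCoord x x (z : CT V x) with hv
    have hz : (z : CT V x) = antiField x v x :=
      (antiField_reCoord (mem_extChartAt_source x) z.2).symm
    have hdf : ∀ u : V, dFn (V := V) f x (chartDinv ℝ x (extChartAt 𝓘(ℝ, V) x x) u) =
        fderiv ℝ (fun y => f ((extChartAt 𝓘(ℝ, V) x).symm y)) (extChartAt 𝓘(ℝ, V) x x) u := by
      intro u
      have h := mfderiv_chartDinv hf hyU u
      rw [hxx] at h
      exact h
    -- The differential of `f` on the `(0,1)`-vector `z` is `dbar` of its coordinate expression.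
    have hev : ev (dFn f x) (z : CT V x) = dbar v (fun y => f ((extChartAt 𝓘(ℝ, V) x).symm y))
        (extChartAt 𝓘(ℝ, V) x x) := by
      rw [hz, antiField, ev_mkCT, dbar, ← hdf, ← hdf]
      rfl
    have hrep : rep x (L.modelCoord x) (fun y => f y • s y) =
        fun y => f ((extChartAt 𝓘(ℝ, V) x).symm y) • rep x (L.modelCoord x) s y := by
      funext y
      exact map_smul _ _ _
    rw [hrep, hev, ← hL.rep_apply _ s (L.mem_modelDom x)]
    have h := df.hasFDerivAt.fun_smul d.hasFDerivAt
    simp only [dbar]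
    rw [h.fderiv, hxx]
    simp only [add_apply, smul_apply, ContinuousLinearMap.smulRight_apply, smul_add, smul_smul,
      smul_eq_mul]
    rw [mul_comm Complex.I (f x)]
    have hadd : ∀ (a b : ℂ) (q : ModelFibre V), (a + b) • q = a • q + b • q :=
      fun a b q => Prod.ext (add_smul a b q.1) (add_smul a b q.2)
    rw [hadd]
    abel
  flat U s Z W B hs hZ hW hB x hx := by
    obtain ⟨σ, hL⟩ := L.exists_isLocalModel x
    apply (L.coordEquiv x).injective
    rw [map_sub]
    simp only [coordEquiv_apply, coord_dbarOp_self]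
    set N := U ⊓ L.modelDom x
    have hNU : N ≤ U := inf_le_left
    have hs' := ReducedSmooth.mono hNU hs
    have hZ' := hZ.mono hNU
    have hW' := hW.mono hNU
    have hy := mem_chartDom (𝕜 := ℝ) (V := V) (mem_extChartAt_source x)
      (show x ∈ N from ⟨hx, L.mem_modelDom x⟩)
    have hxx : (extChartAt 𝓘(ℝ, V) x).symm (extChartAt 𝓘(ℝ, V) x x) = x := extChartAt_to_inv x
    set y := extChartAt 𝓘(ℝ, V) x x
    have hG := hL.contDiffAt_rep inf_le_right hs' hy
    have key : ∀ Z : ∀ x, T01 V x, rep x (L.modelCoord x) (fun x => L.dbarOp s x (Z x)) =ᶠ[nhds y]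
        fun y => dbar (reF x (fun x => (Z x : CT V x)) y) (rep x (L.modelCoord x) s) y := by
      intro Z
      filter_upwards [(isOpen_chartDom x N).mem_nhds hy] with z hz using
        hL.rep_dbarOp inf_le_right hs' Z hz
    have hre : ∀ Z : ∀ x, T01 V x, reCoord x x (Z x : CT V x) =
        reF x (fun x => (Z x : CT V x)) y := by
      intro Z
      rw [reF_apply, hxx]
    have him : ∀ Z : ∀ x, T01 V x, ∀ y ∈ chartDom ℝ x N, imF x (fun x => (Z x : CT V x)) y =
        Complex.I • reF x (fun x => (Z x : CT V x)) y := by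
      intro Z y hy
      have h := fieldInChart_holPart x (fun x => (Z x : CT V x)) hy.1
      have h0 : fieldInChart ℂ x (fun x => holPart x (Z x : CT V x)) y = 0 := by
        have e := (mem_T01_iff _ _).1 (Z ((extChartAt 𝓘(ℝ, V) x).symm y)).2
        exact (congrArg (chartD (V := V) ℂ x _) e).trans (map_zero _)
      rw [h0] at h
      have h4 := congrArg (fun w => Complex.I • w) h
      simp only [smul_add, smul_smul, Complex.I_mul_I, neg_smul, one_smul, smul_zero] at h4
      exact (eq_of_sub_eq_zero ((sub_eq_add_neg _ _).trans h4.symm)).symm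
    have himD : ∀ Z : ∀ x, T01 V x, SmoothCField N (fun x => (Z x : CT V x)) → ∀ u,
        fderiv ℝ (imF x (fun x => (Z x : CT V x))) y u =
          Complex.I • fderiv ℝ (reF x (fun x => (Z x : CT V x))) y u := by
      intro Z hZ u
      have h : imF x (fun x => (Z x : CT V x)) =ᶠ[nhds y]
          fun y => Complex.I • reF x (fun x => (Z x : CT V x)) y := by
        filter_upwards [(isOpen_chartDom x N).mem_nhds hy] with z hz using him Z z hz
      rw [h.fderiv_eq, fderiv_fun_const_smul ((hZ.reF hy).differentiableAt (by simp))]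
      rfl
    have hd : ∀ Z : ∀ x, T01 V x, SmoothCField N (fun x => (Z x : CT V x)) →
        DifferentiableAt ℝ (reF x (fun x => (Z x : CT V x))) y := fun Z hZ =>
      (hZ.reF hy).differentiableAt (by simp)
    have : CompleteSpace V := FiniteDimensional.complete ℂ V
    have hBx : reCoord x x (B x : CT V x) = reF x (cLie (fun y => (Z y : CT V y))
        (fun y => (W y : CT V y))) y := by
      rw [reF_apply, hxx, hB x hx]
    -- The second-order terms cancel because constant-direction operators commute. The remaining
    -- first-order terms differentiate along the bracket of the two fields, their imaginary parts
    -- being `i` times their real parts.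
    rw [hre Z, hre W, hBx, reF_cLie hZ' hW' hy, dbar_congr (key W), dbar_congr (key Z),
      dbar_dbar_field hG (hd W hW'), dbar_dbar_field hG (hd Z hZ'), him Z y hy, him W y hy,
      himD W hW', himD Z hZ', dbar_comm hG (reF x (fun x => (Z x : CT V x)) y)]
    simp only [sub_eq_add_neg, dbar_vec_add, ← neg_one_smul ℂ (_ : V), dbar_vec_smul]
    simp only [star_neg, star_one, neg_smul, one_smul, neg_add, neg_neg]
    abel

end Dolbeault

/-! ### The Courant bracket on the model `V × V*`. -/

section ModelBracket

variable {V : Type*} [NormedAddCommGroup V] [NormedSpace ℂ V]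

/-- The Courant bracket of two holomorphic sections of the model. -/
def modelBracket (F G : V → ModelFibre V) (y : V) : ModelFibre V :=
  ((fderiv ℂ G y (F y).1).1 - (fderiv ℂ F y (G y).1).1,
    (fderiv ℂ G y (F y).1).2 +
      (G y).2.comp ((ContinuousLinearMap.fst ℂ V (V →L[ℂ] ℂ)).comp (fderiv ℂ F y)) -
      (fderiv ℂ F y (G y).1).2 +
      (ContinuousLinearMap.apply ℂ ℂ (G y).1).comp
        ((ContinuousLinearMap.snd ℂ V (V →L[ℂ] ℂ)).comp (fderiv ℂ F y)))

theorem modelBracket_snd_apply (F G : V → ModelFibre V) (y v : V) :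
    (modelBracket F G y).2 v = (fderiv ℂ G y (F y).1).2 v + (G y).2 (fderiv ℂ F y v).1 -
      (fderiv ℂ F y (G y).1).2 v + (fderiv ℂ F y v).2 (G y).1 := rfl

theorem modelBracket_congr {F F' G G' : V → ModelFibre V} {y : V} (hF : F =ᶠ[nhds y] F')
    (hG : G =ᶠ[nhds y] G') : modelBracket F G y = modelBracket F' G' y := by
  rw [modelBracket, modelBracket, hF.fderiv_eq, hG.fderiv_eq, hF.eq_of_nhds, hG.eq_of_nhds]

theorem contDiffOn_modelBracket {F G : V → ModelFibre V} {O : Set V} (hO : IsOpen O)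
    (hF : ContDiffOn ℂ ∞ F O) (hG : ContDiffOn ℂ ∞ G O) :
    ContDiffOn ℂ ∞ (modelBracket F G) O := by
  have dF : ContDiffOn ℂ ∞ (fderiv ℂ F) O := hF.fderiv_of_isOpen hO (by simp)
  have dG : ContDiffOn ℂ ∞ (fderiv ℂ G) O := hG.fderiv_of_isOpen hO (by simp)
  have h1 := dG.clm_apply hF.fst
  have h2 := dF.clm_apply hG.fst
  refine (h1.fst.sub h2.fst).prodMk (((h1.snd.add (hG.snd.clm_comp
    (contDiffOn_const.clm_comp dF))).sub h2.snd).add (ContDiffOn.clm_comp ?_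
      (contDiffOn_const.clm_comp dF)))
  exact (ContinuousLinearMap.contDiff (F := (V →L[ℂ] ℂ) →L[ℂ] ℂ)
    (ContinuousLinearMap.apply ℂ ℂ)).comp_contDiffOn hG.fst

end ModelBracket

/-! ### Holomorphic sections, pairing and bracket of the reduction. -/

section Reduction

variable {V : Type*} [NormedAddCommGroup V] [NormedSpace ℂ V]
  {X : Type*} [TopologicalSpace X] [ChartedSpace V X] [IsManifold 𝓘(ℂ, V) ∞ X]
  {E : X → Type*} [∀ x, AddCommGroup (E x)] [∀ x, Module ℂ (E x)]
  {C : ComplexCourantAlgebroid V E} (L : Lifting C)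

namespace Lifting

/-- The inclusion of the holomorphic cotangent bundle in the reduction. -/
def reducedι (x : X) : HForm V x →ₗ[ℂ] L.Reduced x :=
  ((L.D x).submoduleOf (L.perp x)).mkQ ∘ₗ
    LinearMap.codRestrict (L.perp x) (C.ι x ∘ₗ holFormL x) fun ζ d hd => by
      change C.pairing x (C.ι x (holForm x ζ)) d = 0
      rw [C.pairing_ι, ev_holForm, (mem_T01_iff x _).1 (L.π_mem hd), map_zero, mul_zero]

theorem hasClass_reducedι (x : X) (ζ : HForm V x) :
    L.HasClass (C.ι x (holForm x ζ)) (L.reducedι x ζ) := ⟨_, rfl⟩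

/-- The projection of the reduction to the holomorphic tangent bundle. -/
def reducedπ (x : X) : L.Reduced x →ₗ[ℂ] HT V x :=
  ((L.D x).submoduleOf (L.perp x)).liftQ (holPart x ∘ₗ C.π x ∘ₗ (L.perp x).subtype) fun _ hd =>
    (mem_T01_iff x _).1 (L.π_mem hd)

variable {L}

theorem HasClass.reducedπ {x : X} {a : E x} {q : L.Reduced x} (h : L.HasClass a q) :
    L.reducedπ x q = holPart x (C.π x a) := by
  obtain ⟨h, rfl⟩ := h
  rfl

variable (L) in
/-- The holomorphic sections of the reduction. -/
def IsHol [FiniteDimensional ℂ V] (U : Opens X) (s : ∀ x, L.Reduced x) : Prop :=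
  L.ReducedSmooth U s ∧ ∀ x ∈ U, L.dbarOp s x = 0

theorem IsHol.mono [FiniteDimensional ℂ V] {U W : Opens X} (hW : W ≤ U) {s : ∀ x, L.Reduced x}
    (h : L.IsHol U s) : L.IsHol W s := ⟨ReducedSmooth.mono hW h.1, fun x hx => h.2 x (hW hx)⟩

theorem isHol_of_local [FiniteDimensional ℂ V] {U : Opens X} {s : ∀ x, L.Reduced x}
    (h : ∀ x ∈ U, ∃ W : Opens X, x ∈ W ∧ W ≤ U ∧ L.IsHol W s) : L.IsHol U s := by
  refine ⟨reducedSmooth_of_local fun x hx => ?_, fun x hx => ?_⟩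
  · obtain ⟨W, hxW, hW, h⟩ := h x hx
    exact ⟨W, hxW, hW, h.1⟩
  · obtain ⟨W, hxW, hW, h⟩ := h x hx
    exact h.2 x hxW

end Lifting

namespace IsLocalModel

variable {L} {x₀ : X} {U W : Opens X} {σ : ∀ x, CT V x →ₗ[ℂ] E x}
  {κ : ∀ x, L.Reduced x →ₗ[ℂ] ModelFibre V} (hL : IsLocalModel L x₀ U σ κ)

include hL

/-- In the model the operator is the `∂̄` of the chart along every direction, so its smooth
solutions are the holomorphic maps. -/
theorem isHol_iff [FiniteDimensional ℂ V] (hW : W ≤ U) (s : ∀ x, L.Reduced x) :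
    L.IsHol W s ↔ ContDiffOn ℂ ∞ (rep x₀ κ s) (chartDom ℝ x₀ W) := by
  rw [contDiffOn_complex_iff (isOpen_chartDom x₀ W), Lifting.IsHol, hL.reducedSmooth_iff hW]
  refine and_congr_right fun hs => ?_
  rw [← hL.reducedSmooth_iff hW] at hs
  constructor
  · intro h y hy v
    have hx := hL.subset (hW hy.2)
    have h1 := hL.coord_dbarOp hW hs hy.2 ⟨antiField x₀ v _, antiField_mem hx v⟩
    rw [h _ hy.2, LinearMap.zero_apply, map_zero, (extChartAt 𝓘(ℝ, V) x₀).right_inv hy.1,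
      reCoord_antiField hx] at h1
    exact h1.symm
  · intro h x hx
    refine LinearMap.ext fun z => (hL.bijective x (hW hx)).1 ?_
    rw [hL.coord_dbarOp hW hs hx, LinearMap.zero_apply, map_zero]
    exact h _ (mem_chartDom (hL.subset (hW hx)) hx) _

theorem hvec_reducedπ {x : X} (hx : x ∈ U) (q : L.Reduced x) :
    hvec x₀ x (L.reducedπ x q) = (κ x q).1 := by
  obtain ⟨a, ha⟩ := Lifting.exists_hasClass q
  rw [ha.reducedπ, (hL.of_hasClass hx ha).2]

theorem coord_reducedι {x : X} (hx : x ∈ U) (φ : V →L[ℂ] ℂ) :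
    κ x (L.reducedι x (hform x₀ x φ)) = (0, φ) := by
  obtain ⟨q, hq, hκ⟩ := hL.hasClass x hx 0 φ
  rw [map_zero, zero_add] at hq
  rw [(L.hasClass_reducedι x _).eq hq, hκ, map_zero, map_zero]

theorem rep_reducedι (ξ : ∀ x : X, HForm V x) {y : V} (hy : y ∈ chartDom ℝ x₀ U) :
    rep x₀ κ (fun x => L.reducedι x (ξ x)) y = (0, formInChart ℂ x₀ ξ y) := by
  have h : ξ ((extChartAt 𝓘(ℝ, V) x₀).symm y) =
      hform x₀ ((extChartAt 𝓘(ℝ, V) x₀).symm y) (formInChart ℂ x₀ ξ y) := by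
    refine ContinuousLinearMap.ext fun a => ?_
    exact (congrArg (ξ _) (chartDinv_chartD (𝕜 := ℂ) (x₀ := x₀) hy.1 (asHVec a))).symm
  rw [rep, h]
  exact hL.coord_reducedι hy.2 _

end IsLocalModel

variable [FiniteDimensional ℂ V]

namespace Lifting

/-- The pairing of the reduction. -/
def reducedPairing (x : X) : L.Reduced x →ₗ[ℂ] L.Reduced x →ₗ[ℂ] ℂ :=
  LinearMap.mk₂ ℂ (fun p q => (1 / 2) * ((L.coordEquiv x p).2 (L.coordEquiv x q).1 +
    (L.coordEquiv x q).2 (L.coordEquiv x p).1))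
    (fun p p' q => by simp only [map_add, Prod.snd_add, Prod.fst_add, add_apply]; ring)
    (fun c p q => by
      simp only [map_smul, Prod.smul_snd, Prod.smul_fst, smul_apply, smul_eq_mul]; ring)
    (fun p q q' => by simp only [map_add, Prod.snd_add, Prod.fst_add, add_apply]; ring)
    (fun c p q => by
      simp only [map_smul, Prod.smul_snd, Prod.smul_fst, smul_apply, smul_eq_mul]; ring)

/-- The bracket of the reduction. -/
def reducedBracket (s t : ∀ x, L.Reduced x) (x : X) : L.Reduced x :=
  (L.coordEquiv x).symm (modelBracket (rep x (L.modelCoord x) s) (rep x (L.modelCoord x) t)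
    (extChartAt 𝓘(ℝ, V) x x))

variable {L}

theorem reducedPairing_eq {x : X} {a b : E x} {p q : L.Reduced x} (ha : L.HasClass a p)
    (hb : L.HasClass b q) : L.reducedPairing x p q = C.pairing x a b := by
  obtain ⟨σ, hL⟩ := L.exists_isLocalModel x
  rw [hL.pairing_eq (L.mem_modelDom x) ha hb]
  rfl

theorem reducedPairing_symm (x : X) (p q : L.Reduced x) :
    L.reducedPairing x p q = L.reducedPairing x q p := by
  obtain ⟨a, ha⟩ := exists_hasClass p
  obtain ⟨b, hb⟩ := exists_hasClass q
  rw [reducedPairing_eq ha hb, reducedPairing_eq hb ha, C.pairing_symm]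

/-- Pairing with `(0, ψ)` and `(v, 0)` detects the two components, functionals separating the points
of `V`. -/
theorem reducedPairing_nondegenerate (x : X) (p : L.Reduced x)
    (h : ∀ q, L.reducedPairing x p q = 0) : p = 0 := by
  have h1 : ∀ m : ModelFibre V, (L.coordEquiv x p).2 m.1 + m.2 (L.coordEquiv x p).1 = 0 := by
    intro m
    have h2 : (1 / 2) * ((L.coordEquiv x p).2 (L.coordEquiv x ((L.coordEquiv x).symm m)).1 +
      (L.coordEquiv x ((L.coordEquiv x).symm m)).2 (L.coordEquiv x p).1) = 0 :=
      h ((L.coordEquiv x).symm m)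
    rw [LinearEquiv.apply_symm_apply] at h2
    simpa using h2
  apply (L.coordEquiv x).injective
  rw [map_zero]
  refine Prod.ext ?_ (ContinuousLinearMap.ext fun v => ?_)
  · exact SeparatingDual.eq_zero_of_forall_dual_eq_zero (R := ℂ) fun ψ => by simpa using h1 (0, ψ)
  · simpa using h1 (v, 0)

end Lifting

namespace IsLocalModel

variable {L} {x₀ : X} {U W : Opens X} {σ : ∀ x, CT V x →ₗ[ℂ] E x}
  {κ : ∀ x, L.Reduced x →ₗ[ℂ] ModelFibre V} (hL : IsLocalModel L x₀ U σ κ)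

include hL

theorem reducedPairing_eq {x : X} (hx : x ∈ U) (p q : L.Reduced x) :
    L.reducedPairing x p q = (1 / 2) * ((κ x p).2 (κ x q).1 + (κ x q).2 (κ x p).1) := by
  obtain ⟨a, ha⟩ := Lifting.exists_hasClass p
  obtain ⟨b, hb⟩ := Lifting.exists_hasClass q
  rw [Lifting.reducedPairing_eq ha hb, hL.pairing_eq hx ha hb]

/-- The coordinate derivatives of holomorphic sections are complex linear, so the bracket formula
involves the anchors only through `reF + i imF`. The `(0,1)`-ambiguity of the lifts disappears,
which is why the bracket descends. -/
theorem bracket_hol (hW : W ≤ U) {s t : ∀ x, L.Reduced x} {s' t' : ∀ x, E x} (hs : L.IsHol W s)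
    (ht : L.IsHol W t) (hs' : L.IsLift W s s') (ht' : L.IsLift W t t') {x : X} (hx : x ∈ W) :
    ∃ q, L.HasClass (C.bracket s' t' x) q ∧
      κ x q = modelBracket (rep x₀ κ s) (rep x₀ κ t) (extChartAt 𝓘(ℝ, V) x₀ x) := by
  have hxs := hL.subset (hW hx)
  have hy := mem_chartDom (𝕜 := ℝ) (V := V) hxs hx
  have hxx := (extChartAt 𝓘(ℝ, V) x₀).left_inv hxs
  have hO := (isOpen_chartDom (𝕜 := ℝ) (V := V) x₀ W).mem_nhds hy
  have hd : ∀ {s : ∀ x, L.Reduced x}, L.IsHol W s → ∀ u,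
      fderiv ℝ (rep x₀ κ s) (extChartAt 𝓘(ℝ, V) x₀ x) u =
        fderiv ℂ (rep x₀ κ s) (extChartAt 𝓘(ℝ, V) x₀ x) u := by
    intro s h u
    have := (((hL.isHol_iff hW s).1 h).contDiffAt hO).differentiableAt (by simp)
    rw [this.fderiv_restrictScalars ℝ]
    rfl
  have hf : ∀ {s : ∀ x, L.Reduced x} {s' : ∀ x, E x}, L.IsLift W s s' →
      reF x₀ (fun x => C.π x (s' x)) (extChartAt 𝓘(ℝ, V) x₀ x) +
        Complex.I • imF x₀ (fun x => C.π x (s' x)) (extChartAt 𝓘(ℝ, V) x₀ x) =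
        (rep x₀ κ s (extChartAt 𝓘(ℝ, V) x₀ x)).1 := by
    intro s s' h
    rw [← fieldInChart_holPart x₀ (fun x => C.π x (s' x)) hy.1,
      ← (hL.isLocalRep hW h).fst x hx]
    unfold fieldInChart
    rw [extChartAt_complex, hxx]
    rfl
  have h := hL.bracket hW (hL.isLocalRep hW hs') (hL.isLocalRep hW ht') hy
    (p := modelBracket (rep x₀ κ s) (rep x₀ κ t) (extChartAt 𝓘(ℝ, V) x₀ x)) ?_ fun v => ?_
  · rwa [hxx] at h
  · simp only [hd hs, hd ht, modelBracket, ← hf hs', ← hf ht', map_add, map_smul, Prod.fst_add,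
      Prod.smul_fst]
  · simp only [hd hs, hd ht, modelBracket_snd_apply, ← hf hs', ← hf ht', map_add, map_smul,
      Prod.snd_add, Prod.smul_snd, add_apply, smul_apply, smul_eq_mul]

end IsLocalModel

namespace Lifting

variable {L}

/-- The bracket of the reduction is induced by the bracket. -/
theorem hasClass_reducedBracket {U : Opens X} {s t : ∀ x, L.Reduced x} {s' t' : ∀ x, E x}
    (hs : L.IsHol U s) (ht : L.IsHol U t) (hs' : L.IsLift U s s') (ht' : L.IsLift U t t') {x : X}
    (hx : x ∈ U) : L.HasClass (C.bracket s' t' x) (L.reducedBracket s t x) := by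
  obtain ⟨σ, hL⟩ := L.exists_isLocalModel x
  have hW : U ⊓ L.modelDom x ≤ U := inf_le_left
  obtain ⟨q, hq, hκ⟩ := hL.bracket_hol inf_le_right (hs.mono hW) (ht.mono hW) (hs'.mono hW)
    (ht'.mono hW) ⟨hx, L.mem_modelDom x⟩
  have h : q = L.reducedBracket s t x := (LinearEquiv.eq_symm_apply _).2 hκ
  rwa [← h]

theorem reducedBracket_local {U : Opens X} {s s' t t' : ∀ x, L.Reduced x}
    (hs : ∀ x ∈ U, s x = s' x) (ht : ∀ x ∈ U, t x = t' x) {x : X} (hx : x ∈ U) :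
    L.reducedBracket s t x = L.reducedBracket s' t' x := by
  have hO := (isOpen_chartDom x U).mem_nhds
    (mem_chartDom (𝕜 := ℝ) (V := V) (mem_extChartAt_source x) hx)
  refine congrArg (L.coordEquiv x).symm (modelBracket_congr ?_ ?_)
  · filter_upwards [hO] with y hy
    rw [rep, rep, hs _ hy.2]
  · filter_upwards [hO] with y hy
    rw [rep, rep, ht _ hy.2]

end Lifting

namespace IsLocalModel

variable {L} {x₀ : X} {U W : Opens X} {σ : ∀ x, CT V x →ₗ[ℂ] E x}
  {κ : ∀ x, L.Reduced x →ₗ[ℂ] ModelFibre V} (hL : IsLocalModel L x₀ U σ κ)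

include hL

/-- As for `∂̄`, the bracket is the class of a bracket in `E`, hence is given by the same formula in
every model. -/
theorem coord_reducedBracket (hW : W ≤ U) {s t : ∀ x, L.Reduced x} (hs : L.IsHol W s)
    (ht : L.IsHol W t) {x : X} (hx : x ∈ W) : κ x (L.reducedBracket s t x) =
      modelBracket (rep x₀ κ s) (rep x₀ κ t) (extChartAt 𝓘(ℝ, V) x₀ x) := by
  obtain ⟨W₁, hx₁, hW₁, s', hs'⟩ := hs.1 x hx
  obtain ⟨W₂, hx₂, hW₂, t', ht'⟩ := ht.1 x hx
  have hWW : W₁ ⊓ W₂ ≤ W := inf_le_left.trans hW₁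
  obtain ⟨q, hq, hκ⟩ := hL.bracket_hol (hWW.trans hW) (hs.mono hWW) (ht.mono hWW)
    (hs'.mono inf_le_left) (ht'.mono inf_le_right) ⟨hx₁, hx₂⟩
  rw [← hκ, (Lifting.hasClass_reducedBracket (hs.mono hWW) (ht.mono hWW)
    (hs'.mono inf_le_left) (ht'.mono inf_le_right) ⟨hx₁, hx₂⟩).eq hq]

end IsLocalModel

namespace Lifting

variable {L}

theorem isHol_reducedBracket {U : Opens X} {s t : ∀ x, L.Reduced x} (hs : L.IsHol U s)
    (ht : L.IsHol U t) : L.IsHol U (L.reducedBracket s t) := by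
  refine isHol_of_local fun x hx => ?_
  obtain ⟨σ, hL⟩ := L.exists_isLocalModel x
  have hW : U ⊓ L.modelDom x ≤ U := inf_le_left
  refine ⟨U ⊓ L.modelDom x, ⟨hx, L.mem_modelDom x⟩, hW, (hL.isHol_iff inf_le_right _).2 ?_⟩
  have h1 := (hL.isHol_iff inf_le_right _).1 (hs.mono hW)
  have h2 := (hL.isHol_iff inf_le_right _).1 (ht.mono hW)
  refine (contDiffOn_modelBracket (isOpen_chartDom x _) h1 h2).congr fun y hy => ?_
  rw [rep, hL.coord_reducedBracket inf_le_right (hs.mono hW) (ht.mono hW) hy.2,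
    (extChartAt 𝓘(ℝ, V) x).right_inv hy.1]

theorem isVectorBundle_isHol : IsVectorBundle (HolFn V) L.Reduced L.IsHol := by
  let b := Module.finBasis ℂ (ModelFibre V)
  refine isVectorBundle_of_coord b (fun U W s hW h => h.mono hW)
    (fun U s h => isHol_of_local h) (fun U f g hfg hf => ?_) fun x₀ => ?_
  · exact ContMDiffOn.congr hf fun x hx => (hfg x hx).symm
  · obtain ⟨U, hx₀, κ, σ, hL⟩ := L.exists_localModel x₀
    refine ⟨U, hx₀, κ, hL.bijective, fun W s hW => ?_⟩
    have hWs : (W : Set X) ⊆ (extChartAt 𝓘(ℂ, V) x₀).source := fun x hx => hL.subset (hW hx)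
    rw [hL.isHol_iff hW]
    refine Iff.trans ?_ (forall_congr' fun i => (contMDiffOn_iff_chart hWs _).symm)
    constructor
    · intro h i
      exact (coordL b i).contDiff.comp_contDiffOn h
    · intro h
      have e : rep x₀ κ s = fun y => ∑ i, (b.coord i) (rep x₀ κ s y) • b i := by
        funext y
        exact (b.sum_repr _).symm
      rw [e]
      exact ContDiffOn.sum fun i _ => (h i).smul (contDiffOn_const (c := b i))

theorem isHol_reducedι {U : Opens X} {ξ : ∀ x : X, HForm V x} (hξ : SmoothForm ℂ U ξ) :
    L.IsHol U fun x => L.reducedι x (ξ x) := by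
  refine isHol_of_local fun x hx => ?_
  obtain ⟨σ, hL⟩ := L.exists_isLocalModel x
  refine ⟨U ⊓ L.modelDom x, ⟨hx, L.mem_modelDom x⟩, inf_le_left,
    (hL.isHol_iff inf_le_right _).2 ?_⟩
  refine (contDiffOn_const.prodMk (hξ.mono (inf_le_left : U ⊓ L.modelDom x ≤ U) x)).congr
    fun y hy => hL.rep_reducedι ξ ⟨hy.1, hy.2.2⟩

theorem smoothField_reducedπ {U : Opens X} {s : ∀ x, L.Reduced x} (hs : L.IsHol U s) :
    SmoothField ℂ U fun x => L.reducedπ x (s x) := by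
  refine smoothField_of_local fun x hx => ?_
  obtain ⟨σ, hL⟩ := L.exists_isLocalModel x
  have hW : U ⊓ L.modelDom x ≤ U := inf_le_left
  have hWs : ((U ⊓ L.modelDom x : Opens X) : Set X) ⊆ (extChartAt 𝓘(ℂ, V) x).source :=
    fun z hz => hL.subset hz.2
  refine ⟨U ⊓ L.modelDom x, ⟨hx, L.mem_modelDom x⟩, (smoothField_iff hWs _).2 ?_⟩
  exact ((hL.isHol_iff inf_le_right _).1 (hs.mono hW)).fst.congr fun y hy =>
    hL.hvec_reducedπ hy.2.2 _

theorem holFn_reducedPairing {U : Opens X} {s t : ∀ x, L.Reduced x} (hs : L.IsHol U s)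
    (ht : L.IsHol U t) : HolFn V U fun x => L.reducedPairing x (s x) (t x) := by
  refine contMDiffOn_of_local fun x hx => ?_
  obtain ⟨σ, hL⟩ := L.exists_isLocalModel x
  have hW : U ⊓ L.modelDom x ≤ U := inf_le_left
  have hWs : ((U ⊓ L.modelDom x : Opens X) : Set X) ⊆ (extChartAt 𝓘(ℂ, V) x).source :=
    fun z hz => hL.subset hz.2
  refine ⟨U ⊓ L.modelDom x, ⟨hx, L.mem_modelDom x⟩, (contMDiffOn_iff_chart hWs _).2 ?_⟩
  have h1 := (hL.isHol_iff inf_le_right _).1 (hs.mono hW)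
  have h2 := (hL.isHol_iff inf_le_right _).1 (ht.mono hW)
  exact (contDiffOn_const.mul ((h1.snd.clm_apply h2.fst).add (h2.snd.clm_apply h1.fst))).congr
    fun y hy => hL.reducedPairing_eq hy.2.2 _ _

end Lifting

end Reduction

/-! ### Exactness and holomorphic splittings of the reduction. -/

section Reduction

variable {V : Type*} [NormedAddCommGroup V] [NormedSpace ℂ V] [FiniteDimensional ℂ V]
  {X : Type*} [TopologicalSpace X] [ChartedSpace V X] [IsManifold 𝓘(ℂ, V) ∞ X]
  {E : X → Type*} [∀ x, AddCommGroup (E x)] [∀ x, Module ℂ (E x)]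
  {C : ComplexCourantAlgebroid V E} {L : Lifting C}

namespace Lifting

theorem exists_coord_reducedι (x : X) (ζ : HForm V x) :
    ∃ φ : V →L[ℂ] ℂ, hform x x φ = ζ ∧ L.coordEquiv x (L.reducedι x ζ) = (0, φ) := by
  obtain ⟨σ, hL⟩ := L.exists_isLocalModel x
  obtain ⟨φ, rfl⟩ := hform_surjective (mem_extChartAt_source x) ζ
  exact ⟨φ, rfl, hL.coord_reducedι (L.mem_modelDom x) φ⟩

theorem hvec_reducedπ_self (x : X) (q : L.Reduced x) :
    hvec x x (L.reducedπ x q) = (L.coordEquiv x q).1 := by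
  obtain ⟨σ, hL⟩ := L.exists_isLocalModel x
  exact hL.hvec_reducedπ (L.mem_modelDom x) q

theorem reducedι_injective (x : X) : Function.Injective (L.reducedι x) := by
  refine (injective_iff_map_eq_zero _).2 fun ζ h => ?_
  obtain ⟨φ, rfl, hφ⟩ := L.exists_coord_reducedι x ζ
  rw [h, map_zero] at hφ
  have h2 : (0 : V →L[ℂ] ℂ) = φ := congrArg Prod.snd hφ
  rw [← h2, map_zero]

theorem reduced_exact (x : X) : LinearMap.range (L.reducedι x) = LinearMap.ker (L.reducedπ x) := by
  ext q
  rw [LinearMap.mem_ker]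
  constructor
  · rintro ⟨ζ, rfl⟩
    obtain ⟨φ, rfl, hφ⟩ := L.exists_coord_reducedι x ζ
    have h := L.hvec_reducedπ_self x (L.reducedι x (hform x x φ))
    rw [hφ] at h
    have h2 := hvecInv_hvec (V := V) (mem_extChartAt_source x)
      (L.reducedπ x (L.reducedι x (hform x x φ)))
    rw [h] at h2
    exact h2.symm.trans (map_zero _)
  · intro h
    refine ⟨hform x x (L.coordEquiv x q).2, (L.coordEquiv x).injective ?_⟩
    obtain ⟨φ, hφ, hφ'⟩ := L.exists_coord_reducedι x (hform x x (L.coordEquiv x q).2)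
    have h1 := L.hvec_reducedπ_self x q
    rw [h, map_zero] at h1
    rw [hφ', hform_injective (mem_extChartAt_source x) hφ]
    exact Prod.ext h1 rfl

theorem reducedπ_surjective (x : X) : Function.Surjective (L.reducedπ x) := by
  intro a
  refine ⟨(L.coordEquiv x).symm (hvec x x a, 0), ?_⟩
  have h := L.hvec_reducedπ_self x ((L.coordEquiv x).symm (hvec x x a, 0))
  rw [LinearEquiv.apply_symm_apply] at h
  rw [← hvecInv_hvec (mem_extChartAt_source x) (L.reducedπ x _), h,
    hvecInv_hvec (mem_extChartAt_source x)]

end Lifting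

namespace IsLocalModel

variable {x₀ : X} {U W : Opens X} {σ : ∀ x, CT V x →ₗ[ℂ] E x}
  {κ : ∀ x, L.Reduced x →ₗ[ℂ] ModelFibre V} (hL : IsLocalModel L x₀ U σ κ)

include hL

omit [FiniteDimensional ℂ V] in
/-- A local model of `E` induces a splitting of the reduction. -/
theorem exists_reduced_splitting : ∃ τ : ∀ x, HT V x →ₗ[ℂ] L.Reduced x,
    ∀ x ∈ U, ∀ a, κ x (τ x a) = (hvec x₀ x a, 0) := by
  have key : ∀ x, ∃ τ : HT V x →ₗ[ℂ] L.Reduced x, x ∈ U → ∀ a, κ x (τ a) = (hvec x₀ x a, 0) := by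
    intro x
    by_cases hx : x ∈ U
    · exact ⟨(LinearEquiv.ofBijective (κ x) (hL.bijective x hx)).symm.toLinearMap ∘ₗ
        LinearMap.inl ℂ V (V →L[ℂ] ℂ) ∘ₗ hvec x₀ x, fun _ a =>
          (LinearEquiv.ofBijective (κ x) (hL.bijective x hx)).apply_symm_apply _⟩
    · exact ⟨0, fun h => absurd h hx⟩
  choose τ hτ using key
  exact ⟨τ, hτ⟩

omit [FiniteDimensional ℂ V] in
theorem rep_splitting {τ : ∀ x, HT V x →ₗ[ℂ] L.Reduced x}
    (hτ : ∀ x ∈ U, ∀ a, κ x (τ x a) = (hvec x₀ x a, 0)) (A : ∀ x : X, HT V x)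
    (ξ : ∀ x : X, HForm V x) {y : V} (hy : y ∈ chartDom ℝ x₀ U) :
    rep x₀ κ (fun x => τ x (A x) + L.reducedι x (ξ x)) y =
      (fieldInChart ℂ x₀ A y, formInChart ℂ x₀ ξ y) := by
  have h := hL.rep_reducedι ξ hy
  rw [rep] at h
  rw [rep, map_add, hτ _ hy.2, h, Prod.mk_add_mk, add_zero, zero_add]
  rfl

omit [FiniteDimensional ℂ V] in
theorem reducedπ_splitting {τ : ∀ x, HT V x →ₗ[ℂ] L.Reduced x}
    (hτ : ∀ x ∈ U, ∀ a, κ x (τ x a) = (hvec x₀ x a, 0)) {x : X} (hx : x ∈ U) (a : HT V x) :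
    L.reducedπ x (τ x a) = a := by
  rw [← hvecInv_hvec (hL.subset hx) (L.reducedπ x _), hL.hvec_reducedπ hx, hτ x hx,
    hvecInv_hvec (hL.subset hx)]

theorem isHol_splitting {τ : ∀ x, HT V x →ₗ[ℂ] L.Reduced x}
    (hτ : ∀ x ∈ U, ∀ a, κ x (τ x a) = (hvec x₀ x a, 0)) (hW : W ≤ U) {A : ∀ x : X, HT V x}
    {ξ : ∀ x : X, HForm V x} (hA : SmoothField ℂ W A) (hξ : SmoothForm ℂ W ξ) :
    L.IsHol W fun x => τ x (A x) + L.reducedι x (ξ x) := by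
  have hWs : (W : Set X) ⊆ (extChartAt 𝓘(ℂ, V) x₀).source := fun x hx => hL.subset (hW hx)
  rw [hL.isHol_iff hW]
  exact (((smoothField_iff hWs A).1 hA).prodMk (hξ x₀)).congr fun y hy =>
    hL.rep_splitting hτ A ξ ⟨hy.1, hW hy.2⟩

theorem reducedPairing_splitting {τ : ∀ x, HT V x →ₗ[ℂ] L.Reduced x}
    (hτ : ∀ x ∈ U, ∀ a, κ x (τ x a) = (hvec x₀ x a, 0)) {x : X} (hx : x ∈ U) (a b : HT V x)
    (ξ η : HForm V x) : L.reducedPairing x (τ x a + L.reducedι x ξ) (τ x b + L.reducedι x η) =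
      (1 / 2) * (ξ b + η a) := by
  obtain ⟨φ, rfl⟩ := hform_surjective (hL.subset hx) ξ
  obtain ⟨ψ, rfl⟩ := hform_surjective (hL.subset hx) η
  rw [hL.reducedPairing_eq hx, map_add, map_add, hτ x hx, hτ x hx, hL.coord_reducedι hx,
    hL.coord_reducedι hx, hform_apply, hform_apply]
  simp

/-- Both sides have the same coordinates: for `(A, ξ)` and `(B, η)` the model bracket consists of
the chart expressions of the Lie bracket and of the holomorphic Courant form. -/
theorem reducedBracket_splitting {τ : ∀ x, HT V x →ₗ[ℂ] L.Reduced x}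
    (hτ : ∀ x ∈ U, ∀ a, κ x (τ x a) = (hvec x₀ x a, 0)) (hW : W ≤ U) {A B : ∀ x : X, HT V x}
    {ξ η : ∀ x : X, HForm V x} (hA : SmoothField ℂ W A) (hξ : SmoothForm ℂ W ξ)
    (hB : SmoothField ℂ W B) (hη : SmoothForm ℂ W η) {x : X} (hx : x ∈ W) :
    L.reducedBracket (fun x => τ x (A x) + L.reducedι x (ξ x))
      (fun x => τ x (B x) + L.reducedι x (η x)) x =
      τ x (VectorField.mlieBracket 𝓘(ℂ, V) A B x) + L.reducedι x (hCourantForm A ξ B η x) := by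
  have : CompleteSpace V := FiniteDimensional.complete ℂ V
  have hxs := hL.subset (hW hx)
  have hy := mem_chartDom (𝕜 := ℝ) (V := V) hxs hx
  have hyU := mem_chartDom (𝕜 := ℝ) (V := V) hxs (hW hx)
  have hxx := (extChartAt 𝓘(ℝ, V) x₀).left_inv hxs
  apply (hL.bijective x (hW hx)).1
  rw [hL.coord_reducedBracket hW (hL.isHol_splitting hτ hW hA hξ)
    (hL.isHol_splitting hτ hW hB hη) hx]
  have h1 := hL.rep_splitting hτ (VectorField.mlieBracket 𝓘(ℂ, V) A B) (hCourantForm A ξ B η) hyU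
  rw [hL.rep_apply κ _ (hW hx)] at h1
  rw [h1]
  have e : ∀ (A : ∀ x : X, HT V x) (ξ : ∀ x : X, HForm V x),
      rep x₀ κ (fun x => τ x (A x) + L.reducedι x (ξ x)) =ᶠ[nhds (extChartAt 𝓘(ℝ, V) x₀ x)]
        fun y => (fieldInChart ℂ x₀ A y, formInChart ℂ x₀ ξ y) := by
    intro A ξ
    filter_upwards [(isOpen_chartDom x₀ U).mem_nhds hyU] with y hy using hL.rep_splitting hτ A ξ hy
  rw [modelBracket_congr (e A ξ) (e B η)]
  have d : ∀ {A : ∀ x : X, HT V x} {ξ : ∀ x : X, HForm V x}, SmoothField ℂ W A →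
      SmoothForm ℂ W ξ → ∀ v, fderiv ℂ (fun y => (fieldInChart ℂ x₀ A y, formInChart ℂ x₀ ξ y))
        (extChartAt 𝓘(ℝ, V) x₀ x) v = (fderiv ℂ (fieldInChart ℂ x₀ A) (extChartAt 𝓘(ℝ, V) x₀ x) v,
          fderiv ℂ (formInChart ℂ x₀ ξ) (extChartAt 𝓘(ℝ, V) x₀ x) v) := by
    intro A ξ hA hξ v
    have d1 : DifferentiableAt ℂ (fieldInChart ℂ x₀ A) (extChartAt 𝓘(ℝ, V) x₀ x) :=
      (SmoothField.contDiffAt hA hy).differentiableAt (by simp)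
    have d2 : DifferentiableAt ℂ (formInChart ℂ x₀ ξ) (extChartAt 𝓘(ℝ, V) x₀ x) :=
      (hξ.contDiffAt hy).differentiableAt (by simp)
    rw [(d1.hasFDerivAt.prodMk d2.hasFDerivAt).fderiv]
    rfl
  refine Prod.ext ?_ (ContinuousLinearMap.ext fun v => ?_)
  · simp only [modelBracket, d hA hξ, d hB hη]
    exact (mlieBracket_eq hA hB hy).symm
  · rw [modelBracket_snd_apply]
    simp only [d hA hξ, d hB hη]
    refine Eq.trans ?_ (hCourantForm_eq hξ hη hA B hy v).symm
    rw [extV]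
    ring

end IsLocalModel

/-- The reduction of a complex Courant algebroid by a lifting of `T₀₁X`. -/
def Lifting.reduction (L : Lifting C) : HolomorphicCourantAlgebroid V L.Reduced where
  IsHol := L.IsHol
  isVectorBundle := Lifting.isVectorBundle_isHol
  ι := L.reducedι
  π := L.reducedπ
  ι_hol _ _ := Lifting.isHol_reducedι
  π_hol _ _ := Lifting.smoothField_reducedπ
  ι_injective := Lifting.reducedι_injective
  exact := Lifting.reduced_exact
  π_surjective := Lifting.reducedπ_surjective
  pairing := L.reducedPairing
  pairing_hol _ _ _ := Lifting.holFn_reducedPairing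
  pairing_symm := Lifting.reducedPairing_symm
  pairing_nondegenerate := Lifting.reducedPairing_nondegenerate
  pairing_ι x ξ q := by
    obtain ⟨a, ha⟩ := Lifting.exists_hasClass q
    rw [Lifting.reducedPairing_eq (L.hasClass_reducedι x ξ) ha, C.pairing_ι, ev_holForm,
      ha.reducedπ]
  bracket := L.reducedBracket
  bracket_hol _ _ _ := Lifting.isHol_reducedBracket
  bracket_local _ _ _ _ _ _ _ hs ht _ hx := Lifting.reducedBracket_local hs ht hx
  local_trivialization x₀ := by
    obtain ⟨U, hx₀, κ, σ, hL⟩ := L.exists_localModel x₀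
    obtain ⟨τ, hτ⟩ := hL.exists_reduced_splitting
    refine ⟨U, hx₀, τ, fun x hx a => hL.reducedπ_splitting hτ hx a, fun W A hW hA => ?_,
      fun x hx => hL.reducedPairing_splitting hτ hx,
      fun W A B ξ η hW hA hξ hB hη x hx => hL.reducedBracket_splitting hτ hW hA hξ hB hη hx⟩
    have h0 : SmoothForm ℂ W (0 : ∀ x : X, HForm V x) := by
      intro x₁
      have e : formInChart ℂ x₁ (0 : ∀ x : X, HForm V x) = fun _ => 0 := by
        funext y
        exact ContinuousLinearMap.ext fun v => rfl
      rw [e]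
      exact contDiffOn_const
    have h := hL.isHol_splitting hτ hW hA h0
    simpa using h

theorem Lifting.isReduction (L : Lifting C) : L.IsReduction L.dolbeault L.reduction where
  dbar _ Z _ _ _ _ hZ' hD hs x hx :=
    Lifting.hasClass_dbarOp hZ' (fun x hx => (hD x hx).1) hs hx (Z x) (hD x hx).2
  hol _ _ := Iff.rfl
  ι := L.hasClass_reducedι
  π _ _ _ h := h.reducedπ
  pairing _ _ _ _ _ h h' := Lifting.reducedPairing_eq h h'
  bracket _ _ _ _ _ hs ht hs' ht' _ hx := Lifting.hasClass_reducedBracket hs ht hs' ht' hx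

end Reduction

/-! ## Naturality -/

section Naturality

variable {V : Type*} [NormedAddCommGroup V] [NormedSpace ℂ V]
  {X : Type*} [TopologicalSpace X] [ChartedSpace V X] [IsManifold 𝓘(ℂ, V) ∞ X]
  {E : X → Type*} [∀ x, AddCommGroup (E x)] [∀ x, Module ℂ (E x)]
  {E' : X → Type*} [∀ x, AddCommGroup (E' x)] [∀ x, Module ℂ (E' x)]
  {C : ComplexCourantAlgebroid V E} {L : Lifting C}
  {C' : ComplexCourantAlgebroid V E'} {L' : Lifting C'}
  {Φ : ∀ x, E x ≃ₗ[ℂ] E' x}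

/-- An isomorphism of complex Courant algebroids compatible with liftings induces an isomorphism
of the reductions. -/
theorem exists_reduced_equiv (hΦ : IsComplexCourantIso C C' Φ)
    (hD : ∀ x, (L.D x).map (Φ x : E x →ₗ[ℂ] E' x) = L'.D x) :
    ∃ Ψ : ∀ x, L.Reduced x ≃ₗ[ℂ] L'.Reduced x,
      ∀ (x : X) (a : E x) (q : L.Reduced x), L.HasClass a q → L'.HasClass (Φ x a) (Ψ x q) := by
  have hmem : ∀ x (a : E x), Φ x a ∈ L'.D x ↔ a ∈ L.D x := by
    intro x a
    rw [← hD x, Submodule.mem_map]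
    constructor
    · rintro ⟨b, hb, h⟩
      rwa [← (Φ x).injective h]
    · exact fun h => ⟨a, h, rfl⟩
  have hperp : ∀ x (a : E x), Φ x a ∈ L'.perp x ↔ a ∈ L.perp x := by
    intro x a
    constructor
    · intro h d hd
      rw [← hΦ.pairing]
      exact h _ ((hmem x d).2 hd)
    · intro h d hd
      rw [← (Φ x).apply_symm_apply d, hΦ.pairing]
      exact h _ ((hmem x _).1 (by rwa [LinearEquiv.apply_symm_apply]))
  have hmap : ∀ x, (L.perp x).map (Φ x : E x →ₗ[ℂ] E' x) = L'.perp x := by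
    intro x
    ext b
    rw [Submodule.mem_map]
    constructor
    · rintro ⟨a, ha, rfl⟩
      exact (hperp x a).2 ha
    · exact fun h => ⟨(Φ x).symm b, (hperp x _).1 (by rwa [LinearEquiv.apply_symm_apply]),
        (Φ x).apply_symm_apply b⟩
  let Θ : ∀ x, L.perp x ≃ₗ[ℂ] L'.perp x := fun x => (Φ x).ofSubmodules _ _ (hmap x)
  have hΘ : ∀ x, ((L.D x).submoduleOf (L.perp x)).map (Θ x : L.perp x →ₗ[ℂ] L'.perp x) =
      (L'.D x).submoduleOf (L'.perp x) := by
    intro x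
    ext b
    rw [Submodule.mem_map]
    constructor
    · rintro ⟨a, ha, rfl⟩
      exact (hmem x a).2 ha
    · intro h
      refine ⟨(Θ x).symm b, (hmem x _).1 ?_, (Θ x).apply_symm_apply b⟩
      have h1 : Φ x ((Θ x).symm b : L.perp x) = (b : E' x) :=
        congrArg Subtype.val ((Θ x).apply_symm_apply b)
      exact (congrArg (· ∈ L'.D x) h1).mpr h
  refine ⟨fun x => Submodule.Quotient.equiv _ _ (Θ x) (hΘ x), fun x a q h => ?_⟩
  obtain ⟨h, rfl⟩ := h
  exact ⟨(hperp x a).2 h, rfl⟩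

variable {Ψ : ∀ x, L.Reduced x ≃ₗ[ℂ] L'.Reduced x}

/-- Conversely, `Φ` preserves the pairing and maps `D` into `D'`, so `a` is orthogonal to `D`; its
class is then `q` by injectivity of `Ψ`. -/
theorem hasClass_map_iff
    (hΨ : ∀ (x : X) (a : E x) (q : L.Reduced x), L.HasClass a q → L'.HasClass (Φ x a) (Ψ x q))
    (hΦ : IsComplexCourantIso C C' Φ)
    (hD : ∀ x, (L.D x).map (Φ x : E x →ₗ[ℂ] E' x) = L'.D x) {x : X} {a : E x} {q : L.Reduced x} :
    L'.HasClass (Φ x a) (Ψ x q) ↔ L.HasClass a q := by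
  refine ⟨fun h => ?_, hΨ x a q⟩
  have ha : a ∈ L.perp x := by
    intro d hd
    rw [← hΦ.pairing]
    refine h.1 _ ?_
    rw [← hD x]
    exact ⟨d, hd, rfl⟩
  have h1 : L.HasClass a (Submodule.Quotient.mk (⟨a, ha⟩ : L.perp x)) := ⟨ha, rfl⟩
  rwa [(Ψ x).injective (h.eq (hΨ x a _ h1))]

variable (hΦ : IsComplexCourantIso C C' Φ)
  (hΨ : ∀ {x : X} {a : E x} {q : L.Reduced x}, L'.HasClass (Φ x a) (Ψ x q) ↔ L.HasClass a q)

include hΦ hΨ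

theorem isLift_map_iff (U : Opens X) (s : ∀ x, L.Reduced x) (s' : ∀ x, E x) :
    L'.IsLift U (fun x => Ψ x (s x)) (fun x => Φ x (s' x)) ↔ L.IsLift U s s' :=
  and_congr (hΦ.smooth U s').symm (forall₂_congr fun _ _ => hΨ)

theorem reducedSmooth_map_iff (U : Opens X) (s : ∀ x, L.Reduced x) :
    L.ReducedSmooth U s ↔ L'.ReducedSmooth U (fun x => Ψ x (s x)) := by
  refine forall₂_congr fun x _ => exists_congr fun W => and_congr_right fun _ =>
    and_congr_right fun _ => ⟨fun ⟨s', h⟩ => ⟨_, (isLift_map_iff hΦ hΨ W s s').2 h⟩,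
      fun ⟨s', h⟩ => ⟨fun x => (Φ x).symm (s' x), (isLift_map_iff hΦ hΨ W s _).1 ?_⟩⟩
  simpa using h

/-- `P` and `P'` are known only through brackets with sections of `D` and `D'`. The vector `z` is
therefore extended to a local section of `D`, and `Φ` carries the bracket computing `P` to one
computing `P'`. -/
theorem dolbeault_map [FiniteDimensional ℂ V]
    (hD : ∀ x, (L.D x).map (Φ x : E x →ₗ[ℂ] E' x) = L'.D x)
    {P : DolbeaultOperator V L.Reduced L.ReducedSmooth} {H : HolomorphicCourantAlgebroid V L.Reduced}
    (hP : L.IsReduction P H) {P' : DolbeaultOperator V L'.Reduced L'.ReducedSmooth}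
    {H' : HolomorphicCourantAlgebroid V L'.Reduced} (hP' : L'.IsReduction P' H') {U : Opens X}
    {s : ∀ x, L.Reduced x} (hs : L.ReducedSmooth U s) {x : X} (hx : x ∈ U) (z : T01 V x) :
    Ψ x (P.op s x z) = P'.op (fun y => Ψ y (s y)) x z := by
  obtain ⟨W, hxW, -, s', hs'⟩ := hs x hx
  obtain ⟨U₁, hx₁, κ, σ, hL⟩ := L.exists_localModel x
  set N := W ⊓ U₁
  have hxN : x ∈ N := ⟨hxW, hx₁⟩
  have hsrc : ∀ y ∈ N, y ∈ (extChartAt 𝓘(ℝ, V) x).source := fun y hy => hL.subset hy.2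
  set A : ∀ y : X, CT V y := antiField x (reCoord x x (z : CT V x))
  -- The constant field is of type `(0,1)` only inside the chart; elsewhere the value is zero and
  -- irrelevant.
  have hA : ∀ y, ∃ w : T01 V y, y ∈ N → (w : CT V y) = A y := by
    intro y
    by_cases hy : y ∈ N
    · exact ⟨⟨A y, antiField_mem (hsrc y hy) _⟩, fun _ => rfl⟩
    · exact ⟨0, fun h => absurd h hy⟩
  choose Z hZ using hA
  have hAs : SmoothCField N A := smoothCField_mkCT hsrc contDiffOn_const contDiffOn_const
  have hZs : SmoothCField N fun y => (Z y : CT V y) :=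
    ⟨ContMDiffOn.congr hAs.1 fun y hy =>
      congrArg (fun w => (⟨y, reT y w⟩ : TangentBundle 𝓘(ℝ, V) X)) (hZ y hy),
      ContMDiffOn.congr hAs.2 fun y hy =>
      congrArg (fun w => (⟨y, imT y w⟩ : TangentBundle 𝓘(ℝ, V) X)) (hZ y hy)⟩
  have hZx : Z x = z := Subtype.ext
    ((hZ x hxN).trans (antiField_reCoord (mem_extChartAt_source x) z.2))
  have hσ : C.IsSmooth N fun y => σ y (Z y) := hL.split.smooth N _ inf_le_right hZs
  have hs'' : L.IsLift N s s' :=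
    ⟨C.isVectorBundle.restrict _ _ _ inf_le_left hs'.1, fun y hy => hs'.2 y hy.1⟩
  have h1 := hP.dbar N Z (fun y => σ y (Z y)) s s' hZs hσ (fun y hy =>
    ⟨hL.mem y hy.2 _ (Z y).2, hL.split.right_inv y hy.2 _⟩) hs'' x hxN
  have h2 := hP'.dbar N Z (fun y => Φ y (σ y (Z y))) (fun y => Ψ y (s y)) (fun y => Φ y (s' y)) hZs
    ((hΦ.smooth _ _).1 hσ) (fun y hy => ⟨?_, ?_⟩) ((isLift_map_iff hΦ hΨ _ _ _).2 hs'') x hxN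
  · rw [hZx] at h1 h2
    rw [← hΦ.bracket N _ _ hσ hs''.1 x hxN] at h2
    exact (hΨ.2 h1).eq h2
  · rw [← hD y]
    exact ⟨_, hL.mem y hy.2 _ (Z y).2, rfl⟩
  · rw [hΦ.π, hL.split.right_inv y hy.2]

/-- Each structure of the reduction is determined by its values on representatives in `E`, and `Φ`
maps representatives to representatives. -/
theorem isHolomorphicCourantIso_map [FiniteDimensional ℂ V]
    (hD : ∀ x, (L.D x).map (Φ x : E x →ₗ[ℂ] E' x) = L'.D x)
    {P : DolbeaultOperator V L.Reduced L.ReducedSmooth} {H : HolomorphicCourantAlgebroid V L.Reduced}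
    (hP : L.IsReduction P H) {P' : DolbeaultOperator V L'.Reduced L'.ReducedSmooth}
    {H' : HolomorphicCourantAlgebroid V L'.Reduced} (hP' : L'.IsReduction P' H') :
    IsHolomorphicCourantIso H H' Ψ := by
  have hol : ∀ (U : Opens X) (s : ∀ x, L.Reduced x),
      H.IsHol U s ↔ H'.IsHol U fun x => Ψ x (s x) := by
    intro U s
    rw [hP.hol, hP'.hol, ← reducedSmooth_map_iff hΦ hΨ]
    refine and_congr_right fun hs => forall₂_congr fun x hx => ?_
    rw [LinearMap.ext_iff, LinearMap.ext_iff]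
    refine forall_congr' fun z => ?_
    rw [← dolbeault_map hΦ hΨ hD hP hP' hs hx z]
    simp
  refine ⟨hol, fun x ξ => ?_, fun x q => ?_, fun x p q => ?_, fun U s t hs ht x hx => ?_⟩
  · have h := hΨ.2 (hP.ι x ξ)
    rw [hΦ.ι] at h
    exact h.eq (hP'.ι x ξ)
  · obtain ⟨a, ha⟩ := Lifting.exists_hasClass q
    rw [hP'.π x _ _ (hΨ.2 ha), hP.π x _ _ ha, hΦ.π]
  · obtain ⟨a, ha⟩ := Lifting.exists_hasClass p
    obtain ⟨b, hb⟩ := Lifting.exists_hasClass q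
    rw [hP'.pairing x _ _ _ _ (hΨ.2 ha) (hΨ.2 hb), hP.pairing x _ _ _ _ ha hb, hΦ.pairing]
  -- Smooth lifts exist only locally, which is enough because brackets are compared at a point.
  · obtain ⟨W₁, hx₁, hW₁, s', hs'⟩ := ((hP.hol U s).1 hs).1 x hx
    obtain ⟨W₂, hx₂, hW₂, t', ht'⟩ := ((hP.hol U t).1 ht).1 x hx
    have hN : W₁ ⊓ W₂ ≤ U := inf_le_left.trans hW₁
    have hsN := H.isVectorBundle.restrict _ _ _ hN hs
    have htN := H.isVectorBundle.restrict _ _ _ hN ht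
    have hs'N := hs'.mono (inf_le_left : W₁ ⊓ W₂ ≤ W₁)
    have ht'N := ht'.mono (inf_le_right : W₁ ⊓ W₂ ≤ W₂)
    have h1 := hΨ.2 (hP.bracket _ s t s' t' hsN htN hs'N ht'N x ⟨hx₁, hx₂⟩)
    rw [hΦ.bracket _ s' t' hs'N.1 ht'N.1 x ⟨hx₁, hx₂⟩] at h1
    exact h1.eq (hP'.bracket _ _ _ _ _ ((hol _ _).1 hsN) ((hol _ _).1 htN)
      ((isLift_map_iff hΦ hΨ _ _ _).2 hs'N) ((isLift_map_iff hΦ hΨ _ _ _).2 ht'N) x ⟨hx₁, hx₂⟩)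

end Naturality

end Courant

end

/-! ### The main theorem. -/

theorem mainTheorem9 {V : Type*} [NormedAddCommGroup V] [NormedSpace ℂ V] [FiniteDimensional ℂ V]
    {X : Type*} [TopologicalSpace X] [T2Space X] [SecondCountableTopology X]
    [ChartedSpace V X] [IsManifold 𝓘(ℂ, V) ∞ X]
    {E : X → Type*} [∀ x, AddCommGroup (E x)] [∀ x, Module ℂ (E x)]
    (C : Courant.ComplexCourantAlgebroid V E) (L : Courant.Lifting C) :
    -- the quotient of the orthogonal complement of `D` by `D` is a smooth vector bundle
    Courant.IsVectorBundle (Courant.SmoothFn V) L.Reduced L.ReducedSmooth ∧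
    -- the induced operations are well defined and make it a holomorphic Courant algebroid
    (∃ (P : Courant.DolbeaultOperator V L.Reduced L.ReducedSmooth)
      (H : Courant.HolomorphicCourantAlgebroid V L.Reduced), L.IsReduction P H) ∧
    -- it is natural for isomorphisms of complex Courant algebroids respecting the liftings
    (∀ (P : Courant.DolbeaultOperator V L.Reduced L.ReducedSmooth)
      (H : Courant.HolomorphicCourantAlgebroid V L.Reduced), L.IsReduction P H →
      ∀ (E' : X → Type*) [∀ x, AddCommGroup (E' x)] [∀ x, Module ℂ (E' x)]
        (C' : Courant.ComplexCourantAlgebroid V E') (L' : Courant.Lifting C')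
        (P' : Courant.DolbeaultOperator V L'.Reduced L'.ReducedSmooth)
        (H' : Courant.HolomorphicCourantAlgebroid V L'.Reduced), L'.IsReduction P' H' →
      ∀ Φ : ∀ x, E x ≃ₗ[ℂ] E' x, Courant.IsComplexCourantIso C C' Φ →
        (∀ x, (L.D x).map (Φ x : E x →ₗ[ℂ] E' x) = L'.D x) →
        ∃ Ψ : ∀ x, L.Reduced x ≃ₗ[ℂ] L'.Reduced x,
          (∀ (x : X) (a : E x) (q : L.Reduced x),
            L.HasClass a q → L'.HasClass (Φ x a) (Ψ x q)) ∧
          (∀ (U : TopologicalSpace.Opens X) (s : ∀ x, L.Reduced x),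
            L.ReducedSmooth U s ↔ L'.ReducedSmooth U (fun x => Ψ x (s x))) ∧
          (∀ (U : TopologicalSpace.Opens X) (s : ∀ x, L.Reduced x), L.ReducedSmooth U s →
            ∀ x ∈ U, ∀ z : Courant.T01 V x,
              Ψ x (P.op s x z) = P'.op (fun y => Ψ y (s y)) x z) ∧
          Courant.IsHolomorphicCourantIso H H' Ψ) := by
  refine ⟨L.reduced_isVectorBundle, ⟨L.dolbeault, L.reduction, L.isReduction⟩, ?_⟩
  intro P H hP E' _ _ C' L' P' H' hP' Φ hΦ hD
  obtain ⟨Ψ, hΨ⟩ := Courant.exists_reduced_equiv hΦ hD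
  have hΨ' : ∀ {x : X} {a : E x} {q : L.Reduced x},
      L'.HasClass (Φ x a) (Ψ x q) ↔ L.HasClass a q := Courant.hasClass_map_iff hΨ hΦ hD
  exact ⟨Ψ, hΨ, Courant.reducedSmooth_map_iff hΦ hΨ',
    fun _ _ hs _ hx z => Courant.dolbeault_map hΦ hΨ' hD hP hP' hs hx z,
    Courant.isHolomorphicCourantIso_map hΦ hΨ' hD hP hP'⟩
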